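/- **Setting.** Let $P$ and $P'$ be particles of spin $1/2$ with $\mathcal H_P=\mathcal H_{P'}=L^2(\mathbb R^3;\mathbb C^2)$, let $D$ (a spin filter) have a separable Hilbert space $\mathcal H_D$, and put $Q=P'\vee D$, $\mathcal H_Q=\mathcal H_{P'}\otimes\mathcal H_D$, $\mathcal H=\mathcal H_P\otimes\mathcal H_Q\cong L^2(\mathbb R^3;\mathbb C^2\otimes\mathcal H_Q)$. Let $H_P=-\tfrac{\Delta}{2}\otimes 1$ with domain $H^2(\mathbb R^3;\mathbb C^2)$, let $H_Q$ on $\mathcal H_Q$ and $H$ on $\mathcal H$ be self-adjoint, and suppose that the algebraic tensor product $\mathcal D(H_P)\otimes\mathcal D(H_Q)$ is contained in $\mathcal D(H)$ and in the domain $\mathcal D(H_{P,Q})$ of an operator $H_{P,Q}$, and that $H=H_P\otimes 1+1\otimes H_Q+H_{P,Q}$ on it. Fix a unit vector $\vec e_x\in\mathbb R^3$ and $0<\theta_0<\pi/4$, $v>0$, and let $\mathcal C_{\theta}=\{\vec k:\vec k\cdot\vec e_x\ge|\vec k|\cos\theta\}$ and $\mathcal C_{\theta;v}=\{\vec k\in\mathcal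 C_\theta:|\vec k|>v\}$. The initial state is $$\Psi_0=\frac1{\sqrt{2n}}\sum_{j=1}^n\big(|\phi_{j,P},\downarrow;\psi_{j,P'},\uparrow\rangle-|\phi_{j,P},\uparrow;\psi_{j,P'},\downarrow\rangle\big)\otimes|\chi_j\rangle ,$$ with $\phi_{j,P},\psi_{j,P'}\in L^2(\mathbb R^3)$ of norm $1$ and $\chi_1,\dots,\chi_n\in\mathcal H_D$ orthonormal, and $\Psi_0\in\mathcal D(H_P)\otimes\mathcal D(H_Q)$. **(A1)** There are a nonempty open set $\Omega\subset\mathbb R^3$ at distance $d>0$ from $\mathcal C_{2\theta_0}$, and open cubes $\Omega_n$ ($n\in I\subseteq\mathbb N$) of diameter at most $M$ with $\Omega=\bigcup_{n\in I}\Omega_n$, whose distances $d_n$ from $\mathcal C_{2\theta_0}$ tend to $\infty$ as $n\to\infty$ in $I$, and there are operators $H_{P,Q_n}$ on $\mathcal H$ (with domains containing $\mathcal D(H_{P,Q})$) and $N_n$ on $\mathcal H_Q$, such that: $H_{P,Q}=\sum_{n\in I}H_{P,Q_n}$ strongly on $\mathcal D(H_{P,Q})$; for all $n\in I$ and $\Psi\in\mathcal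 D(H_P)\otimes\mathcal D(H_Q)$, $$\|(H_{P,Q_n}\Psi)(\vec x)\|\le\frac{\|((1\otimes N_n)\Psi)(\vec x)\|}{\mathrm{dist}(\Omega_n,\vec x)^{\alpha}}\quad\text{for a.e. }\vec x\in\Omega^c$$ (the right side being $+\infty$ where $\Psi(\vec x)$ is not in the domain of $1\otimes N_n$); $\sum_{n\in I}d_n^{(1-\alpha)/2}\le C_1d^{-\beta}$; and $[H_{P,Q_n},\vec x]=0$. Here $\alpha>1$, $\beta>0$, $C_1$ and $M$ are constants. **(A2)** $\Psi_0\in\mathcal S(\mathbb R^3;\mathbb C^2\otimes\mathcal H_Q)$, $\|\Psi_0\|=1$, and the Fourier transform $\widehat\Psi_0(\vec k)=(2\pi)^{-3/2}\int e^{-i\vec k\cdot\vec x}\Psi_0(\vec x)\,d^3x$ has support in $\mathcal C_{\theta_0;v}$. **(A3)** $\|(1\otimes N_n)e^{-itH_Q}\Psi_0\|_{L^s(\mathbb R^3;\mathbb C^2\otimes\mathcal H_Q)}<C_2$ for $s\in\{1,2\}$, all $t\ge0$ and all $n\in I$, with a constant $C_2$. **Corollary (No-signaling).** Let $\vec S_P=(\sigma_x,\sigma_y,\sigma_z)$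 be the vector of Pauli matrices acting on the spin of $P$. For every $\eta>0$ there is a distance $d_0>0$, depending only on $\eta$, $v$, $\vec e_x$, $\theta_0$, $\alpha$, $\beta$, $C_1$, $C_2$, $M$ and $n$, $\phi_{1,P},\dots,\phi_{n,P}$, such that whenever the setting above and (A1), (A2), (A3) hold with $d>d_0$, $$\big|\langle e^{-itH}\Psi_0,\ \vec S_P\,e^{-itH}\Psi_0\rangle\big|<\eta\qquad\text{for all }t\ge0 .$$ In particular $d_0$ does not depend on $\mathcal H_D$, on the filter states $\chi_j$, on the $\psi_{j,P'}$, on $H_Q$ or on $H$: whatever measurement the filter performs on $P'$, the expectation of the spin of $P$ is smaller than $\eta$. -/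

import Mathlib

open MeasureTheory Filter Topology
open scoped ENNReal SchwartzMap InnerProductSpace Laplacian

noncomputable section

/-- Physical space `ℝ³`. -/
abbrev Space3 : Type := EuclideanSpace ℝ (Fin 3)

/-- `ℂ² ⊗ K`, realised as the Hilbert sum `K ⊕ K`; component `0` is spin up, component `1` is
spin down. -/
abbrev Spinor (K : Type*) [NormedAddCommGroup K] : Type _ := PiLp 2 (fun _ : Fin 2 => K)

/-- `L²(ℝ³; ℂ) ⊗ ℂ² ⊗ K`, identified with `L²(ℝ³; ℂ² ⊗ K)`. For `K = ℂ` this is the state space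
of one particle of spin `1/2`. -/
abbrev SpinL2 (K : Type*) [NormedAddCommGroup K] : Type _ :=
  Lp (Spinor K) 2 (volume : Measure Space3)

/-- The spin states `|↑⟩` and `|↓⟩` in `ℂ²`. -/
def spinUp : Spinor ℂ := WithLp.toLp 2 ![1, 0]

/-- See `spinUp`. -/
def spinDown : Spinor ℂ := WithLp.toLp 2 ![0, 1]

/-- The one-particle state `|φ, z⟩ = φ ⊗ z`, for a scalar wave function `φ` and `z ∈ ℂ²`. -/
def withSpin (φ : Lp ℂ 2 (volume : Measure Space3)) (z : Spinor ℂ) : SpinL2 ℂ :=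
  (ContinuousLinearMap.toSpanSingleton ℂ z).compLp φ

section Tensor

variable {K : Type*} [NormedAddCommGroup K] [InnerProductSpace ℂ K]

/-- The map `z ↦ z ⊗ q` from `ℂ²` to `ℂ² ⊗ K`. -/
def spinorTensor (q : K) : Spinor ℂ →L[ℂ] Spinor K :=
  LinearMap.toContinuousLinearMap
    { toFun := fun z => WithLp.toLp 2 (fun s => z s • q)
      map_add' := fun z w => by ext s; simp [add_smul]
      map_smul' := fun c z => by ext s; simp [mul_smul] }

/-- The product vector `f ⊗ q`, that is, the function `x ↦ f(x) ⊗ q`. -/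
def tens (f : SpinL2 ℂ) (q : K) : SpinL2 K := (spinorTensor q).compLp f

/-- The operator `M ⊗ 1` on `ℂ² ⊗ K`, for a `2 × 2` matrix `M`. -/
def spinorMap (M : Matrix (Fin 2) (Fin 2) ℂ) : Spinor K →L[ℂ] Spinor K :=
  ((PiLp.continuousLinearEquiv 2 ℂ (fun _ : Fin 2 => K)).symm :
      (Fin 2 → K) →L[ℂ] Spinor K).comp
    (ContinuousLinearMap.pi fun s => ∑ t, M s t • PiLp.proj 2 (fun _ : Fin 2 => K) t)

/-- The Pauli matrices `σ_x, σ_y, σ_z`. -/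
def pauli : Fin 3 → Matrix (Fin 2) (Fin 2) ℂ :=
  ![!![0, 1; 1, 0], !![0, -Complex.I; Complex.I, 0], !![1, 0; 0, -1]]

/-- The component `a` of the spin operator of `P`, acting on `L²(ℝ³; ℂ² ⊗ K)`. -/
def spinOp (a : Fin 3) : SpinL2 K →L[ℂ] SpinL2 K := (spinorMap (pauli a)).compLpL 2 volume

/-- The vector `(⟨Φ, σ_x Φ⟩, ⟨Φ, σ_y Φ⟩, ⟨Φ, σ_z Φ⟩)`. -/
def spinExpectation (Φ : SpinL2 K) : EuclideanSpace ℂ (Fin 3) :=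
  WithLp.toLp 2 (fun a => ⟪Φ, spinOp a Φ⟫_ℂ)

end Tensor

/-! ### Operators and time evolution -/

/-- The graph of `-Δ/2` on `L²(ℝ³; ℂ²)`: pairs `(f, g)` with `-Δf/2 = g` in the sense of
(tempered) distributions. -/
def freeGraph : Submodule ℂ (SpinL2 ℂ × SpinL2 ℂ) where
  carrier := {p | (-(1 / 2) : ℂ) • Δ (Lp.toTemperedDistributionCLM (Spinor ℂ) volume 2 p.1) =
    Lp.toTemperedDistributionCLM (Spinor ℂ) volume 2 p.2}
  add_mem' := by
    intro p q hp hq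
    simp only [Set.mem_ofPred_eq, ← TemperedDistribution.laplacianCLM_apply, Prod.fst_add,
      Prod.snd_add, map_add, smul_add] at *
    rw [hp, hq]
  zero_mem' := by
    simp only [Set.mem_ofPred_eq, ← TemperedDistribution.laplacianCLM_apply, Prod.fst_zero,
      Prod.snd_zero, map_zero, smul_zero]
  smul_mem' := by
    intro c p hp
    simp only [Set.mem_ofPred_eq, ← TemperedDistribution.laplacianCLM_apply, Prod.smul_fst,
      Prod.smul_snd, map_smul] at *
    rw [← hp, smul_comm]

/-- `H_P = -Δ/2 ⊗ 1` on its maximal domain `{f ∈ L² : Δf ∈ L²} = H²(ℝ³; ℂ²)`. -/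
def freeHam : SpinL2 ℂ →ₗ.[ℂ] SpinL2 ℂ := freeGraph.toLinearPMap

/-- `freeGraph` is indeed the graph of `freeHam`. -/
theorem graph_freeHam : freeHam.graph = freeGraph := by
  refine Submodule.toLinearPMap_graph_eq _ ?_
  rintro ⟨f, g⟩ h h0
  have h1 : (-(1 / 2) : ℂ) • Δ (Lp.toTemperedDistributionCLM (Spinor ℂ) volume 2 f) =
    Lp.toTemperedDistributionCLM (Spinor ℂ) volume 2 g := h
  have h2 : f = 0 := h0
  rw [h2, map_zero, ← TemperedDistribution.laplacianCLM_apply, map_zero, smul_zero] at h1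
  have h3 : g ∈ (Lp.toTemperedDistributionCLM (Spinor ℂ) (volume : Measure Space3) 2).ker :=
    h1.symm
  rw [Lp.ker_toTemperedDistributionCLM_eq_bot] at h3
  exact h3

/-- `U t = e^{-itA}` for all `t`: `U` is a strongly continuous one-parameter group of unitaries
whose generator is exactly `A`, so that `i dU(t)ψ/dt = Aψ` at `t = 0` for `ψ` in the domain of `A`,
and for no other `ψ` is `t ↦ U(t)ψ` differentiable at `0`. For a self-adjoint `A` exactly one such
`U` exists, by Stone's theorem. -/
structure IsTimeEvolution {E : Type*} [NormedAddCommGroup E] [InnerProductSpace ℂ E]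
    (A : E →ₗ.[ℂ] E) (U : ℝ → E →L[ℂ] E) : Prop where
  zero : U 0 = ContinuousLinearMap.id ℂ E
  add : ∀ s t, U (s + t) = (U s).comp (U t)
  norm_map : ∀ t ψ, ‖U t ψ‖ = ‖ψ‖
  continuous : ∀ ψ, Continuous fun t => U t ψ
  generator : ∀ ψ ξ, (ψ, ξ) ∈ A.graph ↔ HasDerivAt (fun t => U t ψ) (-Complex.I • ξ) 0

/-! ### The composed system `P ∨ Q` -/

section Model

variable {K : Type*} [NormedAddCommGroup K] [InnerProductSpace ℂ K]

/-- The algebraic tensor product `D(H_P) ⊗ D(H_Q)` inside `L²(ℝ³; ℂ² ⊗ K)`. -/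
def productDomain (HQ : K →ₗ.[ℂ] K) : Submodule ℂ (SpinL2 K) :=
  Submodule.span ℂ {Ψ | ∃ f ∈ freeHam.domain, ∃ q ∈ HQ.domain, Ψ = tens f q}

theorem tens_mem_productDomain (HQ : K →ₗ.[ℂ] K) (f : freeHam.domain) (q : HQ.domain) :
    tens (f : SpinL2 ℂ) (q : K) ∈ productDomain HQ :=
  Submodule.subset_span ⟨f, f.2, q, q.2, rfl⟩

variable (K) in
/-- The Hamiltonians of a particle `P` coupled to a system `Q` with Hilbert space `K`:
`H = H_P ⊗ 1 + 1 ⊗ H_Q + H_{P,Q}` on `D(H_P) ⊗ D(H_Q)`, with `H` and `H_Q` self-adjoint. -/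
structure CoupledSystem [CompleteSpace K] where
  HQ : K →ₗ.[ℂ] K
  HPQ : SpinL2 K →ₗ.[ℂ] SpinL2 K
  H : SpinL2 K →ₗ.[ℂ] SpinL2 K
  isSelfAdjoint_HQ : IsSelfAdjoint HQ
  isSelfAdjoint_H : IsSelfAdjoint H
  le_domain_HPQ : productDomain HQ ≤ HPQ.domain
  le_domain_H : productDomain HQ ≤ H.domain
  H_apply : ∀ (f : freeHam.domain) (q : HQ.domain),
    H ⟨tens (f : SpinL2 ℂ) (q : K), le_domain_H (tens_mem_productDomain HQ f q)⟩ =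
      tens (freeHam f) (q : K) + tens (f : SpinL2 ℂ) (HQ q) +
        HPQ ⟨tens (f : SpinL2 ℂ) (q : K), le_domain_HPQ (tens_mem_productDomain HQ f q)⟩

variable (K) in
/-- The data of the localization of `Q`: the region `Ω`, the index set `I`, the cubes `Ω_n`, the
operators `H_{P,Q_n}` and the operators `N_n` (only the values at `n ∈ I` matter). -/
structure RegionData where
  region : Set Space3
  index : Set ℕ
  cube : ℕ → Set Space3
  inter : ℕ → SpinL2 K →ₗ.[ℂ] SpinL2 K
  num : ℕ → K →ₗ.[ℂ] K

/-- The cone `{k : k · e ≥ |k| cos θ}`. -/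
def cone (e : Space3) (θ : ℝ) : Set Space3 := {k | ‖k‖ * Real.cos θ ≤ ⟪k, e⟫_ℝ}

/-- The truncated cone `{k : k · e ≥ |k| cos θ, |k| > v}`. -/
def truncatedCone (e : Space3) (θ v : ℝ) : Set Space3 := cone e θ ∩ {k | v < ‖k‖}

/-- The distance between two (nonempty) sets. -/
def setDist (S T : Set Space3) : ℝ := sInf {r | ∃ x ∈ S, ∃ y ∈ T, r = dist x y}

/-- Open cubes of positive side length, with arbitrary orientation. -/
def IsOpenCube (S : Set Space3) : Prop :=
  ∃ (b : OrthonormalBasis (Fin 3) ℝ Space3) (c : Space3) (l : ℝ), 0 < l ∧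
    S = {x | ∀ i, |⟪b i, x - c⟫_ℝ| < l / 2}

/-- `m = (1 ⊗ A) u` in `ℂ² ⊗ K` (with both spin components of `u` in the domain of `A`). -/
def FiberApply (A : K →ₗ.[ℂ] K) (u m : Spinor K) : Prop := ∀ s, (u s, m s) ∈ A.graph

/-- Assumption (A1): location of `Q` and properties of the interaction. -/
structure AssumptionA1 [CompleteSpace K] (S : CoupledSystem K) (L : RegionData K) (e : Space3)
    (θ₀ d α β C M : ℝ) : Prop where
  isOpen_region : IsOpen L.region
  d_pos : 0 < d
  dist_region : setDist L.region (cone e (2 * θ₀)) = d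
  region_eq : L.region = ⋃ n ∈ L.index, L.cube n
  isOpenCube : ∀ n ∈ L.index, IsOpenCube (L.cube n)
  diam_le : ∀ n ∈ L.index, Metric.diam (L.cube n) ≤ M
  /-- `d_n → ∞` as `n → ∞` in `I`. -/
  tendsto_dist : Tendsto (fun n : L.index => setDist (L.cube n) (cone e (2 * θ₀))) cofinite atTop
  le_domain_inter : ∀ n ∈ L.index, S.HPQ.domain ≤ (L.inter n).domain
  /-- `H_{P,Q} = ∑_{n ∈ I} H_{P,Q_n}`, the partial sums converging strongly on `D(H_{P,Q})`; here
  `Φ n = H_{P,Q_n} Ψ`. -/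
  strong_sum : ∀ (Ψ : S.HPQ.domain) (Φ : ℕ → SpinL2 K),
    (∀ n ∈ L.index, ((Ψ : SpinL2 K), Φ n) ∈ (L.inter n).graph) → (∀ n ∉ L.index, Φ n = 0) →
    Tendsto (fun m => ∑ n ∈ Finset.range m, Φ n) atTop (𝓝 (S.HPQ Ψ))
  /-- The bound `‖(H_{P,Q_n} Ψ)(x)‖ ≤ ‖((1 ⊗ N_n) Ψ)(x)‖ / dist(Ω_n, x)^α` for `x ∉ Ω` (there is
  nothing to show where `Ψ(x)` is not in the domain of `1 ⊗ N_n`). -/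
  decay : ∀ n ∈ L.index, ∀ Ψ ∈ productDomain S.HQ, ∀ Φ, (Ψ, Φ) ∈ (L.inter n).graph →
    ∀ᵐ x : Space3, x ∉ L.region → ∀ m, FiberApply (L.num n) (Ψ x) m →
      Metric.infDist x (L.cube n) ^ α * ‖Φ x‖ ≤ ‖m‖
  summable_dist :
    Summable fun n : L.index => setDist (L.cube n) (cone e (2 * θ₀)) ^ ((1 - α) / 2)
  tsum_dist_le :
    ∑' n : L.index, setDist (L.cube n) (cone e (2 * θ₀)) ^ ((1 - α) / 2) ≤ C * d ^ (-β)
  /-- `[H_{P,Q_n}, x_j] = 0`: if `Ψ` and `x_j Ψ` are in the domain, then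
  `H_{P,Q_n} x_j Ψ = x_j H_{P,Q_n} Ψ`. -/
  commute : ∀ n ∈ L.index, ∀ (j : Fin 3) (Ψ Ψ' : (L.inter n).domain),
    (∀ᵐ x : Space3, (Ψ' : SpinL2 K) x = (x j : ℂ) • (Ψ : SpinL2 K) x) →
    ∀ᵐ x : Space3, L.inter n Ψ' x = (x j : ℂ) • L.inter n Ψ x

/-- The Fourier transform `(2π)^{-3/2} ∫ e^{-i k·x} F(x) dx`. -/
def fourier3 {V : Type*} [NormedAddCommGroup V] [NormedSpace ℂ V] (F : Space3 → V)
    (k : Space3) : V :=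
  ((2 * Real.pi) ^ (-(3 / 2) : ℝ) : ℝ) •
    ∫ x, Complex.exp (-Complex.I * (⟪k, x⟫_ℝ : ℂ)) • F x

/-- Assumption (A2): choice of the initial state. -/
structure AssumptionA2 (Ψ₀ : SpinL2 K) (e : Space3) (θ₀ v : ℝ) : Prop where
  norm_eq_one : ‖Ψ₀‖ = 1
  schwartz : ∃ F : 𝓢(Space3, Spinor K), Ψ₀ = F.toLp 2 volume ∧
    tsupport (fourier3 F) ⊆ truncatedCone e θ₀ v

/-- Assumption (A3), `W` being the time evolution of `Q`: for `s = 1, 2`, the `L^s` norm of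
`(1 ⊗ N_n) e^{-itH_Q} Ψ₀` is finite and less than `C`. -/
def AssumptionA3 (L : RegionData K) (W : ℝ → K →L[ℂ] K) (Ψ₀ : SpinL2 K) (C : ℝ) : Prop :=
  ∀ n ∈ L.index, ∀ t : ℝ, 0 ≤ t → ∃ Φ : SpinL2 K,
    (∀ᵐ x : Space3, FiberApply (L.num n) (WithLp.toLp 2 fun s => W t (Ψ₀ x s)) (Φ x)) ∧
    eLpNorm Φ 1 volume < ENNReal.ofReal C ∧ eLpNorm Φ 2 volume < ENNReal.ofReal C

end Model

/-! ### The entangled initial state -/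

/-- The state
`(2n)^{-1/2} ∑_j (|φ_j,↓; ψ_j,↑⟩ - |φ_j,↑; ψ_j,↓⟩) ⊗ |χ_j⟩` of `P ∨ P' ∨ D`, where the Hilbert
space of `Q = P' ∨ D` is `L²(ℝ³; ℂ² ⊗ HD)`. -/
def singletState {HD : Type*} [NormedAddCommGroup HD] [InnerProductSpace ℂ HD] {n : ℕ}
    (φ ψ : Fin n → Lp ℂ 2 (volume : Measure Space3)) (χ : Fin n → HD) : SpinL2 (SpinL2 HD) :=
  ((Real.sqrt (2 * n))⁻¹ : ℂ) • ∑ j,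
    (tens (withSpin (φ j) spinDown) (tens (withSpin (ψ j) spinUp) (χ j)) -
      tens (withSpin (φ j) spinUp) (tens (withSpin (ψ j) spinDown) (χ j)))

end

open scoped ContDiff FourierTransform LineDeriv

noncomputable section

/-! ### Functions of temperate growth -/

section TemperateGrowth

open Function

/-! Under an uncoupled evolution the spin of P stays exactly unpolarised, whatever the filter does:
unitarity of e^{-itH_Q} keeps the 2n states of Q in the singlet sum orthonormal, so the reduced spin
state of P is a multiple of the identity, and the Pauli matrices have trace zero
(`spinExpectation_singlet`). It remains to show that e^{-itH}Ψ₀ is close to a state of this form,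
uniformly in t ≥ 0, when d is large.

The plain uncoupled evolution is not a suitable comparison state: (A1) bounds the interaction only
off Ω, and a free wave packet has tails inside Ω. The comparison state is therefore `cutEvol`, the
uncoupled evolution multiplied by a function w of the position of P which is 1 on the cone of angle
2θ₀ and vanishes at distance more than d/2 from it. Dilating one fixed cutoff (`exists_cutoff`)
makes its first and second derivatives O(1/d) and O(1/d²). Multiplication by w acts on the wave
functions of P alone, so the singlet form survives. By Cook's method (`hasDerivAt_neg_cutEvol`) the
difference of the two evolutions is governed by the commutator [H_P, w] and by H_{P,Q} applied to
the comparison state; both must be integrable in time with small integral.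

Three facts give this. Propagation: a packet with spectrum in the truncated cone is O(t⁻²) in L²
outside the outgoing region {x in the cone of angle θ₀, |x| ≥ vt} (`exists_propagation_bound`). The
derivatives of w vanish on the cone, so the commutator only meets this remainder. Distance: points
of the outgoing region in the support of w are at distance at least max(d_n/2, ct) from the cube
Ω_n; `exists_rpow_bound` splits the resulting power -α into d_n^{(1-α)/2}, which (A1) sums to at
most C₁d^{-β}, and an integrable power of 1 + t. Locality: commuting with the coordinates forces
H_{P,Q_n} not to enlarge supports (`ae_eq_zero_of_commute`), so nothing is left inside Ω.

The constants may depend on the φ_j but not on Q. To this end Ψ₀ is expanded over an orthonormal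
basis of the span of the φ_j, consisting of Schwartz functions with the same spectral support
(`exists_orthonormal_schwartz`). The coefficient vectors in Q are partial inner products of Ψ₀,
hence of norm at most 1, and (A3) passes to them in the same way (`AssumptionA3.exists_mem_graph`).
-/

theorem hasTemperateGrowth_cexp_I_mul :
    (fun y : ℝ => Complex.exp (Complex.I * y)).HasTemperateGrowth := by
  have hcd : ContDiff ℝ ∞ (fun y : ℝ => Complex.exp (Complex.I * y)) :=
    (contDiff_const.mul Complex.ofRealCLM.contDiff).cexp
  refine ⟨hcd, fun n => ⟨0, 1, fun x => ?_⟩⟩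
  have h : ∀ m : ℕ, iteratedDeriv m (fun y : ℝ => Complex.exp (Complex.I * y)) =
      fun y : ℝ => Complex.I ^ m * Complex.exp (Complex.I * y) := by
    intro m
    induction m with
    | zero => simp
    | succ m ih =>
      rw [iteratedDeriv_succ, ih]
      ext y
      have h1 : HasDerivAt (fun y : ℝ => Complex.exp (Complex.I * y))
          (Complex.exp (Complex.I * y) * (Complex.I * 1)) y :=
        ((Complex.ofRealCLM.hasDerivAt (x := y)).const_mul Complex.I).cexp
      rw [(h1.const_mul (Complex.I ^ m)).deriv]
      ring
  rw [norm_iteratedFDeriv_eq_norm_iteratedDeriv, h]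
  simp [Complex.norm_exp]

@[fun_prop]
theorem hasTemperateGrowth_cexp_I_mul_comp {E : Type*} [NormedAddCommGroup E] [NormedSpace ℝ E]
    {f : E → ℝ} (hf : f.HasTemperateGrowth) :
    (fun x => Complex.exp (Complex.I * (f x : ℝ))).HasTemperateGrowth :=
  hasTemperateGrowth_cexp_I_mul.comp hf

/-- On the half-line (c, ∞) every derivative of 1/y is bounded, the n-th one by n! c^{-(n+1)}, so
composition with f preserves temperate growth. -/
theorem Function.HasTemperateGrowth.inv_of_le {E : Type*} [NormedAddCommGroup E] [NormedSpace ℝ E]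
    {f : E → ℝ} (hf : f.HasTemperateGrowth) {c : ℝ} (hc : 0 < c) (h : ∀ x, c < f x) :
    (fun x => (f x)⁻¹).HasTemperateGrowth := by
  have ht : UniqueDiffOn ℝ (Set.Ioi c) := isOpen_Ioi.uniqueDiffOn
  refine HasTemperateGrowth.comp' (g := fun y : ℝ => y⁻¹) (t := Set.Ioi c) ?_ ht ?_ ?_ hf
  · rintro _ ⟨x, rfl⟩
    exact h x
  · exact contDiffOn_inv ℝ |>.mono fun x hx => (hc.trans hx).ne'
  · intro N
    -- A single constant has to serve all orders up to N, hence the sum of the individual bounds.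
    refine ⟨0, ∑ k ∈ Finset.range (N + 1), (k.factorial : ℝ) * (c⁻¹) ^ (k + 1), by positivity,
      fun n hn x hx => ?_⟩
    have hx0 : 0 < x := hc.trans hx
    have hcd : ContDiffAt ℝ n (fun y : ℝ => y⁻¹) x := contDiffAt_inv ℝ hx0.ne'
    rw [norm_iteratedFDerivWithin_eq_norm_iteratedDerivWithin,
      iteratedDerivWithin_eq_iteratedDeriv ht hcd hx, iteratedDeriv_eq_iterate]
    have h1 : (deriv^[n] (fun y : ℝ => y⁻¹)) x = (-1) ^ n * n.factorial * x ^ (-1 - n : ℤ) := by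
      have := iter_deriv_inv' (𝕜 := ℝ) n
      exact congrFun this x
    rw [h1, pow_zero, mul_one]
    have h2 : ‖(-1 : ℝ) ^ n * n.factorial * x ^ (-1 - n : ℤ)‖ =
        n.factorial * (x⁻¹) ^ (n + 1) := by
      rw [norm_mul, norm_mul, norm_pow, norm_neg, norm_one, one_pow, one_mul]
      have : x ^ (-1 - n : ℤ) = (x⁻¹) ^ (n + 1) := by
        rw [← zpow_natCast, inv_zpow', ]
        congr 1
        push_cast
        ring
      rw [this, Real.norm_of_nonneg (by positivity), Real.norm_of_nonneg (by positivity)]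
    rw [h2]
    have h3 : (n.factorial : ℝ) * (x⁻¹) ^ (n + 1) ≤ n.factorial * (c⁻¹) ^ (n + 1) := by
      have : x⁻¹ ≤ c⁻¹ := inv_anti₀ hc (le_of_lt hx)
      gcongr
    refine h3.trans (Finset.single_le_sum
      (f := fun k : ℕ => (k.factorial : ℝ) * (c⁻¹) ^ (k + 1)) (fun _ _ => by positivity) ?_)
    exact Finset.mem_range.2 (by omega)

theorem Real.smoothTransition.hasCompactSupport_deriv :
    HasCompactSupport (deriv Real.smoothTransition) := by
  refine HasCompactSupport.intro (isCompact_Icc (a := (0 : ℝ)) (b := 1)) fun x hx => ?_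
  rw [Set.mem_Icc, not_and_or, not_le, not_le] at hx
  rcases hx with hx | hx
  · have : Real.smoothTransition =ᶠ[𝓝 x] fun _ => 0 := by
      filter_upwards [Iio_mem_nhds hx] with y hy
      exact Real.smoothTransition.zero_of_nonpos (le_of_lt hy)
    rw [this.deriv_eq, deriv_const]
  · have : Real.smoothTransition =ᶠ[𝓝 x] fun _ => 1 := by
      filter_upwards [Ioi_mem_nhds hx] with y hy
      exact Real.smoothTransition.one_of_one_le (le_of_lt hy)
    rw [this.deriv_eq, deriv_const]

theorem Real.smoothTransition.contDiff_deriv : ContDiff ℝ ∞ (deriv Real.smoothTransition) :=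
  (contDiff_infty_iff_deriv.1 Real.smoothTransition.contDiff).2

theorem Real.smoothTransition.contDiff_deriv_deriv :
    ContDiff ℝ ∞ (deriv (deriv Real.smoothTransition)) :=
  (contDiff_infty_iff_deriv.1 Real.smoothTransition.contDiff_deriv).2

@[fun_prop]
theorem Real.smoothTransition.hasTemperateGrowth_deriv :
    (deriv Real.smoothTransition).HasTemperateGrowth :=
  Real.smoothTransition.hasCompactSupport_deriv.hasTemperateGrowth
    Real.smoothTransition.contDiff_deriv

@[fun_prop]
theorem Real.smoothTransition.hasTemperateGrowth_deriv_deriv :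
    (deriv (deriv Real.smoothTransition)).HasTemperateGrowth :=
  Real.smoothTransition.hasCompactSupport_deriv.deriv.hasTemperateGrowth
    Real.smoothTransition.contDiff_deriv_deriv

@[fun_prop]
theorem Real.smoothTransition.hasTemperateGrowth :
    Real.smoothTransition.HasTemperateGrowth := by
  have hd : Differentiable ℝ Real.smoothTransition :=
    (Real.smoothTransition.contDiff (n := 1)).differentiable (by simp)
  refine HasTemperateGrowth.of_fderiv ?_ hd (k := 0) (C := 1) fun x => ?_
  · have : fderiv ℝ Real.smoothTransition = fun x =>
        (ContinuousLinearMap.smulRightL ℝ ℝ ℝ (1 : ℝ →L[ℝ] ℝ)) (deriv Real.smoothTransition x) := by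
      ext x
      simp
    rw [this]
    exact (ContinuousLinearMap.hasTemperateGrowth _).comp
      Real.smoothTransition.hasTemperateGrowth_deriv
  · rw [pow_zero, mul_one, Real.norm_of_nonneg (Real.smoothTransition.nonneg x)]
    exact Real.smoothTransition.le_one x

end TemperateGrowth

/-! ### A smooth cutoff to a neighbourhood of a cone -/

section Cutoff

/-- The standard orthonormal basis of `ℝ³`. -/
abbrev stdBasis3 : OrthonormalBasis (Fin 3) ℝ Space3 := EuclideanSpace.basisFun (Fin 3) ℝ

/-- A cutoff `w` together with its first and second partial derivatives, bounded by `B₁` and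
`B₂`. -/
structure IsCutoff (w : Space3 → ℝ) (w₁ w₂ : Fin 3 → Space3 → ℝ) (B₁ B₂ : ℝ) : Prop where
  growth : w.HasTemperateGrowth
  growth₁ : ∀ j, (w₁ j).HasTemperateGrowth
  growth₂ : ∀ j, (w₂ j).HasTemperateGrowth
  deriv₁ : ∀ j x, HasLineDerivAt ℝ w (w₁ j x) x (stdBasis3 j)
  deriv₂ : ∀ j x, HasLineDerivAt ℝ (w₁ j) (w₂ j x) x (stdBasis3 j)
  nonneg : ∀ x, 0 ≤ w x
  le_one : ∀ x, w x ≤ 1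
  bound₁ : ∀ j x, |w₁ j x| ≤ B₁
  bound₂ : ∀ j x, |w₂ j x| ≤ B₂

theorem HasLineDerivAt.comp_inv_smul {w : Space3 → ℝ} {a : ℝ} {r : ℝ} {x v : Space3}
    (h : HasLineDerivAt ℝ w a (r • x) v) : HasLineDerivAt ℝ (fun y => w (r • y)) (r * a) x v := by
  unfold HasLineDerivAt at *
  have h1 : HasDerivAt (fun t : ℝ => r * t) (r * 1) 0 := (hasDerivAt_id (0 : ℝ)).const_mul r
  have h2 : HasDerivAt (fun t : ℝ => w (r • x + t • v)) a (r * 0) := by simpa using h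
  convert! h2.comp (0 : ℝ) h1 using 1
  · ext t
    simp [smul_add, smul_smul]
  · ring

theorem IsCutoff.comp_smul {w : Space3 → ℝ} {w₁ w₂ : Fin 3 → Space3 → ℝ} {B₁ B₂ : ℝ}
    (h : IsCutoff w w₁ w₂ B₁ B₂) {r : ℝ} (hr : 0 ≤ r) :
    IsCutoff (fun x => w (r • x)) (fun j x => r * w₁ j (r • x))
      (fun j x => r * (r * w₂ j (r • x))) (r * B₁) (r * (r * B₂)) where
  growth := h.growth.comp (f := fun x : Space3 => r • x) (by fun_prop)
  growth₁ j := by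
    have := (h.growth₁ j).comp (f := fun x : Space3 => r • x) (by fun_prop)
    exact (Function.HasTemperateGrowth.const r).mul this
  growth₂ j := by
    have := (h.growth₂ j).comp (f := fun x : Space3 => r • x) (by fun_prop)
    exact (Function.HasTemperateGrowth.const r).mul ((Function.HasTemperateGrowth.const r).mul this)
  deriv₁ j x := (h.deriv₁ j (r • x)).comp_inv_smul
  deriv₂ j x := by
    have := (h.deriv₂ j (r • x)).comp_inv_smul
    unfold HasLineDerivAt at *
    exact this.const_mul r
  nonneg x := h.nonneg _
  le_one x := h.le_one _
  bound₁ j x := by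
    rw [abs_mul, abs_of_nonneg hr]
    exact mul_le_mul_of_nonneg_left (h.bound₁ j _) hr
  bound₂ j x := by
    rw [abs_mul, abs_mul, abs_of_nonneg hr]
    exact mul_le_mul_of_nonneg_left (mul_le_mul_of_nonneg_left (h.bound₂ j _) hr) hr

/-- The cutoff is a smooth step applied to q(x) = (2/c)⟨x, e⟩ - 2√(1+|x|²) + 7/2. Using √(1+|x|²) in
place of |x| removes the singularity at the vertex and keeps the first and second derivatives of q
bounded. On the cone q ≥ 3/2, so w is 1 near each of its points and the derivatives vanish there;
positivity of q keeps x within bounded distance of the cone. -/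
theorem exists_cutoff (e : Space3) (he : ‖e‖ = 1) (c : ℝ) (hc : 0 < c) (hc1 : c < 1) :
    ∃ (w : Space3 → ℝ) (w₁ w₂ : Fin 3 → Space3 → ℝ) (B R δ : ℝ), 0 ≤ B ∧ 0 < R ∧ 0 < δ ∧
      IsCutoff w w₁ w₂ B B ∧
      (∀ x, ‖x‖ * c ≤ ⟪x, e⟫_ℝ → w x = 1 ∧ ∀ j, w₁ j x = 0 ∧ w₂ j x = 0) ∧
      (∀ x, w x ≠ 0 → ∃ y, ‖y‖ * c ≤ ⟪y, e⟫_ℝ ∧ dist x y ≤ R) ∧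
      (∀ x, w x ≠ 1 → δ ≤ ‖x‖) := by
  set S := Real.smoothTransition with hS
  set J : ℝ → Space3 → ℝ := fun r x => (1 + ‖x‖ ^ 2) ^ r with hJ
  have hJg : ∀ r, (J r).HasTemperateGrowth := fun r =>
    Function.hasTemperateGrowth_one_add_norm_sq_rpow Space3 r
  have hpos : ∀ x : Space3, 0 < 1 + ‖x‖ ^ 2 := fun x => by positivity
  set q : Space3 → ℝ := fun x => (2 / c) * ⟪x, e⟫_ℝ - 2 * J (1 / 2) x + 7 / 2 with hq
  set b := stdBasis3 with hb
  set q₁ : Fin 3 → Space3 → ℝ := fun j x => (2 / c) * ⟪b j, e⟫_ℝ - 2 * (⟪x, b j⟫_ℝ * J (-1 / 2) x)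
    with hq₁
  set q₂ : Fin 3 → Space3 → ℝ := fun j x =>
    - 2 * (J (-1 / 2) x - ⟪x, b j⟫_ℝ ^ 2 * J (-3 / 2) x) with hq₂
  have hbn : ∀ j, ‖b j‖ = 1 := fun j => b.orthonormal.1 j
  have hin : ∀ j x, |⟪x, b j⟫_ℝ| ≤ ‖x‖ := fun j x => by
    simpa [hbn] using abs_real_inner_le_norm x (b j)
  have dJ : ∀ r j x, HasLineDerivAt ℝ (J r) (2 * r * ⟪x, b j⟫_ℝ * J (r - 1) x) x (b j) := by
    intro r j x
    unfold HasLineDerivAt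
    have h1 : HasDerivAt (fun t : ℝ => x + t • b j) (b j) 0 := by
      simpa using ((hasDerivAt_id (0 : ℝ)).smul_const (b j)).const_add x
    have h2 := (h1.norm_sq.const_add 1).rpow_const (p := r) (Or.inl (hpos _).ne')
    convert! h2 using 1
    simp only [hJ, zero_smul, add_zero]
    ring
  have dI : ∀ (u : Space3) j x, HasLineDerivAt ℝ (fun y => ⟪y, u⟫_ℝ) ⟪b j, u⟫_ℝ x (b j) := by
    intro u j x
    unfold HasLineDerivAt
    have h1 : HasDerivAt (fun t : ℝ => ⟪x, u⟫_ℝ + t * ⟪b j, u⟫_ℝ) (1 * ⟪b j, u⟫_ℝ) 0 :=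
      ((hasDerivAt_id (0 : ℝ)).mul_const _).const_add _
    simpa [inner_add_left, inner_smul_left] using h1
  have dq : ∀ j x, HasLineDerivAt ℝ q (q₁ j x) x (b j) := by
    intro j x
    have h1 := dJ (1 / 2) j x
    have h2 := dI e j x
    unfold HasLineDerivAt at *
    convert! ((h2.const_mul (2 / c)).sub (h1.const_mul 2)).add_const (7 / 2) using 1
    simp only [hq₁]
    norm_num
  have dq₁ : ∀ j x, HasLineDerivAt ℝ (q₁ j) (q₂ j x) x (b j) := by
    intro j x
    have h1 := dJ (-1 / 2) j x
    have h2 := dI (b j) j x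
    unfold HasLineDerivAt at *
    convert! ((h2.mul h1).const_mul 2).const_sub ((2 / c) * ⟪b j, e⟫_ℝ) using 1
    simp only [hq₂, zero_smul, add_zero]
    have : ⟪b j, b j⟫_ℝ = 1 := by rw [real_inner_self_eq_norm_sq, hbn]; norm_num
    rw [this]
    norm_num
    ring
  have hqg : q.HasTemperateGrowth := by
    have := hJg (1 / 2)
    fun_prop
  have hq₁g : ∀ j, (q₁ j).HasTemperateGrowth := fun j => by
    have := hJg (-1 / 2)
    fun_prop
  have hq₂g : ∀ j, (q₂ j).HasTemperateGrowth := fun j => by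
    have := hJg (-1 / 2)
    have := hJg (-3 / 2)
    fun_prop
  have hJb : ∀ x, J (-1 / 2) x ≤ 1 := fun x =>
    Real.rpow_le_one_of_one_le_of_nonpos (by nlinarith [sq_nonneg ‖x‖]) (by norm_num)
  have hJ0 : ∀ r x, 0 ≤ J r x := fun r x => Real.rpow_nonneg (hpos x).le _
  have hJx : ∀ x, ‖x‖ * J (-1 / 2) x ≤ 1 := fun x => by
    have h1 : ‖x‖ ≤ J (1 / 2) x := by
      rw [hJ]
      simp only
      rw [← Real.sqrt_eq_rpow]
      exact Real.le_sqrt_of_sq_le (by linarith)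
    calc ‖x‖ * J (-1 / 2) x ≤ J (1 / 2) x * J (-1 / 2) x := by gcongr
      _ = 1 := by
        simp only [hJ]
        rw [← Real.rpow_add (hpos x)]
        norm_num
  have hJx2 : ∀ x, ‖x‖ ^ 2 * J (-3 / 2) x ≤ 1 := fun x => by
    have : J (-3 / 2) x = J (-1 / 2) x * J (-1 / 2) x * J (-1 / 2) x := by
      simp only [hJ]
      rw [← Real.rpow_add (hpos x), ← Real.rpow_add (hpos x)]
      norm_num
    rw [this]
    have h1 := hJx x
    have h2 := hJb x
    have h3 := hJ0 (-1 / 2) x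
    have h4 : 0 ≤ ‖x‖ * J (-1 / 2) x := by positivity
    calc ‖x‖ ^ 2 * (J (-1 / 2) x * J (-1 / 2) x * J (-1 / 2) x)
        = (‖x‖ * J (-1 / 2) x) * (‖x‖ * J (-1 / 2) x) * J (-1 / 2) x := by ring
      _ ≤ 1 * 1 * 1 := by gcongr
      _ = 1 := by norm_num
  have hq₁b : ∀ j x, |q₁ j x| ≤ 2 / c + 2 := by
    intro j x
    have h1 : |⟪b j, e⟫_ℝ| ≤ 1 := by
      simpa [hbn, he] using abs_real_inner_le_norm (b j) e
    have h2 : |⟪x, b j⟫_ℝ * J (-1 / 2) x| ≤ 1 := by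
      rw [abs_mul, abs_of_nonneg (hJ0 _ _)]
      exact (mul_le_mul_of_nonneg_right (hin j x) (hJ0 _ _)).trans (hJx x)
    calc |q₁ j x| ≤ |(2 / c) * ⟪b j, e⟫_ℝ| + |2 * (⟪x, b j⟫_ℝ * J (-1 / 2) x)| := abs_sub _ _
      _ ≤ (2 / c) * 1 + 2 * 1 := by
        rw [abs_mul, abs_mul 2, abs_of_pos (by positivity : 0 < 2 / c), abs_two]
        gcongr
      _ = _ := by ring
  have hq₂b : ∀ j x, |q₂ j x| ≤ 4 := by
    intro j x
    have h2 : |⟪x, b j⟫_ℝ ^ 2 * J (-3 / 2) x| ≤ 1 := by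
      rw [abs_mul, abs_of_nonneg (hJ0 _ _), abs_pow]
      refine le_trans ?_ (hJx2 x)
      have := hin j x
      have := hJ0 (-3 / 2) x
      gcongr
    have h1 : |J (-1 / 2) x| ≤ 1 := by rw [abs_of_nonneg (hJ0 _ _)]; exact hJb x
    simp only [hq₂, abs_mul]
    have := abs_sub (J (-1 / 2) x) (⟪x, b j⟫_ℝ ^ 2 * J (-3 / 2) x)
    have h3 : |(-2 : ℝ)| = 2 := by norm_num
    rw [h3]
    linarith
  have hSd : Differentiable ℝ S := (Real.smoothTransition.contDiff (n := 1)).differentiable (by simp)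
  have hSd' : Differentiable ℝ (deriv S) :=
    (Real.smoothTransition.contDiff_deriv).differentiable (by simp)
  obtain ⟨M₁, hM₁⟩ := Real.smoothTransition.hasCompactSupport_deriv.exists_bound_of_continuous
    Real.smoothTransition.contDiff_deriv.continuous
  obtain ⟨M₂, hM₂⟩ := Real.smoothTransition.hasCompactSupport_deriv.deriv.exists_bound_of_continuous
    Real.smoothTransition.contDiff_deriv_deriv.continuous
  have hM₁0 : 0 ≤ M₁ := (norm_nonneg _).trans (hM₁ 0)
  have hM₂0 : 0 ≤ M₂ := (norm_nonneg _).trans (hM₂ 0)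
  have hJn : ∀ x, J (1 / 2) x ≤ 1 + ‖x‖ := fun x => by
    simp only [hJ]
    rw [← Real.sqrt_eq_rpow]
    refine Real.sqrt_le_iff.2 ⟨by positivity, ?_⟩
    nlinarith [norm_nonneg x]
  have hJn' : ∀ x, ‖x‖ ≤ J (1 / 2) x := fun x => by
    simp only [hJ]
    rw [← Real.sqrt_eq_rpow]
    exact Real.le_sqrt_of_sq_le (by linarith)
  -- The third line of witnesses adds the bounds for the two orders of derivatives, so that one
  -- constant serves both. R is the length of the shift along e that carries the support into the
  -- cone; c/8 works because q exceeds 1 near the vertex, where q(0) = 3/2.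
  refine ⟨fun x => S (q x), fun j x => deriv S (q x) * q₁ j x,
    fun j x => deriv (deriv S) (q x) * q₁ j x * q₁ j x + deriv S (q x) * q₂ j x,
    M₁ * (2 / c + 2) + (M₂ * (2 / c + 2) * (2 / c + 2) + M₁ * 4), 2 * c / (1 - c), c / 8,
    by positivity, div_pos (by positivity) (by linarith), by positivity, ?_, ?_, ?_, ?_⟩
  · refine ⟨?_, ?_, ?_, ?_, ?_, ?_, ?_, ?_, ?_⟩
    · exact Real.smoothTransition.hasTemperateGrowth.comp hqg
    · intro j
      exact (Real.smoothTransition.hasTemperateGrowth_deriv.comp hqg).mul (hq₁g j)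
    · intro j
      exact (((Real.smoothTransition.hasTemperateGrowth_deriv_deriv.comp hqg).mul (hq₁g j)).mul
        (hq₁g j)).add ((Real.smoothTransition.hasTemperateGrowth_deriv.comp hqg).mul (hq₂g j))
    · intro j x
      have h1 := dq j x
      unfold HasLineDerivAt at *
      have h2 : HasDerivAt S (deriv S (q x)) (q (x + (0 : ℝ) • b j)) := by
        simpa using (hSd (q x)).hasDerivAt
      exact h2.comp (0 : ℝ) h1
    · intro j x
      have h1 := dq j x
      have h3 := dq₁ j x
      unfold HasLineDerivAt at *
      have h2 : HasDerivAt (deriv S) (deriv (deriv S) (q x)) (q (x + (0 : ℝ) • b j)) := by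
        simpa using (hSd' (q x)).hasDerivAt
      have h4 := (h2.comp (0 : ℝ) h1).mul h3
      convert! h4 using 1
      simp
    · exact fun x => Real.smoothTransition.nonneg _
    · exact fun x => Real.smoothTransition.le_one _
    · intro j x
      have : |deriv S (q x) * q₁ j x| ≤ M₁ * (2 / c + 2) := by
        rw [abs_mul]
        exact mul_le_mul (hM₁ _) (hq₁b j x) (abs_nonneg _) hM₁0
      refine this.trans ?_
      have : 0 ≤ M₂ * (2 / c + 2) * (2 / c + 2) + M₁ * 4 := by positivity
      linarith
    · intro j x
      have h1 : |deriv (deriv S) (q x) * q₁ j x * q₁ j x| ≤ M₂ * (2 / c + 2) * (2 / c + 2) := by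
        rw [abs_mul, abs_mul]
        exact mul_le_mul (mul_le_mul (hM₂ _) (hq₁b j x) (abs_nonneg _) hM₂0) (hq₁b j x)
          (abs_nonneg _) (by positivity)
      have h2 : |deriv S (q x) * q₂ j x| ≤ M₁ * 4 := by
        rw [abs_mul]
        exact mul_le_mul (hM₁ _) (hq₂b j x) (abs_nonneg _) hM₁0
      have h3 : 0 ≤ M₁ * (2 / c + 2) := by positivity
      have := abs_add_le (deriv (deriv S) (q x) * q₁ j x * q₁ j x) (deriv S (q x) * q₂ j x)
      linarith
  · intro x hx
    have h1 : 1 < q x := by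
      have h2 : 2 * ‖x‖ ≤ (2 / c) * ⟪x, e⟫_ℝ := by
        calc 2 * ‖x‖ = (2 / c) * (‖x‖ * c) := by field_simp
          _ ≤ _ := by gcongr
      have := hJn x
      simp only [hq]
      linarith
    have h2 : S =ᶠ[𝓝 (q x)] fun _ => 1 := by
      filter_upwards [Ioi_mem_nhds h1] with y hy
      exact Real.smoothTransition.one_of_one_le (le_of_lt hy)
    have h3 : deriv S =ᶠ[𝓝 (q x)] fun _ => 0 := by
      simpa using h2.deriv
    refine ⟨h2.self_of_nhds, fun j => ⟨?_, ?_⟩⟩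
    · simp [h3.self_of_nhds]
    · have h4 : deriv (deriv S) (q x) = 0 := by rw [h3.deriv_eq, deriv_const]
      simp [h3.self_of_nhds, h4]
  · intro x hx
    have h1 : 0 < q x := by
      by_contra h
      exact hx (Real.smoothTransition.zero_of_nonpos (not_lt.1 h))
    -- Moving by τ along e raises ⟨x, e⟩ by τ and c|x| by at most cτ. The gain (1-c)τ = 2c covers
    -- the defect c|x| - ⟨x, e⟩, which is at most 2c where q > 0.
    set τ := 2 * c / (1 - c) with hτ
    have hτ0 : 0 < τ := div_pos (by positivity) (by linarith)
    have hτc : τ * (1 - c) = 2 * c := by rw [hτ]; field_simp [(by linarith : (1 - c) ≠ 0)]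
    refine ⟨x + τ • e, ?_, ?_⟩
    · rw [inner_add_left, inner_smul_left, real_inner_self_eq_norm_sq, he]
      have h2 : ‖x + τ • e‖ ≤ ‖x‖ + τ := by
        refine (norm_add_le _ _).trans ?_
        rw [norm_smul, he, Real.norm_of_nonneg hτ0.le, mul_one]
      have h3 : c * ‖x‖ - ⟪x, e⟫_ℝ ≤ 2 * c := by
        have h4 := hJn' x
        simp only [hq] at h1
        have h5 : 0 < c * ((2 / c) * ⟪x, e⟫_ℝ - 2 * J (1 / 2) x + 7 / 2) := by positivity
        have h6 : c * ((2 / c) * ⟪x, e⟫_ℝ - 2 * J (1 / 2) x + 7 / 2) =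
          2 * ⟪x, e⟫_ℝ - 2 * (c * J (1 / 2) x) + c * (7 / 2) := by field_simp
        rw [h6] at h5
        have h7 : c * ‖x‖ ≤ c * J (1 / 2) x := by gcongr
        linarith
      have h8 : ‖x + τ • e‖ * c ≤ (‖x‖ + τ) * c := by gcongr
      simp only [conj_trivial]
      nlinarith
    · rw [dist_eq_norm]
      simp [norm_smul, he, abs_of_pos hτ0]
  · intro x hx
    have h1 : q x < 1 := by
      by_contra h
      exact hx (Real.smoothTransition.one_of_one_le (not_lt.1 h))
    have h2 : -‖x‖ ≤ ⟪x, e⟫_ℝ := by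
      have := abs_real_inner_le_norm x e
      rw [he, mul_one] at this
      exact (abs_le.1 this).1
    have h3 := hJn x
    simp only [hq] at h1
    have h5 : c * ((2 / c) * ⟪x, e⟫_ℝ - 2 * J (1 / 2) x + 7 / 2) < c * 1 := by gcongr
    have h6 : c * ((2 / c) * ⟪x, e⟫_ℝ - 2 * J (1 / 2) x + 7 / 2) =
      2 * ⟪x, e⟫_ℝ - 2 * (c * J (1 / 2) x) + c * (7 / 2) := by field_simp
    rw [h6] at h5
    have h7 : c * J (1 / 2) x ≤ c * (1 + ‖x‖) := by gcongr
    nlinarith [norm_nonneg x]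

end Cutoff

/-! ### The free Schrödinger evolution on Schwartz functions -/

section FreeEvolution

/-- Mean value inequality with |f'| ≤ |y| between 0 and y. This remainder is used both to
differentiate the free evolution and to expand the chirp for large times. -/
theorem norm_cexp_I_mul_sub_one_sub_le (y : ℝ) :
    ‖Complex.exp (Complex.I * y) - 1 - Complex.I * y‖ ≤ y ^ 2 := by
  set f : ℝ → ℂ := fun s => Complex.exp (Complex.I * s) - 1 - Complex.I * s with hf
  have hd : ∀ s : ℝ, HasDerivAt f (Complex.I * (Complex.exp (Complex.I * s) - 1)) s := by
    intro s
    have h1 : HasDerivAt (fun s : ℝ => Complex.I * (s : ℂ)) (Complex.I * 1) s :=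
      (Complex.ofRealCLM.hasDerivAt (x := s)).const_mul Complex.I
    convert! (h1.cexp.sub_const 1).sub h1 using 1
    ring
  have hb : ∀ s ∈ Set.uIcc 0 y, ‖deriv f s‖ ≤ |y| := by
    intro s hs
    rw [(hd s).deriv, norm_mul, Complex.norm_I, one_mul]
    refine Real.norm_exp_I_mul_ofReal_sub_one_le.trans ?_
    rw [Real.norm_eq_abs]
    have := Set.abs_sub_left_of_mem_uIcc hs
    simpa using this
  have := (convex_uIcc 0 y).norm_image_sub_le_of_norm_deriv_le
    (fun s _ => (hd s).differentiableAt) hb Set.left_mem_uIcc Set.right_mem_uIcc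
  have h0 : f 0 = 0 := by simp [hf]
  rw [h0, sub_zero, sub_zero, Real.norm_eq_abs, ← sq, sq_abs] at this
  exact this

theorem hasDerivAt_of_norm_sub_le {E : Type*} [NormedAddCommGroup E] [NormedSpace ℝ E]
    {f : ℝ → E} {f' : E} {x C : ℝ} (h : ∀ s, ‖f (x + s) - f x - s • f'‖ ≤ C * s ^ 2) :
    HasDerivAt f f' x := by
  rw [hasDerivAt_iff_isLittleO_nhds_zero]
  refine (Asymptotics.IsBigO.of_bound C (Eventually.of_forall fun s => ?_)).trans_isLittleO
    (Asymptotics.isLittleO_pow_id (𝕜 := ℝ) (n := 2) (by norm_num))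
  simpa using h s

theorem SchwartzMap.norm_toLp_le_of_forall_norm_le {E V V' : Type*} [NormedAddCommGroup E]
    [NormedSpace ℝ E] [MeasurableSpace E] [BorelSpace E] [SecondCountableTopology E]
    {μ : Measure E} [μ.HasTemperateGrowth] [NormedAddCommGroup V] [NormedSpace ℝ V]
    [NormedAddCommGroup V'] [NormedSpace ℝ V'] {f : 𝓢(E, V)} {g : 𝓢(E, V')}
    {p : ℝ≥0∞} (h : ∀ x, ‖f x‖ ≤ ‖g x‖) : ‖f.toLp p μ‖ ≤ ‖g.toLp p μ‖ := by
  refine Lp.norm_le_norm_of_ae_le ?_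
  filter_upwards [f.coeFn_toLp p μ, g.coeFn_toLp p μ] with x hf hg
  rw [hf, hg]
  exact h x

/-- The symbol `e^{-2π²it|ξ|²}` of the free Schrödinger evolution. -/
def freeSymbol (t : ℝ) (ξ : Space3) : ℂ :=
  Complex.exp (Complex.I * ((-(2 * Real.pi ^ 2 * t) * ‖ξ‖ ^ 2 : ℝ) : ℂ))

@[fun_prop]
theorem hasTemperateGrowth_freeSymbol (t : ℝ) : (freeSymbol t).HasTemperateGrowth := by
  have : (fun ξ : Space3 => -(2 * Real.pi ^ 2 * t) * ‖ξ‖ ^ 2).HasTemperateGrowth := by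
    have := Function.hasTemperateGrowth_norm_sq Space3
    fun_prop
  exact hasTemperateGrowth_cexp_I_mul_comp this

theorem norm_freeSymbol (t : ℝ) (ξ : Space3) : ‖freeSymbol t ξ‖ = 1 :=
  Complex.norm_exp_I_mul_ofReal _

/-- The free evolution `e^{-itH_P}` on scalar Schwartz functions. -/
def freeEvol (t : ℝ) : 𝓢(Space3, ℂ) →L[ℂ] 𝓢(Space3, ℂ) :=
  SchwartzMap.fourierMultiplierCLM ℂ (freeSymbol t)

theorem fourier_freeEvol_apply (t : ℝ) (f : 𝓢(Space3, ℂ)) (ξ : Space3) :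
    𝓕 (freeEvol t f) ξ = freeSymbol t ξ * 𝓕 f ξ := by
  rw [freeEvol, SchwartzMap.fourierMultiplierCLM_apply, FourierTransform.fourier_fourierInv_eq,
    SchwartzMap.smulLeftCLM_apply_apply (hasTemperateGrowth_freeSymbol t), smul_eq_mul]

theorem freeEvol_zero (f : 𝓢(Space3, ℂ)) : freeEvol 0 f = f := by
  have : freeSymbol 0 = fun _ => 1 := by ext; simp [freeSymbol]
  rw [freeEvol, this]
  simp

theorem norm_toLp_freeEvol (t : ℝ) (f : 𝓢(Space3, ℂ)) :
    ‖(freeEvol t f).toLp 2‖ = ‖f.toLp 2‖ := by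
  rw [← SchwartzMap.norm_fourier_toL2_eq, ← SchwartzMap.norm_fourier_toL2_eq f]
  refine le_antisymm (SchwartzMap.norm_toLp_le_of_forall_norm_le fun ξ => ?_)
    (SchwartzMap.norm_toLp_le_of_forall_norm_le fun ξ => ?_) <;>
  simp [fourier_freeEvol_apply, norm_freeSymbol]

theorem lineDeriv_freeEvol (t : ℝ) (f : 𝓢(Space3, ℂ)) (v : Space3) :
    ∂_{v} (freeEvol t f) = freeEvol t (∂_{v} f) := by
  have h : ∀ f : 𝓢(Space3, ℂ), ∂_{v} f =
      (2 * Real.pi * Complex.I) • SchwartzMap.fourierMultiplierCLM ℂ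
        (fun x : Space3 => ((inner ℝ x v : ℝ) : ℂ)) f := by
    intro f
    rw [SchwartzMap.lineDeriv_eq_fourierMultiplierCLM,
      ← SchwartzMap.fourierMultiplierCLM_ofReal ℂ (by fun_prop)]
    rfl
  have hg : (fun x : Space3 => ((inner ℝ x v : ℝ) : ℂ)).HasTemperateGrowth := by fun_prop
  rw [h, h, freeEvol, map_smul, SchwartzMap.fourierMultiplierCLM_fourierMultiplierCLM_apply hg
    (by fun_prop), SchwartzMap.fourierMultiplierCLM_fourierMultiplierCLM_apply (by fun_prop) hg,
    mul_comm (freeSymbol t)]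

/-- `-Δ/2` on scalar Schwartz functions. -/
def schwartzHam (f : 𝓢(Space3, ℂ)) : 𝓢(Space3, ℂ) := (-(1 / 2) : ℂ) • Δ f

theorem fourier_schwartzHam_apply (f : 𝓢(Space3, ℂ)) (ξ : Space3) :
    𝓕 (schwartzHam f) ξ = ((2 * Real.pi ^ 2 * ‖ξ‖ ^ 2 : ℝ) : ℂ) * 𝓕 f ξ := by
  have hg : (fun x : Space3 => ‖x‖ ^ 2).HasTemperateGrowth :=
    Function.hasTemperateGrowth_norm_sq Space3
  rw [schwartzHam, SchwartzMap.laplacian_eq_fourierMultiplierCLM]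
  have h2 : 𝓕 (SchwartzMap.fourierMultiplierCLM ℂ (fun x : Space3 => ‖x‖ ^ 2) f) ξ =
      ((‖ξ‖ ^ 2 : ℝ) : ℂ) * 𝓕 f ξ := by
    rw [SchwartzMap.fourierMultiplierCLM_apply, FourierTransform.fourier_fourierInv_eq,
      SchwartzMap.smulLeftCLM_apply_apply hg, Complex.real_smul]
  have h3 : ((‖·‖ ^ 2 : Space3 → ℝ)) = fun x : Space3 => ‖x‖ ^ 2 := rfl
  rw [FourierTransform.fourier_smul, smul_apply, FourierTransform.fourier_smul,
    smul_apply]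
  rw [show (SchwartzMap.fourierMultiplierCLM ℂ (‖·‖ ^ 2 : Space3 → ℝ) f) =
    SchwartzMap.fourierMultiplierCLM ℂ (fun x : Space3 => ‖x‖ ^ 2) f from rfl, h2]
  rw [Complex.real_smul, smul_eq_mul]
  push_cast
  ring

/-- By Plancherel the increment is estimated on the Fourier side: with m = 2π²|ξ|² the Taylor
remainder of e^{-ism} is at most s²m², which is s² times the symbol of H_P². -/
theorem hasDerivAt_toLp_freeEvol (f : 𝓢(Space3, ℂ)) (t : ℝ) :
    HasDerivAt (fun s => (freeEvol s f).toLp 2 volume)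
      (-Complex.I • (schwartzHam (freeEvol t f)).toLp 2 volume) t := by
  refine hasDerivAt_of_norm_sub_le (C := ‖(schwartzHam (schwartzHam f)).toLp 2 volume‖) fun s => ?_
  set R : 𝓢(Space3, ℂ) := freeEvol (t + s) f - freeEvol t f -
    (s : ℂ) • (-Complex.I • schwartzHam (freeEvol t f)) with hR
  have h1 : (freeEvol (t + s) f).toLp 2 volume - (freeEvol t f).toLp 2 volume -
      s • (-Complex.I • (schwartzHam (freeEvol t f)).toLp 2 volume) = R.toLp 2 volume := by
    have : R.toLp 2 volume = SchwartzMap.toLpCLM ℂ ℂ 2 volume R := rfl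
    rw [this, hR, map_sub, map_sub, map_smul, map_smul]
    rfl
  rw [h1, ← SchwartzMap.norm_fourier_toL2_eq, ← SchwartzMap.norm_fourier_toL2_eq (schwartzHam _)]
  have h2 : ‖(𝓕 R).toLp 2 volume‖ ≤ ‖((s ^ 2 : ℂ) • 𝓕 (schwartzHam (schwartzHam f))).toLp 2 volume‖ := by
    refine SchwartzMap.norm_toLp_le_of_forall_norm_le fun ξ => ?_
    set m : ℝ := 2 * Real.pi ^ 2 * ‖ξ‖ ^ 2 with hm
    have hs : ∀ r, freeSymbol r ξ = Complex.exp (Complex.I * ((-(r * m) : ℝ) : ℂ)) := by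
      intro r
      rw [freeSymbol, hm]
      congr 3
      ring
    have h3 : 𝓕 R ξ = freeSymbol t ξ * (Complex.exp (Complex.I * ((-(s * m) : ℝ) : ℂ)) - 1 -
        Complex.I * ((-(s * m) : ℝ) : ℂ)) * 𝓕 f ξ := by
      have h4 : 𝓕 R = 𝓕 (freeEvol (t + s) f) - 𝓕 (freeEvol t f) -
          (s : ℂ) • (-Complex.I • 𝓕 (schwartzHam (freeEvol t f))) := by
        rw [hR, sub_eq_add_neg, sub_eq_add_neg, FourierTransform.fourier_add,
          FourierTransform.fourier_add, FourierTransform.fourier_neg, FourierTransform.fourier_neg,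
          FourierTransform.fourier_smul, FourierTransform.fourier_smul, ← sub_eq_add_neg,
          ← sub_eq_add_neg]
      rw [h4]
      simp only [sub_apply, smul_apply, fourier_freeEvol_apply,
        fourier_schwartzHam_apply, smul_eq_mul]
      rw [← hm, hs, hs]
      have : Complex.exp (Complex.I * ((-((t + s) * m) : ℝ) : ℂ)) =
          Complex.exp (Complex.I * ((-(t * m) : ℝ) : ℂ)) *
            Complex.exp (Complex.I * ((-(s * m) : ℝ) : ℂ)) := by
        rw [← Complex.exp_add]
        congr 1
        push_cast
        ring
      rw [this]
      push_cast
      ring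
    rw [h3, norm_mul, norm_mul, norm_freeSymbol, one_mul]
    simp only [smul_apply, fourier_schwartzHam_apply, smul_eq_mul]
    rw [← hm, norm_mul, norm_mul, norm_mul]
    have h5 := norm_cexp_I_mul_sub_one_sub_le (-(s * m))
    calc _ ≤ (-(s * m)) ^ 2 * ‖𝓕 f ξ‖ := by gcongr
      _ = _ := by
        simp only [Complex.norm_real, norm_pow, Real.norm_eq_abs, sq_abs]
        have : |m| * |m| = m ^ 2 := by rw [← sq, sq_abs]
        rw [← mul_assoc |m|, this]
        ring
  refine h2.trans (le_of_eq ?_)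
  have : ((s ^ 2 : ℂ) • 𝓕 (schwartzHam (schwartzHam f))).toLp 2 volume =
    (s ^ 2 : ℂ) • (𝓕 (schwartzHam (schwartzHam f))).toLp 2 volume := rfl
  rw [this, norm_smul, norm_pow, Complex.norm_real, Real.norm_eq_abs, sq_abs, mul_comm]

end FreeEvolution

/-! ### Propagation of wave packets into the outgoing region -/

section Propagation

/-- Multiplication by `e^{i|y|²/(2t)}`. -/
def chirp (t : ℝ) (g : 𝓢(Space3, ℂ)) : 𝓢(Space3, ℂ) :=
  SchwartzMap.smulLeftCLM ℂ
    (fun y : Space3 => Complex.exp (Complex.I * (((2 * t)⁻¹ * ‖y‖ ^ 2 : ℝ) : ℂ))) g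

theorem chirp_apply (t : ℝ) (g : 𝓢(Space3, ℂ)) (y : Space3) :
    chirp t g y = Complex.exp (Complex.I * (((2 * t)⁻¹ * ‖y‖ ^ 2 : ℝ) : ℂ)) * g y := by
  have h1 : (fun y : Space3 => (2 * t)⁻¹ * ‖y‖ ^ 2).HasTemperateGrowth := by
    have := Function.hasTemperateGrowth_norm_sq Space3
    fun_prop
  rw [chirp, SchwartzMap.smulLeftCLM_apply_apply (hasTemperateGrowth_cexp_I_mul_comp h1),
    smul_eq_mul]

/-- The damping e^{-ε|ξ|²} gives the Gaussian a positive real part, as needed for its Fourier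
transform to be computed by an absolutely convergent integral; it is removed by dominated
convergence. -/
theorem tendsto_integral_regularized_freeEvol (t : ℝ) (g : 𝓢(Space3, ℂ)) (x : Space3) :
    Tendsto (fun ε : ℝ => ∫ ξ : Space3, Complex.exp (-(ε + 2 * Real.pi ^ 2 * t * Complex.I) *
      ‖ξ‖ ^ 2 + 2 * Real.pi * Complex.I * ⟪x, ξ⟫_ℝ) • 𝓕 g ξ) (𝓝[>] 0) (𝓝 (freeEvol t g x)) := by
  have h1 : freeEvol t g x = ∫ ξ : Space3, Complex.exp (-((0 : ℝ) + 2 * Real.pi ^ 2 * t * Complex.I) *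
      ‖ξ‖ ^ 2 + 2 * Real.pi * Complex.I * ⟪x, ξ⟫_ℝ) • 𝓕 g ξ := by
    rw [freeEvol, SchwartzMap.fourierMultiplierCLM_apply, SchwartzMap.fourierInv_coe,
      Real.fourierInv_eq']
    refine integral_congr_ae (Eventually.of_forall fun ξ => ?_)
    simp only
    rw [SchwartzMap.smulLeftCLM_apply_apply (hasTemperateGrowth_freeSymbol t), freeSymbol, smul_smul,
      ← Complex.exp_add, real_inner_comm]
    congr 2
    push_cast
    ring
  rw [h1]
  refine tendsto_integral_filter_of_dominated_convergence (fun ξ => ‖𝓕 g ξ‖) ?_ ?_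
    (𝓕 g).integrable.norm ?_
  · refine Eventually.of_forall fun ε => Continuous.aestronglyMeasurable ?_
    have := (𝓕 g).continuous
    fun_prop
  · filter_upwards [self_mem_nhdsWithin] with ε hε
    refine Eventually.of_forall fun ξ => ?_
    rw [norm_smul]
    refine mul_le_of_le_one_left (norm_nonneg _) ?_
    rw [Complex.norm_exp, Real.exp_le_one_iff]
    have h2 : (-((ε : ℂ) + 2 * Real.pi ^ 2 * t * Complex.I) * ‖ξ‖ ^ 2 +
        2 * Real.pi * Complex.I * ⟪x, ξ⟫_ℝ) = ((-ε * ‖ξ‖ ^ 2 : ℝ) : ℂ) +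
        ((-2 * Real.pi ^ 2 * t * ‖ξ‖ ^ 2 + 2 * Real.pi * ⟪x, ξ⟫_ℝ : ℝ) : ℂ) * Complex.I := by
      push_cast
      ring
    rw [h2]
    simp only [Complex.add_re, Complex.ofReal_re, Complex.re_ofReal_mul, Complex.I_re, mul_zero,
      add_zero]
    have : 0 ≤ ε := le_of_lt hε
    nlinarith [sq_nonneg ‖ξ‖, mul_nonneg this (sq_nonneg ‖ξ‖)]
  · refine Eventually.of_forall fun ξ => ?_
    have hc : Continuous fun ε : ℝ => Complex.exp (-((ε : ℂ) + 2 * Real.pi ^ 2 * t * Complex.I) *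
      ‖ξ‖ ^ 2 + 2 * Real.pi * Complex.I * ⟪x, ξ⟫_ℝ) • 𝓕 g ξ := by fun_prop
    exact (hc.tendsto 0).mono_left nhdsWithin_le_nhds

theorem integral_gaussian_smul_fourier {b : ℂ} (hb : 0 < b.re) (g : 𝓢(Space3, ℂ)) (x : Space3) :
    ∫ ξ : Space3, Complex.exp (-b * ‖ξ‖ ^ 2 + 2 * Real.pi * Complex.I * ⟪x, ξ⟫_ℝ) • 𝓕 g ξ =
      (Real.pi / b) ^ (3 / 2 : ℂ) *
        ∫ y : Space3, Complex.exp (-Real.pi ^ 2 * ‖x - y‖ ^ 2 / b) * g y := by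
  have J : Integrable (fun ξ : Space3 =>
      Complex.exp (-b * ‖ξ‖ ^ 2 + 2 * Real.pi * Complex.I * ⟪x, ξ⟫_ℝ)) :=
    GaussianFourier.integrable_cexp_neg_mul_sq_norm_add hb _ _
  have h := (VectorFourier.integral_fourierIntegral_smul_eq_flip (L := innerₗ Space3)
      Real.continuous_fourierChar continuous_inner J g.integrable (ν := volume)).symm
  have h2 : ∫ ξ : Space3, Complex.exp (-b * ‖ξ‖ ^ 2 + 2 * Real.pi * Complex.I * ⟪x, ξ⟫_ℝ) • 𝓕 g ξ =
      ∫ y : Space3, 𝓕 (fun ξ : Space3 => Complex.exp (-b * ‖ξ‖ ^ 2 +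
        2 * Real.pi * Complex.I * ⟪x, ξ⟫_ℝ)) y • g y := by
    simpa [SchwartzMap.fourier_coe] using! h
  rw [h2, ← integral_const_mul]
  refine integral_congr_ae (Eventually.of_forall fun y => ?_)
  simp only
  rw [fourier_gaussian_innerProductSpace' hb, smul_eq_mul, mul_assoc]
  simp

/-- In the kernel of e^{-itH_P}, exp(i|x-y|²/2t) is a phase in x times exp(-i⟨x, y⟩/t), the Fourier
kernel at frequency x/(2πt), times the chirp in y. The phase drops out of the modulus. -/
theorem norm_freeEvol_apply {t : ℝ} (ht : 0 < t) (g : 𝓢(Space3, ℂ)) (x : Space3) :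
    ‖freeEvol t g x‖ =
      (2 * Real.pi * t)⁻¹ ^ (3 / 2 : ℝ) * ‖𝓕 (chirp t g) ((2 * Real.pi * t)⁻¹ • x)‖ := by
  have hpi := Real.pi_pos
  set b₀ : ℂ := 2 * Real.pi ^ 2 * t * Complex.I with hb₀
  have hb₀' : b₀ ≠ 0 := by simp [hb₀, hpi.ne', ht.ne']
  have hq : (Real.pi : ℂ) / b₀ = ((2 * Real.pi * t)⁻¹ : ℝ) * (-Complex.I) := by
    rw [hb₀]
    push_cast
    field_simp
    simp
    ring
  have hlim : Tendsto (fun ε : ℝ => (Real.pi / (ε + b₀)) ^ (3 / 2 : ℂ) *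
        ∫ y : Space3, Complex.exp (-Real.pi ^ 2 * ‖x - y‖ ^ 2 / (ε + b₀)) * g y) (𝓝[>] 0)
      (𝓝 ((Real.pi / b₀) ^ (3 / 2 : ℂ) *
        ∫ y : Space3, Complex.exp (-Real.pi ^ 2 * ‖x - y‖ ^ 2 / b₀) * g y)) := by
    have hc : Tendsto (fun ε : ℝ => (ε : ℂ) + b₀) (𝓝[>] 0) (𝓝 b₀) := by
      have : Continuous fun ε : ℝ => (ε : ℂ) + b₀ := by fun_prop
      have h := (this.tendsto 0).mono_left (nhdsWithin_le_nhds (s := Set.Ioi 0))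
      simpa using h
    refine Tendsto.mul ?_ ?_
    -- The limit π/b₀ lies on the negative imaginary axis, off the branch cut of the power 3/2.
    · refine Tendsto.cpow (tendsto_const_nhds.div hc hb₀') tendsto_const_nhds ?_
      right
      rw [hq]
      simp [hpi.ne', ht.ne']
    · refine tendsto_integral_filter_of_dominated_convergence (fun y => ‖g y‖) ?_ ?_
        g.integrable.norm ?_
      · refine Eventually.of_forall fun ε => Continuous.aestronglyMeasurable ?_
        have := g.continuous
        fun_prop
      · filter_upwards [self_mem_nhdsWithin] with ε hε
        refine Eventually.of_forall fun y => ?_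
        rw [norm_mul]
        refine mul_le_of_le_one_left (norm_nonneg _) ?_
        rw [Complex.norm_exp, Real.exp_le_one_iff]
        have h3 : (-(Real.pi : ℂ) ^ 2 * ‖x - y‖ ^ 2 / (ε + b₀)) =
            ((Real.pi ^ 2 * ‖x - y‖ ^ 2 : ℝ) : ℂ) * (-((ε : ℂ) + b₀)⁻¹) := by
          push_cast
          ring
        rw [h3, Complex.re_ofReal_mul]
        refine mul_nonpos_of_nonneg_of_nonpos (by positivity) ?_
        rw [Complex.neg_re, Complex.inv_re, neg_nonpos]
        have : ((ε : ℂ) + b₀).re = ε := by simp [hb₀, ← Complex.ofReal_pow]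
        rw [this]
        exact div_nonneg (le_of_lt hε) (Complex.normSq_nonneg _)
      · refine Eventually.of_forall fun y => ?_
        exact ((tendsto_const_nhds.div hc hb₀').cexp).mul_const _
  have hlim2 := tendsto_integral_regularized_freeEvol t g x
  have heq : (fun ε : ℝ => ∫ ξ : Space3, Complex.exp (-(ε + 2 * Real.pi ^ 2 * t * Complex.I) *
      ‖ξ‖ ^ 2 + 2 * Real.pi * Complex.I * ⟪x, ξ⟫_ℝ) • 𝓕 g ξ) =ᶠ[𝓝[>] 0]
      (fun ε : ℝ => (Real.pi / (ε + b₀)) ^ (3 / 2 : ℂ) *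
        ∫ y : Space3, Complex.exp (-Real.pi ^ 2 * ‖x - y‖ ^ 2 / (ε + b₀)) * g y) := by
    filter_upwards [self_mem_nhdsWithin] with ε hε
    refine integral_gaussian_smul_fourier ?_ g x
    have : ((ε : ℂ) + b₀).re = ε := by simp [hb₀, ← Complex.ofReal_pow]
    rw [← hb₀, this]
    exact hε
  have hval := tendsto_nhds_unique (hlim2.congr' heq) hlim
  rw [hval, norm_mul]
  congr 1
  · rw [hq]
    have h0 : ((2 * Real.pi * t)⁻¹ : ℝ) * (-Complex.I) ≠ 0 := by
      simp [hpi.ne', ht.ne']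
    rw [show (3 / 2 : ℂ) = ((3 / 2 : ℝ) : ℂ) by push_cast; rfl, Complex.norm_cpow_real]
    rw [norm_mul, norm_neg, Complex.norm_I, mul_one, Complex.norm_real, Real.norm_of_nonneg]
    positivity
  · have h4 : ∫ y : Space3, Complex.exp (-Real.pi ^ 2 * ‖x - y‖ ^ 2 / b₀) * g y =
        Complex.exp (Complex.I * ((‖x‖ ^ 2 / (2 * t) : ℝ) : ℂ)) *
          𝓕 (chirp t g) ((2 * Real.pi * t)⁻¹ • x) := by
      rw [SchwartzMap.fourier_coe, Real.fourier_eq', ← integral_const_mul]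
      refine integral_congr_ae (Eventually.of_forall fun y => ?_)
      simp only
      rw [chirp_apply, smul_eq_mul, ← mul_assoc, ← mul_assoc, ← Complex.exp_add, ← Complex.exp_add]
      congr 2
      have h5 : (‖x - y‖ ^ 2 : ℂ) = ((‖x‖ ^ 2 - 2 * ⟪x, y⟫_ℝ + ‖y‖ ^ 2 : ℝ) : ℂ) := by
        rw [← norm_sub_sq_real]
        push_cast
        rfl
      rw [h5, inner_smul_right, real_inner_comm y x, hb₀]
      push_cast
      have hI : Complex.I * Complex.I = -1 := Complex.I_mul_I
      have ht' : (t : ℂ) ≠ 0 := by exact_mod_cast ht.ne'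
      have hp' : (Real.pi : ℂ) ≠ 0 := by exact_mod_cast hpi.ne'
      field_simp
      ring_nf
      simp only [Complex.I_sq]
      ring
    rw [h4, norm_mul, Complex.norm_exp_I_mul_ofReal, one_mul]

end Propagation

section Propagation

/-- Multiplication by a linear form becomes, up to a constant, a derivative of the Fourier
transform, which vanishes identically near any point of the open complement of A. -/
theorem fourier_inner_smul_eq_zero {A : Set Space3} (hA : IsClosed A) {g : 𝓢(Space3, ℂ)}
    (hg : ∀ ξ ∉ A, 𝓕 g ξ = 0) (m : Space3) :
    ∀ ξ ∉ A, 𝓕 (SchwartzMap.smulLeftCLM ℂ (fun y : Space3 => ⟪y, m⟫_ℝ) g) ξ = 0 := by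
  intro ξ hξ
  have h1 : ∂_{m} (𝓕 g) ξ = 0 := by
    rw [SchwartzMap.lineDerivOp_apply_eq_fderiv]
    have : ⇑(𝓕 g : 𝓢(Space3, ℂ)) =ᶠ[𝓝 ξ] fun _ => 0 := by
      filter_upwards [hA.isOpen_compl.mem_nhds hξ] with y hy
      exact hg y hy
    rw [this.fderiv_eq]
    simp
  rw [SchwartzMap.lineDerivOp_fourier_eq, FourierTransform.fourier_smul, smul_apply] at h1
  rcases smul_eq_zero.1 h1 with h | h
  · exact absurd h (by simp [Real.pi_ne_zero])
  · exact h

theorem fourier_norm_sq_smul_eq_zero {A : Set Space3} (hA : IsClosed A) {g : 𝓢(Space3, ℂ)}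
    (hg : ∀ ξ ∉ A, 𝓕 g ξ = 0) :
    ∀ ξ ∉ A, 𝓕 (SchwartzMap.smulLeftCLM ℂ (fun y : Space3 => ‖y‖ ^ 2) g) ξ = 0 := by
  intro ξ hξ
  have h1 : SchwartzMap.smulLeftCLM ℂ (fun y : Space3 => ‖y‖ ^ 2) g =
      ∑ j, SchwartzMap.smulLeftCLM ℂ (fun y : Space3 => ⟪y, stdBasis3 j⟫_ℝ)
        (SchwartzMap.smulLeftCLM ℂ (fun y : Space3 => ⟪y, stdBasis3 j⟫_ℝ) g) := by
    ext y
    have h2 : (fun y : Space3 => ‖y‖ ^ 2).HasTemperateGrowth :=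
      Function.hasTemperateGrowth_norm_sq Space3
    have h3 : ∀ j, (fun y : Space3 => ⟪y, stdBasis3 j⟫_ℝ).HasTemperateGrowth := fun j => by fun_prop
    rw [SchwartzMap.smulLeftCLM_apply_apply h2, sum_apply]
    simp only [SchwartzMap.smulLeftCLM_apply_apply (h3 _), smul_smul]
    rw [← Finset.sum_smul]
    congr 1
    have := stdBasis3.sum_sq_norm_inner_right y
    rw [← this]
    refine Finset.sum_congr rfl fun j _ => ?_
    rw [real_inner_comm, Real.norm_eq_abs, sq_abs, sq]
  rw [h1]
  have h4 : 𝓕 (∑ j, SchwartzMap.smulLeftCLM ℂ (fun y : Space3 => ⟪y, stdBasis3 j⟫_ℝ)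
        (SchwartzMap.smulLeftCLM ℂ (fun y : Space3 => ⟪y, stdBasis3 j⟫_ℝ) g)) =
      ∑ j, 𝓕 (SchwartzMap.smulLeftCLM ℂ (fun y : Space3 => ⟪y, stdBasis3 j⟫_ℝ)
        (SchwartzMap.smulLeftCLM ℂ (fun y : Space3 => ⟪y, stdBasis3 j⟫_ℝ) g)) :=
    map_sum (FourierTransform.fourierCLM ℂ 𝓢(Space3, ℂ)) _ _
  rw [h4, sum_apply]
  exact Finset.sum_eq_zero fun j _ =>
    fourier_inner_smul_eq_zero hA (fourier_inner_smul_eq_zero hA hg _) _ ξ hξ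

/-- The rescaled function `x ↦ c^{3/2} f(c x)`, which has the same `L²` norm as `f`. -/
def dilate (c : ℝ) (f : 𝓢(Space3, ℂ)) : 𝓢(Space3, ℂ) :=
  if hc : c ≠ 0 then
    ((c ^ (3 / 2 : ℝ) : ℝ) : ℂ) • SchwartzMap.compCLMOfContinuousLinearEquiv ℂ
      (ContinuousLinearEquiv.smulLeft (Units.mk0 c hc)) f
  else 0

theorem dilate_apply {c : ℝ} (hc : c ≠ 0) (f : 𝓢(Space3, ℂ)) (x : Space3) :
    dilate c f x = ((c ^ (3 / 2 : ℝ) : ℝ) : ℂ) * f (c • x) := by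
  rw [dilate, dif_pos hc]
  rfl

theorem norm_toLp_dilate {c : ℝ} (hc : 0 < c) (f : 𝓢(Space3, ℂ)) :
    ‖(dilate c f).toLp 2 volume‖ = ‖f.toLp 2 volume‖ := by
  rw [SchwartzMap.norm_toLp' (by simp) (by simp), SchwartzMap.norm_toLp' (by simp) (by simp)]
  congr 1
  have h1 : ∀ x, ‖dilate c f x‖ ^ (2 : ℝ≥0∞).toReal =
      c ^ (3 : ℕ) * (fun y => ‖f y‖ ^ (2 : ℝ≥0∞).toReal) (c • x) := by
    intro x
    rw [dilate_apply hc.ne', norm_mul, Complex.norm_real, Real.norm_of_nonneg (by positivity),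
      Real.mul_rpow (by positivity) (by positivity), ← Real.rpow_mul hc.le]
    congr 1
    rw [← Real.rpow_natCast]
    norm_num
  simp only [h1]
  rw [integral_const_mul,
    Measure.integral_comp_smul volume (fun y => ‖f y‖ ^ (2 : ℝ≥0∞).toReal) c]
  simp only [finrank_euclideanSpace, Fintype.card_fin, smul_eq_mul]
  rw [abs_of_pos (by positivity), ← mul_assoc, mul_inv_cancel₀ (by positivity), one_mul]

/-- The chirp is expanded as 1 + i|y|²/(2t) + O(|y|⁴/t²). The Fourier transforms of g and of |y|²g
vanish off A, so at frequencies x/(2πt) off A only the remainder contributes. Its dilation preserves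
the L² norm, which gives the rate t⁻². -/
theorem exists_remainder_freeEvol {A : Set Space3} (hA : IsClosed A) {g : 𝓢(Space3, ℂ)}
    (hg : ∀ ξ ∉ A, 𝓕 g ξ = 0) :
    ∃ κ : ℝ, 0 ≤ κ ∧ ∀ t : ℝ, 0 < t → ∃ r : 𝓢(Space3, ℂ), ‖r.toLp 2 volume‖ ≤ κ / t ^ 2 ∧
      ∀ x, (2 * Real.pi * t)⁻¹ • x ∉ A → ‖freeEvol t g x‖ ≤ ‖r x‖ := by
  have hn : (fun y : Space3 => ‖y‖ ^ 2).HasTemperateGrowth :=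
    Function.hasTemperateGrowth_norm_sq Space3
  set g₁ := SchwartzMap.smulLeftCLM ℂ (fun y : Space3 => ‖y‖ ^ 2) g with hg₁
  set g₂ := SchwartzMap.smulLeftCLM ℂ (fun y : Space3 => ‖y‖ ^ 2) g₁ with hg₂
  refine ⟨‖g₂.toLp 2 volume‖, norm_nonneg _, fun t ht => ?_⟩
  have hc : 0 < (2 * Real.pi * t)⁻¹ := by have := Real.pi_pos; positivity
  set R : 𝓢(Space3, ℂ) := chirp t g - g - (Complex.I * ((2 * t)⁻¹ : ℝ)) • g₁ with hR
  refine ⟨dilate (2 * Real.pi * t)⁻¹ (𝓕 R), ?_, fun x hx => ?_⟩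
  · rw [norm_toLp_dilate hc, SchwartzMap.norm_fourier_toL2_eq]
    have h1 : ‖R.toLp 2 volume‖ ≤ ‖((((t ^ 2)⁻¹ : ℝ) : ℂ) • g₂).toLp 2 volume‖ := by
      refine SchwartzMap.norm_toLp_le_of_forall_norm_le fun y => ?_
      have h2 : R y = (Complex.exp (Complex.I * (((2 * t)⁻¹ * ‖y‖ ^ 2 : ℝ) : ℂ)) - 1 -
          Complex.I * (((2 * t)⁻¹ * ‖y‖ ^ 2 : ℝ) : ℂ)) * g y := by
        simp only [hR, sub_apply, smul_apply, chirp_apply, hg₁,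
          SchwartzMap.smulLeftCLM_apply_apply hn, Complex.real_smul, smul_eq_mul]
        push_cast
        ring
      rw [h2, norm_mul]
      simp only [smul_apply, hg₂, hg₁, SchwartzMap.smulLeftCLM_apply_apply hn, norm_smul,
        Complex.norm_real, Real.norm_eq_abs, abs_pow, abs_norm]
      rw [abs_of_pos (by positivity : 0 < (t ^ 2)⁻¹)]
      calc _ ≤ ((2 * t)⁻¹ * ‖y‖ ^ 2) ^ 2 * ‖g y‖ := by
            gcongr
            exact norm_cexp_I_mul_sub_one_sub_le _
        _ = (1 / 4) * ((t ^ 2)⁻¹ * (‖y‖ ^ 2 * (‖y‖ ^ 2 * ‖g y‖))) := by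
          field_simp
          ring
        _ ≤ 1 * ((t ^ 2)⁻¹ * (‖y‖ ^ 2 * (‖y‖ ^ 2 * ‖g y‖))) := by
          gcongr
          norm_num
        _ = _ := one_mul _
    refine h1.trans (le_of_eq ?_)
    have h3 : ((((t ^ 2)⁻¹ : ℝ) : ℂ) • g₂).toLp 2 volume =
      (((t ^ 2)⁻¹ : ℝ) : ℂ) • g₂.toLp 2 (volume : Measure Space3) := rfl
    rw [h3, norm_smul, Complex.norm_real, Real.norm_of_nonneg (by positivity), div_eq_inv_mul]
  · rw [norm_freeEvol_apply ht, dilate_apply hc.ne', norm_mul, Complex.norm_real,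
      Real.norm_of_nonneg (by positivity)]
    have h4 : 𝓕 R ((2 * Real.pi * t)⁻¹ • x) = 𝓕 (chirp t g) ((2 * Real.pi * t)⁻¹ • x) := by
      have h5 : 𝓕 R = 𝓕 (chirp t g) - 𝓕 g - (Complex.I * ((2 * t)⁻¹ : ℝ)) • 𝓕 g₁ := by
        rw [hR, sub_eq_add_neg, sub_eq_add_neg, FourierTransform.fourier_add,
          FourierTransform.fourier_add, FourierTransform.fourier_neg, FourierTransform.fourier_neg,
          FourierTransform.fourier_smul, ← sub_eq_add_neg, ← sub_eq_add_neg]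
      rw [h5, sub_apply, sub_apply, smul_apply, hg _ hx,
        fourier_norm_sq_smul_eq_zero hA hg _ hx]
      simp
    rw [h4]

/-- The set of wave vectors (for the transform with kernel `e^{-2πi⟨ξ, x⟩}`) of states moving with
velocity at least `v` inside a cone. -/
def outgoingSet (e : Space3) (θ v : ℝ) : Set Space3 :=
  {ξ | ξ ∈ cone e θ ∧ v ≤ 2 * Real.pi * ‖ξ‖}

theorem isClosed_cone (e : Space3) (θ : ℝ) : IsClosed (cone e θ) :=
  isClosed_le (f := fun k : Space3 => ‖k‖ * Real.cos θ) (g := fun k => ⟪k, e⟫_ℝ)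
    (by fun_prop) (by fun_prop)

theorem isClosed_outgoingSet (e : Space3) (θ v : ℝ) : IsClosed (outgoingSet e θ v) :=
  (isClosed_cone e θ).inter (isClosed_le (f := fun _ : Space3 => v)
    (g := fun ξ => 2 * Real.pi * ‖ξ‖) (by fun_prop) (by fun_prop))

theorem smul_mem_cone {e : Space3} {θ c : ℝ} (hc : 0 < c) {x : Space3} :
    c • x ∈ cone e θ ↔ x ∈ cone e θ := by
  change ‖c • x‖ * Real.cos θ ≤ ⟪c • x, e⟫_ℝ ↔ ‖x‖ * Real.cos θ ≤ ⟪x, e⟫_ℝ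
  rw [norm_smul, Real.norm_of_nonneg hc.le, real_inner_smul_left, mul_assoc,
    mul_le_mul_iff_right₀ hc]

/-- The frequency x/(2πt) lies in the outgoing set exactly when x is in the cone and |x| ≥ vt, so
the large-time remainder applies in the rest of space. -/
theorem exists_propagation_bound {e : Space3} {θ v : ℝ} {g : 𝓢(Space3, ℂ)}
    (hg : ∀ ξ ∉ outgoingSet e θ v, 𝓕 g ξ = 0) :
    ∃ κ : ℝ, 0 ≤ κ ∧ ∀ t : ℝ, 0 ≤ t → ∃ r : 𝓢(Space3, ℂ),
      ‖r.toLp 2 volume‖ ≤ κ * (1 + t) ^ (-2 : ℝ) ∧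
      ∀ x, ¬ (x ∈ cone e θ ∧ v * t ≤ ‖x‖) → ‖freeEvol t g x‖ ≤ ‖r x‖ := by
  obtain ⟨κ, hκ, h⟩ := exists_remainder_freeEvol (isClosed_outgoingSet e θ v) hg
  have hrp : ∀ t : ℝ, 0 ≤ t → (1 + t) ^ (-2 : ℝ) = ((1 + t) ^ 2)⁻¹ := fun t ht => by
    rw [Real.rpow_neg (by linarith)]
    norm_cast
  refine ⟨4 * κ + 4 * ‖g.toLp 2 volume‖, by positivity, fun t ht => ?_⟩
  rw [hrp t ht]
  rcases lt_or_ge t 1 with h1 | h1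
  -- For t < 1 the whole packet serves as remainder: its norm is conserved and (1+t)² ≤ 4.
  · refine ⟨freeEvol t g, ?_, fun x _ => le_rfl⟩
    rw [norm_toLp_freeEvol, ← div_eq_mul_inv, le_div_iff₀ (by positivity)]
    have h2 : (1 + t) ^ 2 ≤ 4 := by nlinarith
    nlinarith [mul_le_mul_of_nonneg_left h2 (norm_nonneg (g.toLp 2 (volume : Measure Space3)))]
  · have ht0 : 0 < t := by linarith
    obtain ⟨r, hr, hr'⟩ := h t ht0
    refine ⟨r, hr.trans ?_, fun x hx => hr' x fun hx' => hx ?_⟩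
    · rw [← div_eq_mul_inv, div_le_div_iff₀ (by positivity) (by positivity)]
      have h2 : (1 + t) ^ 2 ≤ 4 * t ^ 2 := by nlinarith
      nlinarith [norm_nonneg (g.toLp 2 (volume : Measure Space3)), sq_nonneg t,
        mul_le_mul_of_nonneg_left h2 hκ,
        mul_nonneg (norm_nonneg (g.toLp 2 (volume : Measure Space3))) (sq_nonneg t)]
    · have hp := Real.pi_pos
      have hc : 0 < (2 * Real.pi * t)⁻¹ := by positivity
      obtain ⟨h2, h3⟩ := hx'
      refine ⟨(smul_mem_cone hc).1 h2, ?_⟩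
      rw [norm_smul, Real.norm_of_nonneg hc.le] at h3
      have : 2 * Real.pi * ((2 * Real.pi * t)⁻¹ * ‖x‖) = ‖x‖ / t := by field_simp
      rw [this, le_div_iff₀ ht0] at h3
      exact h3

end Propagation

/-! ### The free evolution with a position cutoff -/

section CutoffEvolution

/-- Multiplication of Schwartz functions by a real function of temperate growth. -/
def cutMul (w : Space3 → ℝ) : 𝓢(Space3, ℂ) →L[ℂ] 𝓢(Space3, ℂ) :=
  SchwartzMap.smulLeftCLM ℂ (fun x => (w x : ℂ))

theorem cutMul_apply {w : Space3 → ℝ} (hw : w.HasTemperateGrowth) (f : 𝓢(Space3, ℂ)) (x : Space3) :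
    cutMul w f x = (w x : ℂ) * f x := by
  rw [cutMul, SchwartzMap.smulLeftCLM_apply_apply (by fun_prop), smul_eq_mul]

theorem norm_toLp_cutMul_le {w : Space3 → ℝ} (hw : w.HasTemperateGrowth) {B : ℝ} (hB : 0 ≤ B)
    {f r : 𝓢(Space3, ℂ)} (h : ∀ x, |w x| * ‖f x‖ ≤ B * ‖r x‖) :
    ‖(cutMul w f).toLp 2 volume‖ ≤ B * ‖r.toLp 2 volume‖ := by
  have h1 : ‖(cutMul w f).toLp 2 volume‖ ≤ ‖((B : ℂ) • r).toLp 2 volume‖ := by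
    refine SchwartzMap.norm_toLp_le_of_forall_norm_le fun x => ?_
    rw [cutMul_apply hw, smul_apply, norm_mul, norm_smul, Complex.norm_real, Complex.norm_real,
      Real.norm_eq_abs, Real.norm_of_nonneg hB]
    exact h x
  refine h1.trans (le_of_eq ?_)
  have h2 : ((B : ℂ) • r).toLp 2 volume = (B : ℂ) • r.toLp 2 (volume : Measure Space3) := rfl
  rw [h2, norm_smul, Complex.norm_real, Real.norm_of_nonneg hB]

theorem IsCutoff.norm_toLp_cutMul_le {w : Space3 → ℝ} {w₁ w₂ : Fin 3 → Space3 → ℝ} {B₁ B₂ : ℝ}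
    (h : IsCutoff w w₁ w₂ B₁ B₂) (f : 𝓢(Space3, ℂ)) :
    ‖(cutMul w f).toLp 2 volume‖ ≤ ‖f.toLp 2 volume‖ := by
  have := _root_.norm_toLp_cutMul_le h.growth zero_le_one (f := f) (r := f) fun x => by
    rw [abs_of_nonneg (h.nonneg x)]
    exact mul_le_mul_of_nonneg_right (h.le_one x) (norm_nonneg _)
  rwa [one_mul] at this

theorem lineDeriv_cutMul {w w₁ : Space3 → ℝ} (hw : w.HasTemperateGrowth)
    (hw₁ : w₁.HasTemperateGrowth) {v : Space3} (hd : ∀ x, HasLineDerivAt ℝ w (w₁ x) x v)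
    (f : 𝓢(Space3, ℂ)) :
    ∂_{v} (cutMul w f) = cutMul w₁ f + cutMul w (∂_{v} f) := by
  ext x
  rw [add_apply, cutMul_apply hw₁, cutMul_apply hw, SchwartzMap.lineDerivOp_apply]
  have h1 := hd x
  have h2 : HasLineDerivAt ℝ f (∂_{v} f x) x v := by
    rw [SchwartzMap.lineDerivOp_apply]
    exact f.differentiableAt.lineDifferentiableAt.hasLineDerivAt
  have h3 : HasLineDerivAt ℝ (cutMul w f) ((w₁ x : ℂ) * f x + (w x : ℂ) * ∂_{v} f x) x v := by
    unfold HasLineDerivAt at *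
    have h4 : (fun t : ℝ => cutMul w f (x + t • v)) = fun t : ℝ =>
        ((w (x + t • v) : ℝ) : ℂ) * f (x + t • v) := by
      ext t
      exact cutMul_apply hw f _
    rw [h4]
    convert! h1.ofReal_comp.mul h2 using 1
    simp
  exact h3.lineDeriv

/-- The commutator of `-Δ/2` with a cutoff. -/
theorem schwartzHam_cutMul {w : Space3 → ℝ} {w₁ w₂ : Fin 3 → Space3 → ℝ} {B₁ B₂ : ℝ}
    (h : IsCutoff w w₁ w₂ B₁ B₂) (f : 𝓢(Space3, ℂ)) :
    schwartzHam (cutMul w f) - cutMul w (schwartzHam f) =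
      (-(1 / 2) : ℂ) • ∑ j, (cutMul (w₂ j) f + (2 : ℂ) • cutMul (w₁ j) (∂_{stdBasis3 j} f)) := by
  rw [schwartzHam, schwartzHam, map_smul, ← smul_sub]
  congr 1
  rw [SchwartzMap.laplacian_eq_sum stdBasis3, SchwartzMap.laplacian_eq_sum stdBasis3, map_sum,
    ← Finset.sum_sub_distrib]
  refine Finset.sum_congr rfl fun j _ => ?_
  rw [lineDeriv_cutMul h.growth (h.growth₁ j) (h.deriv₁ j), LineDeriv.lineDerivOp_add,
    lineDeriv_cutMul (h.growth₁ j) (h.growth₂ j) (h.deriv₂ j),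
    lineDeriv_cutMul h.growth (h.growth₁ j) (h.deriv₁ j), two_smul]
  abel

theorem fourier_lineDeriv_eq_zero {A : Set Space3} {g : 𝓢(Space3, ℂ)}
    (hg : ∀ ξ ∉ A, 𝓕 g ξ = 0) (m : Space3) : ∀ ξ ∉ A, 𝓕 (∂_{m} g) ξ = 0 := by
  intro ξ hξ
  rw [SchwartzMap.fourier_lineDerivOp_eq, smul_apply,
    SchwartzMap.smulLeftCLM_apply_apply (by fun_prop), hg ξ hξ]
  simp

/-- The commutator contains only derivatives of w, which vanish on the cone, and so it meets only
the small part of the packet and of its partial derivatives (which have the same spectral support).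
The constant depends on g alone; this matters because w is dilated with d. -/
theorem exists_commutator_bound {e : Space3} {θ v : ℝ} {g : 𝓢(Space3, ℂ)}
    (hg : ∀ ξ ∉ outgoingSet e θ v, 𝓕 g ξ = 0) :
    ∃ κ : ℝ, 0 ≤ κ ∧ ∀ (w : Space3 → ℝ) (w₁ w₂ : Fin 3 → Space3 → ℝ) (B₁ B₂ : ℝ),
      IsCutoff w w₁ w₂ B₁ B₂ → (∀ x ∈ cone e θ, ∀ j, w₁ j x = 0 ∧ w₂ j x = 0) →
      ∀ t : ℝ, 0 ≤ t →
        ‖(schwartzHam (cutMul w (freeEvol t g)) - cutMul w (schwartzHam (freeEvol t g))).toLp 2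
          volume‖ ≤ κ * (B₁ + B₂) * (1 + t) ^ (-2 : ℝ) := by
  obtain ⟨κ₀, hκ₀, h₀⟩ := exists_propagation_bound hg
  choose κ hκ h using fun j => exists_propagation_bound
    (fourier_lineDeriv_eq_zero hg (stdBasis3 j))
  refine ⟨∑ j, (κ₀ + 2 * κ j), Finset.sum_nonneg fun j _ => by have := hκ j; positivity,
    fun w w₁ w₂ B₁ B₂ hw hz t ht => ?_⟩
  have hB₁ : 0 ≤ B₁ := (abs_nonneg _).trans (hw.bound₁ 0 0)
  have hB₂ : 0 ≤ B₂ := (abs_nonneg _).trans (hw.bound₂ 0 0)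
  have hT : 0 ≤ (1 + t) ^ (-2 : ℝ) := by positivity
  obtain ⟨r₀, hr₀, hr₀'⟩ := h₀ t ht
  -- A bounded multiplier that vanishes on the cone sees only the remainder r of the packet.
  have key : ∀ (u : Space3 → ℝ) (B : ℝ) (f r : 𝓢(Space3, ℂ)), u.HasTemperateGrowth → 0 ≤ B →
      (∀ x, |u x| ≤ B) → (∀ x ∈ cone e θ, u x = 0) →
      (∀ x, ¬ (x ∈ cone e θ ∧ v * t ≤ ‖x‖) → ‖f x‖ ≤ ‖r x‖) →
      ‖(cutMul u f).toLp 2 volume‖ ≤ B * ‖r.toLp 2 volume‖ := by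
    intro u B f r hu hB hb hz' hr
    refine norm_toLp_cutMul_le hu hB fun x => ?_
    by_cases hx : x ∈ cone e θ
    · rw [hz' x hx, abs_zero, zero_mul]
      positivity
    · have := hr x fun h => hx h.1
      have := hb x
      gcongr
  rw [schwartzHam_cutMul hw]
  have e1 : ((-(1 / 2) : ℂ) • ∑ j, (cutMul (w₂ j) (freeEvol t g) +
      (2 : ℂ) • cutMul (w₁ j) (∂_{stdBasis3 j} (freeEvol t g)))).toLp 2 volume =
      (-(1 / 2) : ℂ) • ∑ j, ((cutMul (w₂ j) (freeEvol t g)).toLp 2 (volume : Measure Space3) +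
      (2 : ℂ) • (cutMul (w₁ j) (∂_{stdBasis3 j} (freeEvol t g))).toLp 2
        (volume : Measure Space3)) := by
    simp only [← SchwartzMap.toLpCLM_apply (𝕜 := ℂ), map_smul, map_sum, map_add]
  rw [e1, norm_smul]
  have e2 : ‖(-(1 / 2) : ℂ)‖ ≤ 1 := by
    rw [norm_neg]
    norm_num
  refine (mul_le_of_le_one_left (norm_nonneg _) e2).trans ?_
  rw [Finset.sum_mul, Finset.sum_mul]
  refine (norm_sum_le _ _).trans (Finset.sum_le_sum fun j _ => ?_)
  obtain ⟨r, hr, hr'⟩ := h j t ht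
  rw [← lineDeriv_freeEvol] at hr'
  have a1 := key (w₂ j) B₂ (freeEvol t g) r₀ (hw.growth₂ j) hB₂ (hw.bound₂ j)
    (fun x hx => (hz x hx j).2) hr₀'
  have a2 := key (w₁ j) B₁ _ r (hw.growth₁ j) hB₁ (hw.bound₁ j)
    (fun x hx => (hz x hx j).1) hr'
  refine (norm_add_le _ _).trans ?_
  rw [norm_smul]
  have e3 : ‖(2 : ℂ)‖ = 2 := by norm_num
  rw [e3]
  have b1 := a1.trans (mul_le_mul_of_nonneg_left hr₀ hB₂)
  have b2 := a2.trans (mul_le_mul_of_nonneg_left hr hB₁)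
  have := hκ j
  have c1 : 0 ≤ B₁ * (κ₀ * (1 + t) ^ (-2 : ℝ)) := by positivity
  have c2 : 0 ≤ B₂ * (κ j * (1 + t) ^ (-2 : ℝ)) := by positivity
  nlinarith

/-- Since 0 ≤ w ≤ 1, multiplication by w is a contraction of L², so it preserves the little-o
estimate of the free evolution. -/
theorem hasDerivAt_toLp_cutMul_freeEvol {w : Space3 → ℝ} {w₁ w₂ : Fin 3 → Space3 → ℝ} {B₁ B₂ : ℝ}
    (h : IsCutoff w w₁ w₂ B₁ B₂) (f : 𝓢(Space3, ℂ)) (t : ℝ) :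
    HasDerivAt (fun s => (cutMul w (freeEvol s f)).toLp 2 volume)
      (-Complex.I • (cutMul w (schwartzHam (freeEvol t f))).toLp 2 volume) t := by
  have h1 := hasDerivAt_toLp_freeEvol f t
  rw [hasDerivAt_iff_isLittleO] at h1 ⊢
  refine Asymptotics.IsBigO.trans_isLittleO (Asymptotics.IsBigO.of_bound 1
    (Eventually.of_forall fun s => ?_)) h1
  rw [one_mul]
  set R : 𝓢(Space3, ℂ) := freeEvol s f - freeEvol t f -
    ((s - t : ℝ) : ℂ) • (-Complex.I • schwartzHam (freeEvol t f)) with hR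
  convert! h.norm_toLp_cutMul_le R using 2
  simp only [← SchwartzMap.toLpCLM_apply (𝕜 := ℂ), hR, map_smul, map_sub]
  rfl

/-- Pointwise 1 - w ≤ |x|²/ρ², since w differs from 1 only where |x| ≥ ρ. This makes the error at
time zero small as ρ grows, through the second moment of the packet. -/
theorem norm_toLp_sub_cutMul_le {w : Space3 → ℝ} {w₁ w₂ : Fin 3 → Space3 → ℝ} {B₁ B₂ : ℝ}
    (h : IsCutoff w w₁ w₂ B₁ B₂) {ρ : ℝ} (hρ : 0 < ρ) (hw : ∀ x, w x ≠ 1 → ρ ≤ ‖x‖)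
    (f : 𝓢(Space3, ℂ)) :
    ‖(f - cutMul w f).toLp 2 volume‖ ≤ (ρ ^ 2)⁻¹ *
      ‖(cutMul (fun x => ‖x‖ ^ 2) f).toLp 2 volume‖ := by
  have hn : (fun y : Space3 => ‖y‖ ^ 2).HasTemperateGrowth :=
    Function.hasTemperateGrowth_norm_sq Space3
  have h0 : f - cutMul w f = cutMul (fun x => 1 - w x) f := by
    ext x
    have := h.growth
    rw [sub_apply, cutMul_apply h.growth, cutMul_apply (by fun_prop)]
    push_cast
    ring
  rw [h0]
  have := h.growth
  refine norm_toLp_cutMul_le (by fun_prop) (by positivity) fun x => ?_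
  rw [cutMul_apply hn, norm_mul, Complex.norm_real, norm_pow, norm_norm, ← mul_assoc]
  refine mul_le_mul_of_nonneg_right ?_ (norm_nonneg _)
  by_cases hx : w x = 1
  · rw [hx, sub_self, abs_zero]
    positivity
  · have h1 := hw x hx
    have h2 : |1 - w x| ≤ 1 := by
      rw [abs_le]
      constructor <;> linarith [h.nonneg x, h.le_one x]
    refine h2.trans ?_
    rw [← div_eq_inv_mul, one_le_div (by positivity)]
    gcongr

end CutoffEvolution

/-! ### Product vectors and partial inner products -/

section TensorAlgebra

variable {K : Type*} [NormedAddCommGroup K] [InnerProductSpace ℂ K]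

theorem spinorTensor_apply (q : K) (z : Spinor ℂ) (s : Fin 2) : spinorTensor q z s = z s • q := rfl

theorem coeFn_tens (f : SpinL2 ℂ) (q : K) :
    ∀ᵐ x : Space3, ∀ s, tens f q x s = f x s • q := by
  filter_upwards [(spinorTensor q).coeFn_compLp f] with x hx s
  rw [tens, hx]
  rfl

theorem coeFn_withSpin (f : Lp ℂ 2 (volume : Measure Space3)) (z : Spinor ℂ) :
    ∀ᵐ x : Space3, withSpin f z x = f x • z := by
  filter_upwards [(ContinuousLinearMap.toSpanSingleton ℂ z).coeFn_compLp f] with x hx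
  rw [withSpin, hx]
  rfl

theorem inner_tens (f f' : SpinL2 ℂ) (q q' : K) :
    ⟪tens f q, tens f' q'⟫_ℂ = ⟪f, f'⟫_ℂ * ⟪q, q'⟫_ℂ := by
  rw [L2.inner_def, L2.inner_def, ← integral_mul_const]
  refine integral_congr_ae ?_
  filter_upwards [coeFn_tens f q, coeFn_tens f' q'] with x hx hx'
  simp only [PiLp.inner_apply, hx, hx', inner_smul_left, inner_smul_right, Finset.sum_mul]
  refine Finset.sum_congr rfl fun s _ => ?_
  simp only [RCLike.inner_apply]
  ring

theorem inner_withSpin (f f' : Lp ℂ 2 (volume : Measure Space3)) (z z' : Spinor ℂ) :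
    ⟪withSpin f z, withSpin f' z'⟫_ℂ = ⟪f, f'⟫_ℂ * ⟪z, z'⟫_ℂ := by
  rw [L2.inner_def, L2.inner_def, ← integral_mul_const]
  refine integral_congr_ae ?_
  filter_upwards [coeFn_withSpin f z, coeFn_withSpin f' z'] with x hx hx'
  rw [hx, hx', inner_smul_left, inner_smul_right]
  simp only [RCLike.inner_apply]
  ring

theorem norm_tens (f : SpinL2 ℂ) (q : K) : ‖tens f q‖ = ‖f‖ * ‖q‖ := by
  have h := inner_tens f f q q
  rw [inner_self_eq_norm_sq_to_K, inner_self_eq_norm_sq_to_K, inner_self_eq_norm_sq_to_K,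
    ← mul_pow] at h
  have h2 : ‖tens f q‖ ^ 2 = (‖f‖ * ‖q‖) ^ 2 := by exact_mod_cast h
  exact (pow_left_inj₀ (norm_nonneg _) (by positivity) two_ne_zero).1 h2

theorem norm_withSpin (f : Lp ℂ 2 (volume : Measure Space3)) (z : Spinor ℂ) :
    ‖withSpin f z‖ = ‖f‖ * ‖z‖ := by
  have h := inner_withSpin f f z z
  rw [inner_self_eq_norm_sq_to_K, inner_self_eq_norm_sq_to_K, inner_self_eq_norm_sq_to_K,
    ← mul_pow] at h
  have h2 : ‖withSpin f z‖ ^ 2 = (‖f‖ * ‖z‖) ^ 2 := by exact_mod_cast h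
  exact (pow_left_inj₀ (norm_nonneg _) (by positivity) two_ne_zero).1 h2

variable (K) in
/-- The product `(f, q) ↦ f ⊗ q` as a bounded bilinear map. -/
def tensCLM : SpinL2 ℂ →L[ℂ] K →L[ℂ] SpinL2 K :=
  LinearMap.mkContinuous₂ (LinearMap.mk₂ ℂ (fun (f : SpinL2 ℂ) (q : K) => tens f q)
    (fun f f' q => (ContinuousLinearMap.compLpL 2 volume (spinorTensor q)).map_add f f')
    (fun c f q => (ContinuousLinearMap.compLpL 2 volume (spinorTensor q)).map_smul c f)
    (fun f q q' => by
      refine Lp.ext ?_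
      filter_upwards [coeFn_tens f (q + q'), coeFn_tens f q, coeFn_tens f q',
        Lp.coeFn_add (tens f q) (tens f q')] with x h h1 h2 h3
      ext s
      rw [h3, h s, Pi.add_apply, PiLp.add_apply, h1, h2, smul_add])
    (fun c f q => by
      refine Lp.ext ?_
      filter_upwards [coeFn_tens f (c • q), coeFn_tens f q,
        Lp.coeFn_smul c (tens f q)] with x h h1 h3
      ext s
      rw [h3, h s, Pi.smul_apply, PiLp.smul_apply, h1, smul_comm]))
    1 fun f q => by
      rw [one_mul]
      exact (norm_tens f q).le

@[simp]
theorem tensCLM_apply (f : SpinL2 ℂ) (q : K) : tensCLM K f q = tens f q := rfl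

/-- The map `f ↦ |f, z⟩`. -/
def withSpinCLM (z : Spinor ℂ) : Lp ℂ 2 (volume : Measure Space3) →L[ℂ] SpinL2 ℂ :=
  (ContinuousLinearMap.toSpanSingleton ℂ z).compLpL 2 volume

@[simp]
theorem withSpinCLM_apply (z : Spinor ℂ) (f : Lp ℂ 2 (volume : Measure Space3)) :
    withSpinCLM z f = withSpin f z := rfl

theorem coeFn_tens_withSpin (f : Lp ℂ 2 (volume : Measure Space3)) (z : Spinor ℂ) (q : K) :
    ∀ᵐ x : Space3, ∀ s, tens (withSpin f z) q x s = (f x * z s) • q := by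
  filter_upwards [coeFn_tens (withSpin f z) q, coeFn_withSpin f z] with x h h1 s
  rw [h, h1]
  rfl

theorem norm_tens_withSpin (f : Lp ℂ 2 (volume : Measure Space3)) (z : Spinor ℂ) (q : K) :
    ‖tens (withSpin f z) q‖ = ‖f‖ * ‖z‖ * ‖q‖ := by
  rw [norm_tens, norm_withSpin]

section Slice

variable [CompleteSpace K]

/-- The partial inner product `Ψ ↦ ⟨f, Ψ⟩_P`, with values in the state space of `Q`. -/
def slice (f : SpinL2 ℂ) : SpinL2 K →L[ℂ] K := ContinuousLinearMap.adjoint (tensCLM K f)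

theorem slice_tens (f f' : SpinL2 ℂ) (q : K) : slice f (tens f' q) = ⟪f, f'⟫_ℂ • q := by
  refine ext_inner_left ℂ fun u => ?_
  rw [slice, ContinuousLinearMap.adjoint_inner_right, tensCLM_apply, inner_tens, inner_smul_right]

theorem norm_slice_le (f : SpinL2 ℂ) (Ψ : SpinL2 K) : ‖slice f Ψ‖ ≤ ‖f‖ * ‖Ψ‖ := by
  refine (ContinuousLinearMap.le_opNorm _ _).trans ?_
  gcongr
  rw [slice, LinearIsometryEquiv.norm_map]
  refine ContinuousLinearMap.opNorm_le_bound _ (norm_nonneg _) fun q => ?_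
  rw [tensCLM_apply, norm_tens]

end Slice

theorem withSpin_toLp (g : 𝓢(Space3, ℂ)) (z : Spinor ℂ) :
    withSpin (g.toLp 2 volume) z =
      (SchwartzMap.postcompCLM (ContinuousLinearMap.toSpanSingleton ℂ z) g).toLp 2 volume := by
  refine Lp.ext ?_
  filter_upwards [coeFn_withSpin (g.toLp 2 volume) z, g.coeFn_toLp 2 volume,
    (SchwartzMap.postcompCLM (ContinuousLinearMap.toSpanSingleton ℂ z) g).coeFn_toLp 2 volume]
    with x h1 h2 h3
  rw [h1, h2, h3, SchwartzMap.postcompCLM_apply]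
  rfl

theorem lineDeriv_postcompCLM {F G : Type*} [NormedAddCommGroup F] [NormedSpace ℂ F]
    [NormedAddCommGroup G] [NormedSpace ℂ G] (T : F →L[ℂ] G) (g : 𝓢(Space3, F)) (m : Space3) :
    ∂_{m} (SchwartzMap.postcompCLM T g) = SchwartzMap.postcompCLM T (∂_{m} g) := by
  ext x
  rw [SchwartzMap.lineDerivOp_apply_eq_fderiv, SchwartzMap.postcompCLM_apply,
    SchwartzMap.lineDerivOp_apply_eq_fderiv]
  have h1 := (T.restrictScalars ℝ).hasFDerivAt.comp x (g.hasFDerivAt x)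
  have h2 : ⇑(SchwartzMap.postcompCLM T g) = (T.restrictScalars ℝ) ∘ g := by
    ext y
    rfl
  rw [h2, h1.fderiv]
  rfl

theorem laplacian_postcompCLM {F G : Type*} [NormedAddCommGroup F] [NormedSpace ℂ F]
    [NormedAddCommGroup G] [NormedSpace ℂ G] (T : F →L[ℂ] G) (g : 𝓢(Space3, F)) :
    Δ (SchwartzMap.postcompCLM T g) = SchwartzMap.postcompCLM T (Δ g) := by
  rw [SchwartzMap.laplacian_eq_sum stdBasis3, SchwartzMap.laplacian_eq_sum stdBasis3, map_sum]
  simp only [lineDeriv_postcompCLM]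

/-- On Schwartz functions the distributional Laplacian is the classical one, and it acts on the
scalar factor only. -/
theorem mem_graph_freeHam (g : 𝓢(Space3, ℂ)) (z : Spinor ℂ) :
    (withSpin (g.toLp 2 volume) z, withSpin ((schwartzHam g).toLp 2 volume) z) ∈ freeHam.graph := by
  rw [graph_freeHam]
  change (-(1 / 2) : ℂ) • Δ (Lp.toTemperedDistributionCLM (Spinor ℂ) volume 2
    (withSpin (g.toLp 2 volume) z)) = Lp.toTemperedDistributionCLM (Spinor ℂ) volume 2
      (withSpin ((schwartzHam g).toLp 2 volume) z)
  rw [withSpin_toLp, withSpin_toLp, Lp.toTemperedDistributionCLM_apply,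
    Lp.toTemperedDistributionCLM_apply, Lp.toTemperedDistribution_toLp_eq,
    Lp.toTemperedDistribution_toLp_eq, TemperedDistribution.laplacian_toTemperedDistributionCLM_eq,
    laplacian_postcompCLM, schwartzHam, map_smul, map_smul]

theorem withSpin_mem_domain (g : 𝓢(Space3, ℂ)) (z : Spinor ℂ) :
    withSpin (g.toLp 2 volume) z ∈ freeHam.domain :=
  LinearPMap.mem_domain_of_mem_graph (mem_graph_freeHam g z)

theorem freeHam_withSpin (g : 𝓢(Space3, ℂ)) (z : Spinor ℂ) :
    freeHam ⟨withSpin (g.toLp 2 volume) z, withSpin_mem_domain g z⟩ =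
      withSpin ((schwartzHam g).toLp 2 volume) z := by
  obtain ⟨y, hy, hy'⟩ := (LinearPMap.mem_graph_iff freeHam).1 (mem_graph_freeHam g z)
  refine Eq.trans ?_ hy'
  congr 1
  exact Subtype.ext hy.symm

end TensorAlgebra

/-! ### Spin expectations and the singlet -/

section Spin

variable {K : Type*} [NormedAddCommGroup K] [InnerProductSpace ℂ K]

theorem spinorMap_apply (M : Matrix (Fin 2) (Fin 2) ℂ) (u : Spinor K) (s : Fin 2) :
    spinorMap M u s = ∑ t, M s t • u t := by
  simp [spinorMap]

theorem norm_spinorMap_pauli (a : Fin 3) (u : Spinor K) : ‖spinorMap (pauli a) u‖ = ‖u‖ := by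
  rw [PiLp.norm_eq_of_L2, PiLp.norm_eq_of_L2]
  congr 1
  simp only [Fin.sum_univ_two, spinorMap_apply]
  fin_cases a <;> simp [pauli, norm_smul, add_comm]

theorem coeFn_spinOp (a : Fin 3) (Φ : SpinL2 K) :
    ∀ᵐ x : Space3, spinOp a Φ x = spinorMap (pauli a) (Φ x) := by
  have h := ContinuousLinearMap.coeFn_compLpL (spinorMap (K := K) (pauli a)) Φ
  rw [spinOp]
  exact h

theorem norm_spinOp (a : Fin 3) (Φ : SpinL2 K) : ‖spinOp a Φ‖ = ‖Φ‖ := by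
  refine le_antisymm (Lp.norm_le_norm_of_ae_le ?_) (Lp.norm_le_norm_of_ae_le ?_) <;>
  · filter_upwards [coeFn_spinOp a Φ] with x hx
    rw [hx, norm_spinorMap_pauli]

theorem spinOp_tens_withSpin (a : Fin 3) (f : Lp ℂ 2 (volume : Measure Space3)) (z : Spinor ℂ)
    (q : K) :
    spinOp a (tens (withSpin f z) q) = tens (withSpin f (spinorMap (pauli a) z)) q := by
  refine Lp.ext ?_
  filter_upwards [coeFn_spinOp a (tens (withSpin f z) q), coeFn_tens_withSpin f z q,
    coeFn_tens_withSpin f (spinorMap (pauli a) z) q] with x h1 h2 h3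
  ext s
  rw [h1, h3, spinorMap_apply, spinorMap_apply]
  simp only [h2, smul_smul, Finset.mul_sum, Finset.sum_smul, smul_eq_mul]
  refine Finset.sum_congr rfl fun t _ => ?_
  congr 1
  ring

theorem inner_tens_withSpin (f f' : Lp ℂ 2 (volume : Measure Space3)) (z z' : Spinor ℂ)
    (q q' : K) :
    ⟪tens (withSpin f z) q, tens (withSpin f' z') q'⟫_ℂ = ⟪f, f'⟫_ℂ * ⟪z, z'⟫_ℂ * ⟪q, q'⟫_ℂ := by
  rw [inner_tens, inner_withSpin]

/-- The spin basis: `0` is up, `1` is down. -/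
def spinVec (s : Fin 2) : Spinor ℂ := if s = 0 then spinUp else spinDown

theorem spinVec_apply (s t : Fin 2) : spinVec s t = if s = t then 1 else 0 := by
  fin_cases s <;> fin_cases t <;> simp [spinVec, spinUp, spinDown]

theorem inner_spinVec (s t : Fin 2) : ⟪spinVec s, spinVec t⟫_ℂ = if s = t then 1 else 0 := by
  simp only [PiLp.inner_apply, spinVec_apply, Fin.sum_univ_two]
  fin_cases s <;> fin_cases t <;> simp

theorem norm_spinVec (s : Fin 2) : ‖spinVec s‖ = 1 := by
  rw [norm_eq_sqrt_re_inner (𝕜 := ℂ), inner_spinVec, if_pos rfl]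
  simp

/-- A maximally entangled state of spin singlet type has vanishing spin expectation. -/
theorem spinExpectation_singlet {n : ℕ} (f : Fin n → Lp ℂ 2 (volume : Measure Space3))
    (q : Fin n → Fin 2 → K) (hq : ∀ j s j' s', ⟪q j s, q j' s'⟫_ℂ =
      if j = j' ∧ s = s' then 1 else 0) (c : ℂ) :
    spinExpectation (c • ∑ j, (tens (withSpin (f j) spinDown) (q j 0) -
      tens (withSpin (f j) spinUp) (q j 1))) = 0 := by
  ext a
  -- The trace of a Pauli matrix. Orthonormality of the `q j s` removes the terms mixing the two
  -- spins, and the diagonal terms combine to this trace.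
  have hz : ⟪spinDown, spinorMap (pauli a) spinDown⟫_ℂ +
      ⟪spinUp, spinorMap (pauli a) spinUp⟫_ℂ = 0 := by
    simp only [PiLp.inner_apply, spinorMap_apply, Fin.sum_univ_two, spinUp, spinDown]
    fin_cases a <;> simp [pauli]
  have hq₁ : ∀ i j s, ⟪q i s, q j s⟫_ℂ = if i = j then 1 else 0 := fun i j s => by simp [hq]
  have hq₂ : ∀ i j, ⟪q i 0, q j 1⟫_ℂ = 0 := fun i j => by simp [hq]
  have hq₃ : ∀ i j, ⟪q i 1, q j 0⟫_ℂ = 0 := fun i j => by simp [hq]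
  have key : ∀ i j : Fin n, ⟪f j, f i⟫_ℂ * ⟪spinDown, spinorMap (pauli a) spinDown⟫_ℂ *
      (if j = i then 1 else 0) - -(⟪f j, f i⟫_ℂ * ⟪spinUp, spinorMap (pauli a) spinUp⟫_ℂ *
      (if j = i then 1 else 0)) = 0 := by
    intro i j
    rw [sub_neg_eq_add, ← add_mul, ← mul_add, hz, mul_zero, zero_mul]
  simp only [spinExpectation, map_smul, map_sum, map_sub, spinOp_tens_withSpin, inner_smul_left,
    inner_smul_right, sum_inner, inner_sum, inner_sub_left, inner_sub_right, inner_tens_withSpin,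
    hq₁, hq₂, hq₃, mul_zero, sub_zero, zero_sub, ← mul_sub, ← Finset.sum_sub_distrib, key,
    Finset.sum_const_zero]
  rfl

/-- Each component is a bounded quadratic form, so it changes by at most (‖Φ‖ + ‖Φ'‖)‖Φ - Φ'‖; the
factor 3 is a crude bound for √3. -/
theorem norm_spinExpectation_le_of_eq_zero {Φ Φ' : SpinL2 K} (h : spinExpectation Φ' = 0) :
    ‖spinExpectation Φ‖ ≤ 3 * ((‖Φ‖ + ‖Φ'‖) * ‖Φ - Φ'‖) := by
  have h1 : ∀ a, ‖spinExpectation Φ a‖ ≤ (‖Φ‖ + ‖Φ'‖) * ‖Φ - Φ'‖ := by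
    intro a
    have h2 : ⟪Φ', spinOp a Φ'⟫_ℂ = 0 := congrArg (fun v : EuclideanSpace ℂ (Fin 3) => v a) h
    have h3 : spinExpectation Φ a =
        ⟪Φ - Φ', spinOp a Φ⟫_ℂ + ⟪Φ', spinOp a (Φ - Φ')⟫_ℂ := by
      rw [map_sub, inner_sub_left, inner_sub_right, h2]
      simp [spinExpectation]
    rw [h3]
    refine (norm_add_le _ _).trans ?_
    have h4 := norm_inner_le_norm (𝕜 := ℂ) (Φ - Φ') (spinOp a Φ)
    have h5 := norm_inner_le_norm (𝕜 := ℂ) Φ' (spinOp a (Φ - Φ'))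
    rw [norm_spinOp] at h4 h5
    linarith
  set B := (‖Φ‖ + ‖Φ'‖) * ‖Φ - Φ'‖ with hB
  have hB0 : 0 ≤ B := by positivity
  rw [EuclideanSpace.norm_eq, Real.sqrt_le_left (by positivity), Fin.sum_univ_three]
  nlinarith [h1 0, h1 1, h1 2, norm_nonneg (spinExpectation Φ 0), norm_nonneg (spinExpectation Φ 1),
    norm_nonneg (spinExpectation Φ 2), pow_le_pow_left₀ (norm_nonneg _) (h1 0) 2,
    pow_le_pow_left₀ (norm_nonneg _) (h1 1) 2, pow_le_pow_left₀ (norm_nonneg _) (h1 2) 2]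

end Spin

/-! ### Unitary groups and their generators -/

section TimeEvolution

variable {E : Type*} [NormedAddCommGroup E] [InnerProductSpace ℂ E] {A : E →ₗ.[ℂ] E}
  {U : ℝ → E →L[ℂ] E}

theorem IsTimeEvolution.apply_add (h : IsTimeEvolution A U) (s t : ℝ) (ψ : E) :
    U (s + t) ψ = U s (U t ψ) := by
  rw [h.add]
  rfl

theorem IsTimeEvolution.apply_zero (h : IsTimeEvolution A U) (ψ : E) : U 0 ψ = ψ := by
  rw [h.zero]
  rfl

theorem IsTimeEvolution.inner_map (h : IsTimeEvolution A U) (t : ℝ) (φ ψ : E) :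
    ⟪U t φ, U t ψ⟫_ℂ = ⟪φ, ψ⟫_ℂ :=
  LinearIsometry.inner_map_map ⟨(U t : E →ₗ[ℂ] E), h.norm_map t⟩ φ ψ

theorem IsTimeEvolution.mem_graph (h : IsTimeEvolution A U) {ψ ξ : E} (hψ : (ψ, ξ) ∈ A.graph)
    (t : ℝ) : (U t ψ, U t ξ) ∈ A.graph := by
  rw [h.generator] at hψ ⊢
  have h1 := ((U t).restrictScalars ℝ).hasFDerivAt.comp_hasDerivAt (0 : ℝ) hψ
  convert! h1 using 1
  · ext s
    simp only [Function.comp_apply, ContinuousLinearMap.coe_restrictScalars']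
    rw [← h.apply_add, ← h.apply_add, add_comm]
  · simp

theorem IsTimeEvolution.hasDerivAt (h : IsTimeEvolution A U) {ψ ξ : E} (hψ : (ψ, ξ) ∈ A.graph)
    (t : ℝ) : HasDerivAt (fun s => U s ψ) (-Complex.I • U t ξ) t := by
  have h1 := (h.generator _ _).1 (h.mem_graph hψ t)
  have h2 : HasDerivAt (fun s : ℝ => s - t) 1 t := (hasDerivAt_id t).sub_const t
  have h3 := HasDerivAt.scomp_of_eq t h1 h2 (sub_self t).symm
  rw [one_smul] at h3
  convert! h3 using 1
  ext s
  simp only [Function.comp_apply]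
  rw [← h.apply_add, sub_add_cancel]

/-- A product rule for a group that is only strongly differentiable: the value y s must lie in the
domain of the generator, while y' need not. -/
theorem IsTimeEvolution.hasDerivAt_neg_apply (h : IsTimeEvolution A U) {y : ℝ → E} {y' ξ : E}
    {s : ℝ} (hy : HasDerivAt y y' s) (hξ : (y s, ξ) ∈ A.graph) :
    HasDerivAt (fun r => U (-r) (y r)) (U (-s) (Complex.I • ξ + y')) s := by
  have h1 : HasDerivAt (fun r : ℝ => U (-r) (y s)) (Complex.I • ξ) 0 := by
    have h2 := (h.generator _ _).1 hξ
    have h3 := HasDerivAt.scomp_of_eq (0 : ℝ) h2 (hasDerivAt_neg (0 : ℝ)) neg_zero.symm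
    convert! h3 using 1
    simp
  rw [hasDerivAt_iff_isLittleO_nhds_zero] at hy h1 ⊢
  -- Three errors: the one of y, moved by an isometry; the one of the group at the fixed vector y s;
  -- and r times a difference that vanishes in the limit by strong continuity.
  have e : ∀ r : ℝ, U (-(s + r)) (y (s + r)) - U (-s) (y s) - r • U (-s) (Complex.I • ξ + y') =
      U (-(s + r)) (y (s + r) - y s - r • y') + (U (-s) (U (-(0 + r)) (y s) - U (-0) (y s) -
        r • (Complex.I • ξ)) + r • (U (-(s + r)) y' - U (-s) y')) := by
    intro r
    have e1 : -(s + r) = -s + -(0 + r) := by ring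
    have e2 : ∀ (t : ℝ) (ψ : E), U t (r • ψ) = r • U t ψ := fun t ψ =>
      ((U t).restrictScalars ℝ).map_smul r ψ
    simp only [map_sub, map_add, e2, smul_add, smul_sub]
    rw [e1, h.apply_add, h.apply_add, h.apply_add, neg_zero, h.apply_zero]
    abel
  simp only [e]
  refine Asymptotics.IsLittleO.add ?_ (Asymptotics.IsLittleO.add ?_ ?_)
  · refine (Asymptotics.IsBigO.of_bound 1 (Eventually.of_forall fun r => ?_)).trans_isLittleO hy
    rw [one_mul, h.norm_map]
  · refine (Asymptotics.IsBigO.of_bound 1 (Eventually.of_forall fun r => ?_)).trans_isLittleO h1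
    rw [one_mul, h.norm_map]
  · have h4 : Tendsto (fun r : ℝ => U (-(s + r)) y' - U (-s) y') (𝓝 0) (𝓝 0) := by
      have hc : Continuous fun r : ℝ => U (-(s + r)) y' - U (-s) y' :=
        ((h.continuous y').comp (by fun_prop : Continuous fun r : ℝ => -(s + r))).sub
          continuous_const
      have := hc.tendsto 0
      simpa using this
    have h5 := (Asymptotics.isBigO_refl (fun r : ℝ => r) (𝓝 0)).smul_isLittleO
      ((Asymptotics.isLittleO_one_iff ℝ).2 h4)
    simpa using h5

end TimeEvolution

/-! ### Operators commuting with position do not enlarge supports -/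

section Locality

/-- An `L²` function which vanishes to second order (in the `L²` sense) at all points of an open
set vanishes a.e. there, by Lebesgue's density theorem. -/
theorem ae_eq_zero_of_forall_eq_norm_sq_smul {V : Type*} [NormedAddCommGroup V] [NormedSpace ℂ V]
    (g : Lp V 2 (volume : Measure Space3)) (O : Set Space3)
    (h : ∀ x₀ ∈ O, ∃ G : Lp V 2 (volume : Measure Space3),
      ∀ᵐ x, g x = ((‖x - x₀‖ ^ 2 : ℝ) : ℂ) • G x) :
    ∀ᵐ x : Space3, x ∈ O → g x = 0 := by
  have hint : ∀ G : Lp V 2 (volume : Measure Space3), Integrable (fun x => ‖G x‖ ^ 2) :=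
    fun G => (Lp.memLp G).integrable_norm_pow two_ne_zero
  filter_upwards [IsUnifLocDoublingMeasure.ae_tendsto_average (volume : Measure Space3)
    (hint g).locallyIntegrable 1] with x₀ hx₀ hO
  have h1 : Tendsto (fun r : ℝ => ⨍ y in Metric.closedBall x₀ r, ‖g y‖ ^ 2) (𝓝[>] 0)
      (𝓝 (‖g x₀‖ ^ 2)) := by
    refine hx₀ (fun _ => x₀) (fun r => r) tendsto_id ?_
    filter_upwards [self_mem_nhdsWithin] with r hr
    rw [one_mul]
    exact Metric.mem_closedBall_self (le_of_lt hr)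
  obtain ⟨G, hG⟩ := h x₀ hO
  set m : ℝ := (volume : Measure Space3).real (Metric.ball 0 1) with hm
  have hm0 : 0 < m := ENNReal.toReal_pos (Metric.measure_ball_pos _ _ one_pos).ne'
    measure_ball_lt_top.ne
  have h2 : Tendsto (fun r : ℝ => r * (m⁻¹ * ∫ y, ‖G y‖ ^ 2)) (𝓝[>] 0) (𝓝 0) := by
    have hc : Continuous fun r : ℝ => r * (m⁻¹ * ∫ y, ‖G y‖ ^ 2) := by fun_prop
    have := (hc.tendsto 0).mono_left (nhdsWithin_le_nhds (s := Set.Ioi 0))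
    simpa using this
  have h3 : ‖g x₀‖ ^ 2 ≤ 0 := by
    refine le_of_tendsto_of_tendsto h1 h2 ?_
    filter_upwards [self_mem_nhdsWithin] with r hr
    have hr0 : 0 < r := hr
    rw [setAverage_eq, smul_eq_mul, Measure.addHaar_real_closedBall _ _ hr0.le]
    simp only [finrank_euclideanSpace, Fintype.card_fin]
    -- Second-order vanishing gives r⁴ in the integral of the square, which beats the volume r³ of
    -- the ball; first order would give only r².
    have h4 : ∫ y in Metric.closedBall x₀ r, ‖g y‖ ^ 2 ≤ r ^ 4 * ∫ y, ‖G y‖ ^ 2 := by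
      calc ∫ y in Metric.closedBall x₀ r, ‖g y‖ ^ 2
          ≤ ∫ y in Metric.closedBall x₀ r, r ^ 4 * ‖G y‖ ^ 2 := by
            refine setIntegral_mono_on_ae (hint g).integrableOn
              ((hint G).const_mul _).integrableOn measurableSet_closedBall ?_
            filter_upwards [hG] with y hy hyr
            rw [hy, norm_smul, Complex.norm_real, Real.norm_of_nonneg (by positivity), mul_pow,
              ← pow_mul]
            rw [mem_closedBall_iff_norm] at hyr
            gcongr
        _ ≤ ∫ y, r ^ 4 * ‖G y‖ ^ 2 :=
            setIntegral_le_integral ((hint G).const_mul _)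
              (Eventually.of_forall fun y => by positivity)
        _ = r ^ 4 * ∫ y, ‖G y‖ ^ 2 := integral_const_mul _ _
    calc (r ^ 3 * m)⁻¹ * ∫ y in Metric.closedBall x₀ r, ‖g y‖ ^ 2
        ≤ (r ^ 3 * m)⁻¹ * (r ^ 4 * ∫ y, ‖G y‖ ^ 2) := by gcongr
      _ = r * (m⁻¹ * ∫ y, ‖G y‖ ^ 2) := by field_simp
  have h5 : ‖g x₀‖ ^ 2 = 0 := le_antisymm h3 (by positivity)
  exact norm_eq_zero.1 (pow_eq_zero_iff two_ne_zero |>.1 h5)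

/-- The denominator is |x - x₀|² plus a bump that is 0 outside the ball of radius ρ and 1 near x₀.
It is bounded away from zero, so its inverse is smooth of temperate growth. -/
theorem exists_hasTemperateGrowth_inv_norm_sq (x₀ : Space3) {ρ : ℝ} (hρ : 0 < ρ) :
    ∃ w : Space3 → ℝ, w.HasTemperateGrowth ∧ ∀ x, ρ ≤ ‖x - x₀‖ → ‖x - x₀‖ ^ 2 * w x = 1 := by
  have hn : (fun x : Space3 => ‖x - x₀‖ ^ 2).HasTemperateGrowth :=
    (Function.hasTemperateGrowth_norm_sq Space3).comp (f := fun x => x - x₀) (by fun_prop)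
  set S := Real.smoothTransition with hS
  have hq : (fun x : Space3 => S (2 / ρ ^ 2 * ‖x - x₀‖ ^ 2 - 1)).HasTemperateGrowth :=
    Real.smoothTransition.hasTemperateGrowth.comp
      (f := fun x : Space3 => 2 / ρ ^ 2 * ‖x - x₀‖ ^ 2 - 1) (by fun_prop)
  set D : Space3 → ℝ := fun x => ‖x - x₀‖ ^ 2 + (1 - S (2 / ρ ^ 2 * ‖x - x₀‖ ^ 2 - 1)) with hD
  have hDg : D.HasTemperateGrowth := by fun_prop
  have hc : 0 < min 1 (ρ ^ 2 / 2) / 2 := by positivity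
  have hlow : ∀ x, min 1 (ρ ^ 2 / 2) / 2 < D x := by
    intro x
    refine (half_lt_self (by positivity)).trans_le ?_
    rcases le_total (ρ ^ 2 / 2) (‖x - x₀‖ ^ 2) with hx | hx
    · refine (min_le_right _ _).trans (hx.trans ?_)
      have := Real.smoothTransition.le_one (2 / ρ ^ 2 * ‖x - x₀‖ ^ 2 - 1)
      simp only [hD]
      linarith
    · refine (min_le_left _ _).trans ?_
      have h1 : 2 / ρ ^ 2 * ‖x - x₀‖ ^ 2 - 1 ≤ 0 := by
        rw [sub_nonpos]
        calc 2 / ρ ^ 2 * ‖x - x₀‖ ^ 2 ≤ 2 / ρ ^ 2 * (ρ ^ 2 / 2) := by gcongr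
          _ = 1 := by field_simp
      simp only [hD, hS, Real.smoothTransition.zero_of_nonpos h1]
      nlinarith [sq_nonneg ‖x - x₀‖]
  refine ⟨fun x => (D x)⁻¹, hDg.inv_of_le hc hlow, fun x hx => ?_⟩
  have h1 : 1 ≤ 2 / ρ ^ 2 * ‖x - x₀‖ ^ 2 - 1 := by
    have h2 : 2 / ρ ^ 2 * ρ ^ 2 ≤ 2 / ρ ^ 2 * ‖x - x₀‖ ^ 2 := by gcongr
    have h3 : 2 / ρ ^ 2 * ρ ^ 2 = 2 := by field_simp
    linarith
  have h4 : D x = ‖x - x₀‖ ^ 2 := by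
    simp only [hD, hS, Real.smoothTransition.one_of_one_le h1]
    ring
  have h5 : 0 < ‖x - x₀‖ := hρ.trans_le hx
  simp only [h4]
  exact mul_inv_cancel₀ (by positivity)

/-- A linear map into `L²` which commutes with the coordinate functions does not increase
supports. -/
theorem ae_eq_zero_of_commute {ι V : Type*} [NormedAddCommGroup V] [NormedSpace ℂ V]
    (D : (ι → 𝓢(Space3, ℂ)) →ₗ[ℂ] Lp V 2 (volume : Measure Space3))
    (hD : ∀ (j : Fin 3) (f : ι → 𝓢(Space3, ℂ)),
      ∀ᵐ x : Space3, D (fun i => cutMul (fun x => x j) (f i)) x = (x j : ℂ) • D f x)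
    {O : Set Space3} (hO : IsOpen O) (f : ι → 𝓢(Space3, ℂ)) (hf : ∀ i, ∀ x ∈ O, f i x = 0) :
    ∀ᵐ x : Space3, x ∈ O → D f x = 0 := by
  refine ae_eq_zero_of_forall_eq_norm_sq_smul _ O fun x₀ hx₀ => ?_
  obtain ⟨ρ, hρ, hball⟩ := Metric.isOpen_iff.1 hO x₀ hx₀
  obtain ⟨w, hw, hw'⟩ := exists_hasTemperateGrowth_inv_norm_sq x₀ hρ
  have hcoord : ∀ j : Fin 3, (fun x : Space3 => x j).HasTemperateGrowth := fun j =>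
    (EuclideanSpace.proj j : Space3 →L[ℝ] ℝ).hasTemperateGrowth
  have hsub : ∀ j : Fin 3, (fun x : Space3 => x j - x₀ j).HasTemperateGrowth := fun j => by
    have := hcoord j
    fun_prop
  have hD' : ∀ (j : Fin 3) (f : ι → 𝓢(Space3, ℂ)),
      ∀ᵐ x : Space3, D (fun i => cutMul (fun x => x j - x₀ j) (f i)) x =
        ((x j - x₀ j : ℝ) : ℂ) • D f x := by
    intro j f
    have e1 : (fun i => cutMul (fun x => x j - x₀ j) (f i)) =
        (fun i => cutMul (fun x => x j) (f i)) - ((x₀ j : ℝ) : ℂ) • f := by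
      ext i x
      rw [cutMul_apply (hsub j), Pi.sub_apply, sub_apply, cutMul_apply (hcoord j), Pi.smul_apply,
        smul_apply, smul_eq_mul]
      push_cast
      ring
    rw [e1, map_sub, map_smul]
    filter_upwards [hD j f, Lp.coeFn_sub (D fun i => cutMul (fun x => x j) (f i))
      (((x₀ j : ℝ) : ℂ) • D f), Lp.coeFn_smul ((x₀ j : ℝ) : ℂ) (D f)] with x h1 h2 h3
    rw [h2, Pi.sub_apply, h3, h1, Pi.smul_apply, Complex.ofReal_sub, sub_smul]
  -- As f vanishes near x₀, f = |x - x₀|² h with h Schwartz. Expanding the square in coordinates and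
  -- commuting them through D gives D f = |x - x₀|² D h, with no continuity of D.
  set h : ι → 𝓢(Space3, ℂ) := fun i => cutMul w (f i) with hh
  refine ⟨D h, ?_⟩
  have e2 : f = ∑ j : Fin 3, fun i => cutMul (fun x => x j - x₀ j)
      (cutMul (fun x => x j - x₀ j) (h i)) := by
    ext i x
    rw [Finset.sum_apply, sum_apply]
    simp only [cutMul_apply (hsub _), hh, cutMul_apply hw]
    have e3 : ∑ j : Fin 3, ((x j - x₀ j : ℝ) : ℂ) * (((x j - x₀ j : ℝ) : ℂ) *
        ((w x : ℂ) * f i x)) = ((‖x - x₀‖ ^ 2 * w x : ℝ) : ℂ) * f i x := by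
      rw [EuclideanSpace.norm_sq_eq, Finset.sum_mul]
      push_cast
      rw [Finset.sum_mul]
      refine Finset.sum_congr rfl fun j _ => ?_
      have : ((‖(x - x₀) j‖ : ℝ) : ℂ) ^ 2 = ((x j : ℂ) - (x₀ j : ℂ)) ^ 2 := by
        rw [← Complex.ofReal_pow, Real.norm_eq_abs, sq_abs, PiLp.sub_apply]
        push_cast
        rfl
      rw [this]
      ring
    rw [e3]
    by_cases hx : ρ ≤ ‖x - x₀‖
    · rw [hw' x hx, Complex.ofReal_one, one_mul]
    · rw [hf i x (hball (mem_ball_iff_norm.2 (not_le.1 hx))), mul_zero]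
  have e4 : D f = ∑ j : Fin 3, D (fun i => cutMul (fun x => x j - x₀ j)
      (cutMul (fun x => x j - x₀ j) (h i))) := by
    conv_lhs => rw [e2]
    exact map_sum D _ _
  rw [e4]
  have h1 : ∀ᵐ x : Space3, ∀ j : Fin 3, D (fun i => cutMul (fun x => x j - x₀ j)
      (cutMul (fun x => x j - x₀ j) (h i))) x =
      ((x j - x₀ j : ℝ) : ℂ) • ((x j - x₀ j : ℝ) : ℂ) • D h x := by
    rw [ae_all_iff]
    intro j
    filter_upwards [hD' j h, hD' j (fun i => cutMul (fun x => x j - x₀ j) (h i))] with x a b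
    rw [b, a]
  filter_upwards [h1, Lp.coeFn_finsetSum Finset.univ (fun j => D (fun i =>
    cutMul (fun x => x j - x₀ j) (cutMul (fun x => x j - x₀ j) (h i))))] with x a b
  rw [b, Finset.sum_apply]
  simp only [a, smul_smul]
  rw [← Finset.sum_smul]
  congr 1
  rw [EuclideanSpace.norm_sq_eq]
  push_cast
  refine Finset.sum_congr rfl fun j _ => ?_
  rw [← Complex.ofReal_pow, Real.norm_eq_abs, sq_abs, PiLp.sub_apply]
  push_cast
  ring

end Locality

/-! ### Finite sums of product vectors -/

section ProductSums

variable {ι : Type*} [Fintype ι] {K : Type*} [NormedAddCommGroup K] [InnerProductSpace ℂ K]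

/-- The finite sum of product vectors `∑ i, f i ⊗ z i ⊗ p i`. -/
def tensSum (z : ι → Spinor ℂ) (p : ι → K) (f : ι → 𝓢(Space3, ℂ)) : SpinL2 K :=
  ∑ i, tens (withSpin ((f i).toLp 2 volume) (z i)) (p i)

/-- `tensSum` as a linear map in the wave functions. -/
def tensSumₗ (z : ι → Spinor ℂ) (p : ι → K) : (ι → 𝓢(Space3, ℂ)) →ₗ[ℂ] SpinL2 K where
  toFun := tensSum z p
  map_add' f g := by
    simp only [tensSum, ← tensCLM_apply, ← withSpinCLM_apply,
      ← SchwartzMap.toLpCLM_apply (𝕜 := ℂ), Pi.add_apply, map_add, add_apply,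
      Finset.sum_add_distrib]
  map_smul' c f := by
    simp only [tensSum, ← tensCLM_apply, ← withSpinCLM_apply,
      ← SchwartzMap.toLpCLM_apply (𝕜 := ℂ), Pi.smul_apply, map_smul,
      smul_apply, Finset.smul_sum, RingHom.id_apply]

theorem coeFn_tensSum (z : ι → Spinor ℂ) (p : ι → K) (f : ι → 𝓢(Space3, ℂ)) :
    ∀ᵐ x : Space3, ∀ s, tensSum z p f x s = ∑ i, (f i x * z i s) • p i := by
  have h1 : ∀ᵐ x : Space3, ∀ i s, tens (withSpin ((f i).toLp 2 volume) (z i)) (p i) x s =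
      (f i x * z i s) • p i := by
    rw [ae_all_iff]
    intro i
    filter_upwards [coeFn_tens_withSpin ((f i).toLp 2 volume) (z i) (p i),
      (f i).coeFn_toLp 2 volume] with x h1 h2 s
    rw [h1, h2]
  filter_upwards [h1, Lp.coeFn_finsetSum Finset.univ
    (fun i => tens (withSpin ((f i).toLp 2 volume) (z i)) (p i))] with x h2 h3 s
  rw [tensSum, h3, Finset.sum_apply, WithLp.ofLp_sum, Finset.sum_apply]
  exact Finset.sum_congr rfl fun i _ => h2 i s

theorem tensSum_mem_productDomain {HQ : K →ₗ.[ℂ] K} {p : ι → K} (hp : ∀ i, p i ∈ HQ.domain)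
    (z : ι → Spinor ℂ) (f : ι → 𝓢(Space3, ℂ)) : tensSum z p f ∈ productDomain HQ :=
  Submodule.sum_mem _ fun i _ =>
    tens_mem_productDomain HQ ⟨_, withSpin_mem_domain (f i) (z i)⟩ ⟨p i, hp i⟩

/-- An operator which commutes with the coordinates does not increase the support of a sum of
product vectors. -/
theorem ae_eq_zero_of_mem_graph (T : SpinL2 K →ₗ.[ℂ] SpinL2 K)
    (hT : ∀ (j : Fin 3) (Ψ Ψ' : T.domain),
      (∀ᵐ x : Space3, (Ψ' : SpinL2 K) x = (x j : ℂ) • (Ψ : SpinL2 K) x) →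
      ∀ᵐ x : Space3, T Ψ' x = (x j : ℂ) • T Ψ x)
    {z : ι → Spinor ℂ} {p : ι → K} (hdom : ∀ f, tensSum z p f ∈ T.domain)
    {O : Set Space3} (hO : IsOpen O) {f : ι → 𝓢(Space3, ℂ)} (hf : ∀ i, ∀ x ∈ O, f i x = 0) :
    ∀ᵐ x : Space3, x ∈ O → T ⟨tensSum z p f, hdom f⟩ x = 0 := by
  refine ae_eq_zero_of_commute (T.toFun ∘ₗ (tensSumₗ z p).codRestrict T.domain hdom)
    (fun j f => ?_) hO f hf
  refine hT j ⟨tensSum z p f, hdom f⟩ ⟨tensSum z p fun i => cutMul (fun x => x j) (f i), hdom _⟩ ?_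
  have hc : (fun x : Space3 => x j).HasTemperateGrowth :=
    (EuclideanSpace.proj j : Space3 →L[ℝ] ℝ).hasTemperateGrowth
  filter_upwards [coeFn_tensSum z p f, coeFn_tensSum z p fun i => cutMul (fun x => x j) (f i)]
    with x h1 h2
  ext s
  rw [h2, PiLp.smul_apply, h1, Finset.smul_sum]
  refine Finset.sum_congr rfl fun i _ => ?_
  rw [cutMul_apply hc, smul_smul, mul_assoc]

theorem norm_tensSum_le (z : ι → Spinor ℂ) (p : ι → K) (f : ι → 𝓢(Space3, ℂ)) :
    ‖tensSum z p f‖ ≤ ∑ i, ‖(f i).toLp 2 (volume : Measure Space3)‖ * ‖z i‖ * ‖p i‖ :=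
  (norm_sum_le _ _).trans (Finset.sum_le_sum fun _ _ => (norm_tens_withSpin _ _ _).le)

section Complete

variable [CompleteSpace K]

theorem slice_sum_tens {f : ι → SpinL2 ℂ} (hf : Orthonormal ℂ f) (p : ι → K) (i : ι) :
    slice (f i) (∑ j, tens (f j) (p j)) = p i := by
  classical
  rw [map_sum, Finset.sum_eq_single i]
  · rw [slice_tens, orthonormal_iff_ite.1 hf, if_pos rfl, one_smul]
  · intro j _ hj
    rw [slice_tens, orthonormal_iff_ite.1 hf, if_neg (Ne.symm hj), zero_smul]
  · simp

theorem slice_mem_domain {HQ : K →ₗ.[ℂ] K} (f : SpinL2 ℂ) {Ψ : SpinL2 K}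
    (hΨ : Ψ ∈ productDomain HQ) : slice f Ψ ∈ HQ.domain := by
  have h : productDomain HQ ≤ HQ.domain.comap (slice (K := K) f).toLinearMap := by
    refine Submodule.span_le.2 ?_
    rintro _ ⟨f', _, q, hq, rfl⟩
    change slice f (tens f' q) ∈ HQ.domain
    rw [slice_tens]
    exact HQ.domain.smul_mem _ hq
  exact h hΨ

/-- If `1 ⊗ A` can be applied to `∑ i, f i ⊗ p i` almost everywhere, with the `f i` orthonormal and
a square integrable result `Φ`, then `A` can be applied to the `p i`. -/
theorem exists_mem_graph_of_fiberApply (A : K →ₗ.[ℂ] K) {f : ι → SpinL2 ℂ} (hf : Orthonormal ℂ f)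
    (p : ι → K) (Φ : SpinL2 K)
    (h : ∀ᵐ x : Space3, FiberApply A (WithLp.toLp 2 fun s => ∑ i, f i x s • p i) (Φ x)) (i : ι) :
    ∃ m, (p i, m) ∈ A.graph ∧ ‖m‖ ≤ ‖Φ‖ := by
  have hdom : ∀ i, p i ∈ A.domain := by
    intro i
    by_contra hi
    -- A purely algebraic functional that kills the domain of A but not p i. Applied in almost every
    -- fibre it gives a linear relation among the orthonormal f i, so A need not be closed or
    -- densely defined.
    obtain ⟨ℓ, hℓ, hℓ'⟩ := Submodule.exists_le_ker_of_notMem hi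
    refine hℓ ?_
    have h0 : ∑ i, ℓ (p i) • f i = 0 := by
      refine Lp.ext ?_
      have h1 : ∀ᵐ x : Space3, ∀ i, (ℓ (p i) • f i : SpinL2 ℂ) x = ℓ (p i) • f i x := by
        rw [ae_all_iff]
        exact fun i => Lp.coeFn_smul _ _
      filter_upwards [h, h1, Lp.coeFn_finsetSum Finset.univ (fun i => ℓ (p i) • f i),
        Lp.coeFn_zero (Spinor ℂ) 2 (volume : Measure Space3)] with x a b c d
      rw [c, d, Finset.sum_apply]
      ext s
      have h2 := hℓ' (LinearPMap.mem_domain_of_mem_graph (a s))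
      rw [LinearMap.mem_ker, map_sum] at h2
      simp only [b, Pi.zero_apply, WithLp.ofLp_sum, Finset.sum_apply, PiLp.smul_apply,
        PiLp.zero_apply]
      rw [← h2]
      refine Finset.sum_congr rfl fun i _ => ?_
      rw [map_smul, smul_eq_mul, smul_eq_mul, mul_comm]
    have h1 := Fintype.linearIndependent_iff.1 hf.linearIndependent _ h0 i
    exact h1
  have hΦ : Φ = ∑ i, tens (f i) (A ⟨p i, hdom i⟩) := by
    refine Lp.ext ?_
    have h1 : ∀ᵐ x : Space3, ∀ i s, tens (f i) (A ⟨p i, hdom i⟩) x s =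
        f i x s • A ⟨p i, hdom i⟩ := by
      rw [ae_all_iff]
      exact fun i => coeFn_tens _ _
    filter_upwards [h, h1, Lp.coeFn_finsetSum Finset.univ (fun i => tens (f i) (A ⟨p i, hdom i⟩))]
      with x a b c
    rw [c, Finset.sum_apply]
    ext s
    rw [WithLp.ofLp_sum, Finset.sum_apply]
    simp only [b]
    have h2 : (∑ i, f i x s • p i, ∑ i, f i x s • A ⟨p i, hdom i⟩) ∈ A.graph := by
      have h3 : ∑ i, f i x s • (p i, A ⟨p i, hdom i⟩) ∈ A.graph :=
        Submodule.sum_mem _ fun i _ => A.graph.smul_mem _ (A.mem_graph ⟨p i, hdom i⟩)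
      convert h3 using 1
      simp [Prod.ext_iff, Prod.fst_sum, Prod.snd_sum]
    exact A.mem_graph_snd_inj (a s) h2 rfl
  refine ⟨A ⟨p i, hdom i⟩, A.mem_graph ⟨p i, hdom i⟩, ?_⟩
  have h1 := norm_slice_le (f i) Φ
  rw [hf.1 i, one_mul] at h1
  conv_lhs at h1 => rw [hΦ, slice_sum_tens hf]
  exact h1

end Complete

end ProductSums

/-! ### Distances between cones, cubes and their neighbourhoods -/

section Geometry

theorem setDist_le_dist {S T : Set Space3} {x y : Space3} (hx : x ∈ S) (hy : y ∈ T) :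
    setDist S T ≤ dist x y :=
  csInf_le ⟨0, by rintro _ ⟨x, _, y, _, rfl⟩; exact dist_nonneg⟩ ⟨x, hx, y, hy, rfl⟩

theorem setDist_anti {S S' T : Set Space3} (h : S ⊆ S') (hS : S.Nonempty) (hT : T.Nonempty) :
    setDist S' T ≤ setDist S T := by
  obtain ⟨x, hx⟩ := hS
  obtain ⟨y, hy⟩ := hT
  refine le_csInf ⟨_, x, hx, y, hy, rfl⟩ ?_
  rintro _ ⟨x, hx, y, hy, rfl⟩
  exact setDist_le_dist (h hx) hy

theorem zero_mem_cone (e : Space3) (θ : ℝ) : (0 : Space3) ∈ cone e θ := by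
  simp [cone]

theorem cone_nonempty (e : Space3) (θ : ℝ) : (cone e θ).Nonempty := ⟨0, zero_mem_cone e θ⟩

theorem setDist_le_infDist {S : Set Space3} {x : Space3} (hx : x ∈ S) (e : Space3) (θ : ℝ) :
    setDist S (cone e θ) ≤ Metric.infDist x (cone e θ) :=
  (Metric.le_infDist (cone_nonempty e θ)).2 fun _ hy => setDist_le_dist hx hy

theorem IsOpenCube.nonempty {S : Set Space3} (h : IsOpenCube S) : S.Nonempty := by
  obtain ⟨b, c, l, hl, rfl⟩ := h
  refine ⟨c, fun i => ?_⟩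
  rw [sub_self, inner_zero_right, abs_zero]
  positivity

/-- A set at distance `δ` from a cone is at distance at least `δ / 2` from the points which are at
distance at most `δ / 2` from the cone. -/
theorem half_le_infDist {S : Set Space3} (hS : S.Nonempty) {e : Space3} {θ δ : ℝ}
    (hδ : δ ≤ setDist S (cone e θ)) {x : Space3} (hx : Metric.infDist x (cone e θ) ≤ δ / 2) :
    δ / 2 ≤ Metric.infDist x S := by
  refine (Metric.le_infDist hS).2 fun y hy => ?_
  have h1 := setDist_le_infDist hy e θ
  have h2 := Metric.infDist_le_infDist_add_dist (s := cone e θ) (x := y) (y := x)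
  rw [dist_comm y x] at h2
  linarith

/-- Points far out in a cone are far from a set outside of a larger cone. -/
theorem mul_le_infDist_of_mem_cone {S : Set Space3} (hS : S.Nonempty) {e : Space3} (he : ‖e‖ = 1)
    {θ θ' : ℝ} (hS' : ∀ y ∈ S, y ∉ cone e θ') {x : Space3} (hx : x ∈ cone e θ) :
    (Real.cos θ - Real.cos θ') / 2 * ‖x‖ ≤ Metric.infDist x S := by
  refine (Metric.le_infDist hS).2 fun y hy => ?_
  have h1 : ⟪y, e⟫_ℝ < ‖y‖ * Real.cos θ' := not_le.1 (hS' y hy)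
  have h2 : ‖x‖ * Real.cos θ ≤ ⟪x, e⟫_ℝ := hx
  have h3 : ⟪x, e⟫_ℝ - ⟪y, e⟫_ℝ ≤ dist x y := by
    rw [← inner_sub_left, dist_eq_norm]
    refine (real_inner_le_norm _ _).trans ?_
    rw [he, mul_one]
  -- Added to the projection estimate on e, this eliminates ‖y‖ and bounds 2 dist(x, y) from below,
  -- whence the factor 1/2.
  have h4 : (‖y‖ - ‖x‖) * Real.cos θ' ≤ dist x y := by
    refine (le_abs_self _).trans ?_
    rw [abs_mul, dist_comm, dist_eq_norm]
    exact (mul_le_mul (abs_norm_sub_norm_le _ _) (Real.abs_cos_le_one _) (abs_nonneg _)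
      (norm_nonneg _)).trans (mul_one _).le
  nlinarith

end Geometry

/-! ### Bounds on the interaction -/

section InteractionBound

/-- The decay in time of a potential `|x|^{-α}` seen by a wave packet moving away, in terms of the
distance `δ` at time zero. -/
theorem exists_rpow_bound {α c : ℝ} (hα : 1 < α) (hc : 0 < c) : ∃ A : ℝ, 0 ≤ A ∧
    ∀ δ t : ℝ, 1 ≤ δ → 0 ≤ t →
      (max (δ / 2) (c * t)) ^ (-α) ≤ A * δ ^ ((1 - α) / 2) * (1 + t) ^ (-min 2 ((1 + α) / 2)) ∧
      (δ / 2) ^ (-α) * (1 + t) ^ (-2 : ℝ) ≤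
        A * δ ^ ((1 - α) / 2) * (1 + t) ^ (-min 2 ((1 + α) / 2)) := by
  -- The maximum of δ/2 and ct is at least their mean, and δ ≥ 1, so it is at least 1/4 + ct/2 ≥
  -- b(1+t).
  set b := min (1 / 4) (c / 2) with hb
  have hb0 : 0 < b := by positivity
  have hb1 : b ≤ 1 / 4 := min_le_left _ _
  have hb2 : b ≤ c / 2 := min_le_right _ _
  refine ⟨(2⁻¹ : ℝ) ^ ((1 - α) / 2) * b ^ (-((1 + α) / 2)), by positivity,
    fun δ t hδ ht => ?_⟩
  -- One factor supplies the decay in δ that (A1) sums over the cubes; the other has exponent below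
  -- -1, since α > 1, and is integrable in time.
  have split : ∀ m : ℝ, 0 < m → m ^ (-α) = m ^ ((1 - α) / 2) * m ^ (-((1 + α) / 2)) := by
    intro m hm
    rw [← Real.rpow_add hm]
    congr 1
    ring
  have h1 : (δ / 2) ^ ((1 - α) / 2) = (2⁻¹ : ℝ) ^ ((1 - α) / 2) * δ ^ ((1 - α) / 2) := by
    rw [div_eq_inv_mul, Real.mul_rpow (by norm_num) (by linarith)]
  have ht1 : (1 : ℝ) ≤ 1 + t := by linarith
  have hδ2 : 0 < δ / 2 := by linarith
  constructor
  · set m := max (δ / 2) (c * t) with hm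
    have hm1 : δ / 2 ≤ m := le_max_left _ _
    have hm2 : c * t ≤ m := le_max_right _ _
    have hm0 : 0 < m := by linarith
    have h2 : m ^ ((1 - α) / 2) ≤ (δ / 2) ^ ((1 - α) / 2) :=
      Real.rpow_le_rpow_of_nonpos hδ2 hm1 (by linarith)
    have h3 : b * (1 + t) ≤ m := by nlinarith
    have h4 : m ^ (-((1 + α) / 2)) ≤ (b * (1 + t)) ^ (-((1 + α) / 2)) :=
      Real.rpow_le_rpow_of_nonpos (by positivity) h3 (by linarith)
    rw [Real.mul_rpow hb0.le (by linarith)] at h4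
    have h5 : (1 + t) ^ (-((1 + α) / 2)) ≤ (1 + t) ^ (-min 2 ((1 + α) / 2)) :=
      Real.rpow_le_rpow_of_exponent_le ht1 (neg_le_neg (min_le_right _ _))
    rw [split m hm0]
    calc m ^ ((1 - α) / 2) * m ^ (-((1 + α) / 2)) ≤ (δ / 2) ^ ((1 - α) / 2) *
          (b ^ (-((1 + α) / 2)) * (1 + t) ^ (-min 2 ((1 + α) / 2))) :=
        mul_le_mul h2 (h4.trans (mul_le_mul_of_nonneg_left h5 (by positivity))) (by positivity)
          (by positivity)
      _ = _ := by rw [h1]; ring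
  · have h5 : (1 + t) ^ (-2 : ℝ) ≤ (1 + t) ^ (-min 2 ((1 + α) / 2)) :=
      Real.rpow_le_rpow_of_exponent_le ht1 (neg_le_neg (min_le_left _ _))
    have h4 : (δ / 2) ^ (-((1 + α) / 2)) ≤ b ^ (-((1 + α) / 2)) :=
      Real.rpow_le_rpow_of_nonpos hb0 (by linarith) (by linarith)
    rw [split _ hδ2]
    calc (δ / 2) ^ ((1 - α) / 2) * (δ / 2) ^ (-((1 + α) / 2)) * (1 + t) ^ (-2 : ℝ) ≤
          (δ / 2) ^ ((1 - α) / 2) * b ^ (-((1 + α) / 2)) * (1 + t) ^ (-min 2 ((1 + α) / 2)) :=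
        mul_le_mul (mul_le_mul_of_nonneg_left h4 (by positivity)) h5 (by positivity) (by positivity)
      _ = _ := by rw [h1]; ring

/-- Where P holds the weight is at least δ' and the full packet E is kept; elsewhere the weight is
only at least δ, but E is dominated by the small r. In the application P is the outgoing region and
ρ the distance to a cube. -/
theorem norm_le_of_infDist_rpow_mul_le {V ι : Type*} [NormedAddCommGroup V] [Fintype ι]
    {Φ : Lp V 2 (volume : Measure Space3)} {E r : ι → 𝓢(Space3, ℂ)}
    {ρ : Space3 → ℝ} {α δ δ' C : ℝ} (hα : 0 ≤ α) (hδ : 0 < δ) (hδ' : 0 < δ') (hC : 0 ≤ C)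
    {P : Space3 → Prop}
    (h : ∀ᵐ x : Space3, Φ x ≠ 0 → δ ≤ ρ x ∧ (P x → δ' ≤ ρ x) ∧
      ρ x ^ α * ‖Φ x‖ ≤ C * ∑ i, ‖E i x‖)
    (hr : ∀ i x, ¬ P x → ‖E i x‖ ≤ ‖r i x‖) :
    ‖Φ‖ ≤ C * ∑ i, (δ' ^ (-α) * ‖(E i).toLp 2 (volume : Measure Space3)‖ +
      δ ^ (-α) * ‖(r i).toLp 2 (volume : Measure Space3)‖) := by
  have hnorm : ∀ g : 𝓢(Space3, ℂ), ∃ g' : Lp ℝ 2 (volume : Measure Space3),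
      (∀ᵐ x : Space3, g' x = ‖g x‖) ∧ ‖g'‖ = ‖g.toLp 2 (volume : Measure Space3)‖ := by
    intro g
    have hg := (g.memLp 2 (volume : Measure Space3)).norm
    refine ⟨hg.toLp _, hg.coeFn_toLp, ?_⟩
    refine le_antisymm (Lp.norm_le_norm_of_ae_le ?_) (Lp.norm_le_norm_of_ae_le ?_) <;>
    · filter_upwards [hg.coeFn_toLp, g.coeFn_toLp 2 volume] with x h1 h2
      rw [h1, h2, norm_norm]
  choose nE hE hE' using fun i => hnorm (E i)
  choose nr hnr hnr' using fun i => hnorm (r i)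
  have key : ‖Φ‖ ≤ ‖C • ∑ i, (δ' ^ (-α) • nE i + δ ^ (-α) • nr i)‖ := by
    refine Lp.norm_le_norm_of_ae_le ?_
    have h1 : ∀ᵐ x : Space3, ∀ i, (δ' ^ (-α) • nE i + δ ^ (-α) • nr i : Lp ℝ 2 volume) x =
        δ' ^ (-α) * ‖E i x‖ + δ ^ (-α) * ‖r i x‖ := by
      rw [ae_all_iff]
      intro i
      filter_upwards [Lp.coeFn_add (δ' ^ (-α) • nE i) (δ ^ (-α) • nr i),
        Lp.coeFn_smul (δ' ^ (-α)) (nE i), Lp.coeFn_smul (δ ^ (-α)) (nr i), hE i, hnr i]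
        with x a b c d e
      rw [a, Pi.add_apply, b, c, Pi.smul_apply, Pi.smul_apply, d, e, smul_eq_mul, smul_eq_mul]
    filter_upwards [h, h1, Lp.coeFn_smul C (∑ i, (δ' ^ (-α) • nE i + δ ^ (-α) • nr i)),
      Lp.coeFn_finsetSum Finset.univ (fun i => δ' ^ (-α) • nE i + δ ^ (-α) • nr i)]
      with x a b c d
    rw [c, Pi.smul_apply, d, Finset.sum_apply]
    simp only [b]
    refine le_trans ?_ (le_abs_self _)
    rw [smul_eq_mul]
    by_cases hx : Φ x = 0
    · rw [hx, norm_zero]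
      have := fun i => add_nonneg (mul_nonneg (Real.rpow_nonneg hδ'.le (-α)) (norm_nonneg (E i x)))
        (mul_nonneg (Real.rpow_nonneg hδ.le (-α)) (norm_nonneg (r i x)))
      exact mul_nonneg hC (Finset.sum_nonneg fun i _ => this i)
    obtain ⟨a1, a2, a3⟩ := a hx
    have hρ : 0 < ρ x := hδ.trans_le a1
    have h2 : ‖Φ x‖ ≤ C * ∑ i, ρ x ^ (-α) * ‖E i x‖ := by
      rw [← Finset.mul_sum, mul_left_comm, Real.rpow_neg hρ.le, ← div_eq_inv_mul,
        le_div_iff₀ (by positivity), mul_comm]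
      exact a3
    refine h2.trans (mul_le_mul_of_nonneg_left (Finset.sum_le_sum fun i _ => ?_) hC)
    have p1 : 0 ≤ δ' ^ (-α) * ‖E i x‖ := by positivity
    have p2 : 0 ≤ δ ^ (-α) * ‖r i x‖ := by positivity
    by_cases hP : P x
    · have := mul_le_mul_of_nonneg_right
        (Real.rpow_le_rpow_of_nonpos hδ' (a2 hP) (neg_nonpos.2 hα)) (norm_nonneg (E i x))
      linarith
    · have := mul_le_mul (Real.rpow_le_rpow_of_nonpos hδ a1 (neg_nonpos.2 hα)) (hr i x hP)
        (norm_nonneg _) (by positivity)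
      linarith
  refine key.trans ?_
  rw [norm_smul, Real.norm_of_nonneg hC]
  refine mul_le_mul_of_nonneg_left ((norm_sum_le _ _).trans (Finset.sum_le_sum fun i _ => ?_)) hC
  refine (norm_add_le _ _).trans (le_of_eq ?_)
  rw [norm_smul, norm_smul, hE', hnr', Real.norm_of_nonneg (by positivity),
    Real.norm_of_nonneg (by positivity)]

end InteractionBound

section InteractionBound

variable {ι : Type*} [Fintype ι] {K : Type*} [NormedAddCommGroup K] [InnerProductSpace ℂ K]
  [CompleteSpace K] {S : CoupledSystem K} {L : RegionData K} {e : Space3} {θ₀ d α β C₁ M : ℝ}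

theorem AssumptionA1.cube_subset (h : AssumptionA1 S L e θ₀ d α β C₁ M) {n : ℕ}
    (hn : n ∈ L.index) : L.cube n ⊆ L.region := by
  rw [h.region_eq]
  exact Set.subset_biUnion_of_mem hn

theorem AssumptionA1.le_setDist (h : AssumptionA1 S L e θ₀ d α β C₁ M) {n : ℕ}
    (hn : n ∈ L.index) : d ≤ setDist (L.cube n) (cone e (2 * θ₀)) := by
  rw [← h.dist_region]
  exact setDist_anti (h.cube_subset hn) (h.isOpenCube n hn).nonempty (cone_nonempty _ _)

/-- The interaction of an outgoing wave packet, cut off to a neighbourhood of the cone, with one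
of the cubes. -/
theorem AssumptionA1.norm_inter_le (h : AssumptionA1 S L e θ₀ d α β C₁ M) (he : ‖e‖ = 1)
    (hα : 1 < α) (hθ : Real.cos (2 * θ₀) < Real.cos θ₀) {v t : ℝ} {C : ℝ}
    (hC : 0 ≤ C) {n : ℕ} (hn : n ∈ L.index) {w : Space3 → ℝ} (hw : w.HasTemperateGrowth)
    (hw₁ : ∀ x, |w x| ≤ 1) (hw₀ : ∀ x, d / 2 < Metric.infDist x (cone e (2 * θ₀)) → w x = 0)
    {z : ι → Spinor ℂ} (hz : ∀ i, ‖z i‖ ≤ 1) {p m : ι → K} (hp : ∀ i, p i ∈ S.HQ.domain)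
    (hm : ∀ i, (p i, m i) ∈ (L.num n).graph) (hmC : ∀ i, ‖m i‖ ≤ C) {f r : ι → 𝓢(Space3, ℂ)}
    (hr : ∀ i x, ¬ (x ∈ cone e θ₀ ∧ v * t ≤ ‖x‖) → ‖f i x‖ ≤ ‖r i x‖) {Φ : SpinL2 K}
    (hΦ : (tensSum z p (fun i => cutMul w (f i)), Φ) ∈ (L.inter n).graph) :
    ‖Φ‖ ≤ C * ∑ i, (max (setDist (L.cube n) (cone e (2 * θ₀)) / 2)
        ((Real.cos θ₀ - Real.cos (2 * θ₀)) / 2 * v * t) ^ (-α) *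
          ‖(f i).toLp 2 (volume : Measure Space3)‖ +
      (setDist (L.cube n) (cone e (2 * θ₀)) / 2) ^ (-α) *
        ‖(r i).toLp 2 (volume : Measure Space3)‖) := by
  have hd := h.d_pos
  set δ := setDist (L.cube n) (cone e (2 * θ₀)) with hδ
  have hdδ : d ≤ δ := h.le_setDist hn
  have hne := (h.isOpenCube n hn).nonempty
  have hmem := tensSum_mem_productDomain (HQ := S.HQ) hp z
  have hdom : ∀ f, tensSum z p f ∈ (L.inter n).domain := fun f =>
    h.le_domain_inter n hn (S.le_domain_HPQ (hmem f))
  have hO : IsOpen {x : Space3 | d / 2 < Metric.infDist x (cone e (2 * θ₀))} :=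
    isOpen_lt continuous_const (Metric.continuous_infDist_pt _)
  have hΦ' : (L.inter n) ⟨_, hdom fun i => cutMul w (f i)⟩ = Φ :=
    LinearPMap.mem_graph_snd_inj _ ((L.inter n).mem_graph ⟨_, hdom fun i => cutMul w (f i)⟩) hΦ rfl
  -- By locality the interaction lives within d/2 of the cone, hence off Ω, where the decay bound of
  -- (A1) is available.
  have hsupp := ae_eq_zero_of_mem_graph (L.inter n) (h.commute n hn) hdom hO
    (f := fun i => cutMul w (f i)) fun i x hx => by
      rw [cutMul_apply hw, hw₀ x hx, Complex.ofReal_zero, zero_mul]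
  rw [hΦ'] at hsupp
  refine norm_le_of_infDist_rpow_mul_le (ρ := fun x => Metric.infDist x (L.cube n))
    (P := fun x => x ∈ cone e θ₀ ∧ v * t ≤ ‖x‖) (by linarith) (by linarith)
    (lt_max_of_lt_left (by linarith)) hC ?_ hr
  filter_upwards [hsupp, h.decay n hn _ (hmem _) Φ hΦ,
    coeFn_tensSum z p fun i => cutMul w (f i)] with x h1 h2 h3 hx
  have hx' : Metric.infDist x (cone e (2 * θ₀)) ≤ d / 2 := not_lt.1 fun h => hx (h1 h)
  have hreg : ∀ y ∈ L.region, d ≤ Metric.infDist y (cone e (2 * θ₀)) := fun y hy => by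
    rw [← h.dist_region]
    exact setDist_le_infDist hy _ _
  have hδx : δ / 2 ≤ Metric.infDist x (L.cube n) :=
    half_le_infDist hne le_rfl (hx'.trans (by linarith))
  refine ⟨hδx, fun hP => max_le hδx ?_, ?_⟩
  · have h4 := mul_le_infDist_of_mem_cone hne he (θ' := 2 * θ₀) (fun y hy hy' => ?_) hP.1
    · refine le_trans ?_ h4
      rw [mul_assoc]
      exact mul_le_mul_of_nonneg_left hP.2 (by linarith)
    · have h5 := hreg y (h.cube_subset hn hy)
      rw [Metric.infDist_zero_of_mem hy'] at h5
      linarith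
  · have hxr : x ∉ L.region := fun hxr => by linarith [hreg x hxr]
    set u : ι → Spinor K := fun i => WithLp.toLp 2 fun s => (cutMul w (f i) x * z i s) • m i with hu
    have hu' : ∀ i, ‖u i‖ ≤ C * ‖f i x‖ := by
      intro i
      have e1 : u i = (cutMul w (f i) x) • spinorTensor (m i) (z i) := by
        ext s
        simp [hu, spinorTensor_apply, mul_smul]
      have e2 : ‖spinorTensor (m i) (z i)‖ ≤ C := by
        have e3 : ‖spinorTensor (m i) (z i)‖ = ‖z i‖ * ‖m i‖ := by
          rw [PiLp.norm_eq_of_L2, PiLp.norm_eq_of_L2]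
          simp only [spinorTensor_apply, norm_smul, mul_pow, ← Finset.sum_mul]
          rw [Real.sqrt_mul (Finset.sum_nonneg fun _ _ => by positivity),
            Real.sqrt_sq (norm_nonneg _)]
        rw [e3]
        exact (mul_le_of_le_one_left (norm_nonneg _) (hz i)).trans (hmC i)
      rw [e1, norm_smul, mul_comm, cutMul_apply hw, norm_mul, Complex.norm_real, Real.norm_eq_abs]
      exact mul_le_mul e2 (mul_le_of_le_one_left (norm_nonneg _) (hw₁ x)) (by positivity) hC
    have h4 := h2 hxr (∑ i, u i) fun s => by
      rw [h3, WithLp.ofLp_sum, Finset.sum_apply]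
      have h5 : ∑ i, (cutMul w (f i) x * z i s) • (p i, m i) ∈ (L.num n).graph :=
        Submodule.sum_mem _ fun i _ => (L.num n).graph.smul_mem _ (hm i)
      convert h5 using 1
      simp [Prod.ext_iff, Prod.fst_sum, Prod.snd_sum, hu]
    refine h4.trans ?_
    rw [Finset.mul_sum]
    exact (norm_sum_le _ _).trans (Finset.sum_le_sum fun i _ => hu' i)

/-- The interaction of an outgoing wave packet, cut off to a neighbourhood of the cone. -/
theorem AssumptionA1.norm_HPQ_le (h : AssumptionA1 S L e θ₀ d α β C₁ M) (he : ‖e‖ = 1)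
    (hα : 1 < α) (hθ : Real.cos (2 * θ₀) < Real.cos θ₀) (hd : 1 ≤ d) {v t A : ℝ}
    (ht : 0 ≤ t) (hA : 0 ≤ A)
    (hA' : ∀ δ t : ℝ, 1 ≤ δ → 0 ≤ t →
      (max (δ / 2) ((Real.cos θ₀ - Real.cos (2 * θ₀)) / 2 * v * t)) ^ (-α) ≤
        A * δ ^ ((1 - α) / 2) * (1 + t) ^ (-min 2 ((1 + α) / 2)) ∧
      (δ / 2) ^ (-α) * (1 + t) ^ (-2 : ℝ) ≤
        A * δ ^ ((1 - α) / 2) * (1 + t) ^ (-min 2 ((1 + α) / 2))) {C : ℝ}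
    (hC : 0 ≤ C) {w : Space3 → ℝ} (hw : w.HasTemperateGrowth)
    (hw₁ : ∀ x, |w x| ≤ 1) (hw₀ : ∀ x, d / 2 < Metric.infDist x (cone e (2 * θ₀)) → w x = 0)
    {z : ι → Spinor ℂ} (hz : ∀ i, ‖z i‖ ≤ 1) {p : ι → K} (hp : ∀ i, p i ∈ S.HQ.domain)
    (hm : ∀ n ∈ L.index, ∀ i, ∃ m, (p i, m) ∈ (L.num n).graph ∧ ‖m‖ ≤ C)
    {f r : ι → 𝓢(Space3, ℂ)}
    (hr : ∀ i x, ¬ (x ∈ cone e θ₀ ∧ v * t ≤ ‖x‖) → ‖f i x‖ ≤ ‖r i x‖) {a κ : ι → ℝ}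
    (hf : ∀ i, ‖(f i).toLp 2 (volume : Measure Space3)‖ ≤ a i)
    (hrκ : ∀ i, ‖(r i).toLp 2 (volume : Measure Space3)‖ ≤ κ i * (1 + t) ^ (-2 : ℝ))
    (hκ : ∀ i, 0 ≤ κ i) :
    ‖S.HPQ ⟨tensSum z p (fun i => cutMul w (f i)),
      S.le_domain_HPQ (tensSum_mem_productDomain hp z _)⟩‖ ≤
      C * A * (∑ i, (a i + κ i)) * (C₁ * d ^ (-β)) * (1 + t) ^ (-min 2 ((1 + α) / 2)) := by
  classical
  set y := tensSum z p (fun i => cutMul w (f i)) with hy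
  have hy' : y ∈ S.HPQ.domain := S.le_domain_HPQ (tensSum_mem_productDomain hp z _)
  set D : ℕ → ℝ := fun n => setDist (L.cube n) (cone e (2 * θ₀)) ^ ((1 - α) / 2) with hD
  set Φ : ℕ → SpinL2 K := fun n => if hn : n ∈ L.index then
    L.inter n ⟨y, h.le_domain_inter n hn hy'⟩ else 0 with hΦdef
  have hΦ : ∀ n ∈ L.index, (y, Φ n) ∈ (L.inter n).graph := by
    intro n hn
    simp only [hΦdef, dif_pos hn]
    exact (L.inter n).mem_graph ⟨y, h.le_domain_inter n hn hy'⟩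
  have hΦ0 : ∀ n ∉ L.index, Φ n = 0 := fun n hn => by simp only [hΦdef, dif_neg hn]
  set B := C * A * (∑ i, (a i + κ i)) * (1 + t) ^ (-min 2 ((1 + α) / 2)) with hB
  have ha : ∀ i, 0 ≤ a i := fun i => (norm_nonneg _).trans (hf i)
  have hB0 : 0 ≤ B := by
    have : 0 ≤ ∑ i, (a i + κ i) := Finset.sum_nonneg fun i _ => add_nonneg (ha i) (hκ i)
    positivity
  have hbound : ∀ n ∈ L.index, ‖Φ n‖ ≤ B * D n := by
    intro n hn
    choose m hm₁ hm₂ using hm n hn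
    have hδ : 1 ≤ setDist (L.cube n) (cone e (2 * θ₀)) := hd.trans (h.le_setDist hn)
    refine (h.norm_inter_le he hα hθ hC hn hw hw₁ hw₀ hz hp hm₁ hm₂ hr (hΦ n hn)).trans ?_
    obtain ⟨b1, b2⟩ := hA' _ t hδ ht
    set δ := setDist (L.cube n) (cone e (2 * θ₀)) with hδdef
    have hT : 0 ≤ (1 + t) ^ (-min 2 ((1 + α) / 2)) := by positivity
    have hDn : 0 ≤ δ ^ ((1 - α) / 2) := by positivity
    calc C * ∑ i, (max (δ / 2) ((Real.cos θ₀ - Real.cos (2 * θ₀)) / 2 * v * t) ^ (-α) *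
          ‖(f i).toLp 2 (volume : Measure Space3)‖ +
        (δ / 2) ^ (-α) * ‖(r i).toLp 2 (volume : Measure Space3)‖)
        ≤ C * ∑ i, (A * δ ^ ((1 - α) / 2) * (1 + t) ^ (-min 2 ((1 + α) / 2))) * (a i + κ i) := by
          refine mul_le_mul_of_nonneg_left (Finset.sum_le_sum fun i _ => ?_) hC
          rw [mul_add]
          refine add_le_add (mul_le_mul b1 (hf i) (norm_nonneg _) (by positivity)) ?_
          refine (mul_le_mul_of_nonneg_left (hrκ i) (by positivity)).trans ?_
          rw [mul_left_comm, mul_comm]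
          exact mul_le_mul_of_nonneg_right b2 (hκ i)
      _ = B * D n := by
          rw [← Finset.mul_sum]
          simp only [hB, hD]
          ring
  have hsum : ∑' n : L.index, D n ≤ C₁ * d ^ (-β) := h.tsum_dist_le
  have hDnn : ∀ n ∈ L.index, 0 ≤ D n := fun n hn => by
    have := hd.trans (h.le_setDist hn)
    exact Real.rpow_nonneg (by linarith) _
  have hpart : ∀ k, ‖∑ n ∈ Finset.range k, Φ n‖ ≤ B * (C₁ * d ^ (-β)) := by
    intro k
    -- Extension by zero turns the sum over the index set into a sum over ℕ. The partial sums are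
    -- then bounded uniformly, and strong convergence carries the bound to H_{P,Q}.
    have hind : ∀ n, ‖Φ n‖ ≤ B * L.index.indicator D n := by
      intro n
      by_cases hn : n ∈ L.index
      · rw [Set.indicator_of_mem hn]
        exact hbound n hn
      · rw [hΦ0 n hn, Set.indicator_of_notMem hn, norm_zero, mul_zero]
    have hS : Summable (L.index.indicator D) :=
      summable_subtype_iff_indicator.1 h.summable_dist
    refine (norm_sum_le _ _).trans ((Finset.sum_le_sum fun n _ => hind n).trans ?_)
    rw [← Finset.mul_sum]
    refine mul_le_mul_of_nonneg_left ((hS.sum_le_tsum _ fun n _ => ?_).trans ?_) hB0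
    · exact Set.indicator_nonneg hDnn n
    · rw [← tsum_subtype]
      exact hsum
  have hlim := h.strong_sum ⟨y, hy'⟩ Φ hΦ hΦ0
  refine (le_of_tendsto hlim.norm (Eventually.of_forall hpart)).trans (le_of_eq ?_)
  rw [hB]
  ring

end InteractionBound

/-! ### Decomposition of the initial state -/

section InitialState

/-- Finitely many states of Schwartz class with spectrum in `A` are combinations of orthonormal
ones. -/
theorem exists_orthonormal_schwartz {n : ℕ} (φ : Fin n → Lp ℂ 2 (volume : Measure Space3))
    (A : Set Space3) (hφ : ∀ j, ∃ f : 𝓢(Space3, ℂ), φ j = f.toLp 2 volume ∧ ∀ ξ ∉ A, 𝓕 f ξ = 0) :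
    ∃ (N : ℕ) (g : Fin N → 𝓢(Space3, ℂ)) (c : Fin n → Fin N → ℂ),
      Orthonormal ℂ (fun l => (g l).toLp 2 (volume : Measure Space3)) ∧
      (∀ l, ∀ ξ ∉ A, 𝓕 (g l) ξ = 0) ∧ ∀ j, φ j = ∑ l, c j l • (g l).toLp 2 volume := by
  let V : Submodule ℂ 𝓢(Space3, ℂ) :=
    { carrier := {f | ∀ ξ ∉ A, 𝓕 f ξ = 0}
      add_mem' := fun {f g} hf hg ξ hξ => by
        rw [FourierTransform.fourier_add, add_apply, hf ξ hξ, hg ξ hξ, add_zero]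
      zero_mem' := fun ξ _ => by
        rw [FourierTransform.fourier_zero, zero_apply]
      smul_mem' := fun c f hf ξ hξ => by
        rw [FourierTransform.fourier_smul, smul_apply, hf ξ hξ, smul_zero] }
  let E : Submodule ℂ (Lp ℂ 2 (volume : Measure Space3)) := Submodule.span ℂ (Set.range φ)
  -- The admissible Schwartz functions form a subspace, so every vector in the span of the φ j, in
  -- particular each member of an orthonormal basis, has such a representative.
  have hE : E ≤ V.map (SchwartzMap.toLpCLM ℂ ℂ 2 (volume : Measure Space3)).toLinearMap := by
    refine Submodule.span_le.2 ?_
    rintro _ ⟨j, rfl⟩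
    obtain ⟨f, hf, hf'⟩ := hφ j
    exact ⟨f, hf', hf.symm⟩
  have hfin : FiniteDimensional ℂ E := FiniteDimensional.span_of_finite ℂ (Set.finite_range φ)
  let b := stdOrthonormalBasis ℂ E
  have hb : ∀ l, ∃ g : 𝓢(Space3, ℂ), (∀ ξ ∉ A, 𝓕 g ξ = 0) ∧
      g.toLp 2 (volume : Measure Space3) = (b l : Lp ℂ 2 (volume : Measure Space3)) := fun l => by
    obtain ⟨g, hg, hg'⟩ := hE (b l).2
    exact ⟨g, hg, hg'⟩
  choose g hg hg' using hb
  refine ⟨Module.finrank ℂ E, g,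
    fun j l => b.repr ⟨φ j, Submodule.subset_span ⟨j, rfl⟩⟩ l, ?_, hg, fun j => ?_⟩
  · refine orthonormal_iff_ite.2 fun i j => ?_
    rw [hg', hg', ← Submodule.coe_inner]
    exact orthonormal_iff_ite.1 b.orthonormal i j
  · have h1 := congrArg E.subtype (b.sum_repr ⟨φ j, Submodule.subset_span ⟨j, rfl⟩⟩)
    simp only [map_sum, map_smul, Submodule.subtype_apply] at h1
    simp only [hg']
    exact h1.symm

theorem fourier_eq_fourier3 {V : Type*} [NormedAddCommGroup V] [NormedSpace ℂ V]
    (F : 𝓢(Space3, V)) (ξ : Space3) :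
    𝓕 F ξ = ((2 * Real.pi) ^ (3 / 2 : ℝ) : ℝ) • fourier3 F ((2 * Real.pi) • ξ) := by
  have h1 : (0 : ℝ) < 2 * Real.pi := by positivity
  rw [fourier3, smul_smul, ← Real.rpow_add h1]
  rw [show (3 / 2 : ℝ) + -(3 / 2) = 0 by ring, Real.rpow_zero, one_smul, SchwartzMap.fourier_coe,
    Real.fourier_eq']
  congr 1
  ext x
  congr 2
  rw [real_inner_smul_left, real_inner_comm]
  push_cast
  ring

theorem fourier_postcompCLM {V V' : Type*} [NormedAddCommGroup V] [NormedSpace ℂ V]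
    [CompleteSpace V] [NormedAddCommGroup V'] [NormedSpace ℂ V'] [CompleteSpace V']
    (T : V →L[ℂ] V') (F : 𝓢(Space3, V))
    (ξ : Space3) : 𝓕 (SchwartzMap.postcompCLM T F) ξ = T (𝓕 F ξ) := by
  rw [SchwartzMap.fourier_coe, SchwartzMap.fourier_coe, Real.fourier_eq', Real.fourier_eq',
    ← T.integral_comp_comm]
  · simp only [map_smul]
    rfl
  · have h := F.integrable (μ := (volume : Measure Space3))
    refine (h.norm.mono' ?_ ?_)
    · refine AEStronglyMeasurable.smul ?_ h.aestronglyMeasurable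
      fun_prop
    · refine Eventually.of_forall fun x => ?_
      rw [norm_smul, Complex.norm_exp_ofReal_mul_I, one_mul]

theorem AssumptionA2.fourier_eq_zero {K : Type*} [NormedAddCommGroup K] [InnerProductSpace ℂ K]
    {F : 𝓢(Space3, Spinor K)} {e : Space3} {θ v : ℝ}
    (hF : tsupport (fourier3 F) ⊆ truncatedCone e θ v) {ξ : Space3} (hξ : ξ ∉ outgoingSet e θ v) :
    𝓕 F ξ = 0 := by
  have h1 : (0 : ℝ) < 2 * Real.pi := by positivity
  rw [fourier_eq_fourier3]
  by_cases h : fourier3 F ((2 * Real.pi) • ξ) = 0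
  · rw [h, smul_zero]
  · refine absurd ?_ hξ
    obtain ⟨h2, h3⟩ := hF (subset_tsupport _ h)
    refine ⟨?_, ?_⟩
    · exact (smul_mem_cone h1).1 h2
    · have h4 : v < ‖(2 * Real.pi) • ξ‖ := h3
      rw [norm_smul, Real.norm_of_nonneg h1.le] at h4
      exact h4.le

variable {HD : Type*} [NormedAddCommGroup HD] [InnerProductSpace ℂ HD] {n : ℕ}

/-- The states of `Q` which are correlated with the spin of `P`: `0` is `ψ_j,↑` and `1` is
`ψ_j,↓`. -/
def filterState (ψ : Fin n → Lp ℂ 2 (volume : Measure Space3)) (χ : Fin n → HD) (j : Fin n)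
    (s : Fin 2) : SpinL2 HD :=
  tens (withSpin (ψ j) (spinVec s)) (χ j)

theorem inner_filterState {ψ : Fin n → Lp ℂ 2 (volume : Measure Space3)} (hψ : ∀ j, ‖ψ j‖ = 1)
    {χ : Fin n → HD} (hχ : Orthonormal ℂ χ) (j : Fin n) (s : Fin 2) (j' : Fin n) (s' : Fin 2) :
    ⟪filterState ψ χ j s, filterState ψ χ j' s'⟫_ℂ = if j = j' ∧ s = s' then 1 else 0 := by
  rw [filterState, filterState, inner_tens_withSpin, inner_spinVec, orthonormal_iff_ite.1 hχ]
  by_cases h : j = j'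
  · subst h
    rw [inner_self_eq_norm_sq_to_K, hψ]
    simp
  · simp [h]

theorem singletState_eq (φ ψ : Fin n → Lp ℂ 2 (volume : Measure Space3)) (χ : Fin n → HD) :
    singletState φ ψ χ = ((Real.sqrt (2 * n))⁻¹ : ℂ) • ∑ j,
      (tens (withSpin (φ j) spinDown) (filterState ψ χ j 0) -
        tens (withSpin (φ j) spinUp) (filterState ψ χ j 1)) := rfl

/-- Pairing the spin-down component of Ψ with `q j 0` isolates φ j by orthonormality. This is a
bounded linear map on fibres, so it preserves the Schwartz class and the spectral support. -/
theorem AssumptionA2.exists_schwartz {K : Type*} [NormedAddCommGroup K] [InnerProductSpace ℂ K]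
    [CompleteSpace K] {Ψ : SpinL2 K} {φ : Fin n → Lp ℂ 2 (volume : Measure Space3)}
    {q : Fin n → Fin 2 → K}
    (hq : ∀ j s j' s', ⟪q j s, q j' s'⟫_ℂ = if j = j' ∧ s = s' then 1 else 0)
    (hΨ : Ψ = ((Real.sqrt (2 * n))⁻¹ : ℂ) • ∑ j, (tens (withSpin (φ j) spinDown) (q j 0) -
      tens (withSpin (φ j) spinUp) (q j 1))) {e : Space3} {θ v : ℝ}
    (h : AssumptionA2 Ψ e θ v) (j : Fin n) :
    ∃ f : 𝓢(Space3, ℂ), φ j = f.toLp 2 volume ∧ ∀ ξ ∉ outgoingSet e θ v, 𝓕 f ξ = 0 := by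
  obtain ⟨F, hF, hF'⟩ := h.schwartz
  have hn : 0 < (n : ℝ) := Nat.cast_pos.2 (j.pos)
  have hs : (Real.sqrt (2 * n) : ℂ) ≠ 0 := by
    rw [Ne, Complex.ofReal_eq_zero]
    positivity
  let T : Spinor K →L[ℂ] ℂ := (Real.sqrt (2 * n) : ℂ) •
    (innerSL ℂ (q j 0)).comp (PiLp.proj 2 (fun _ : Fin 2 => K) 1)
  have hT : ∀ u, T u = (Real.sqrt (2 * n) : ℂ) * ⟪q j 0, u 1⟫_ℂ := fun u => rfl
  refine ⟨SchwartzMap.postcompCLM T F, ?_, fun ξ hξ => ?_⟩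
  · refine Lp.ext ?_
    have h1 : ∀ᵐ x : Space3, ∀ i s,
        (tens (withSpin (φ i) spinDown) (q i 0) - tens (withSpin (φ i) spinUp) (q i 1) :
          SpinL2 K) x s = (φ i x * spinDown s) • q i 0 - (φ i x * spinUp s) • q i 1 := by
      rw [ae_all_iff]
      intro i
      filter_upwards [Lp.coeFn_sub (tens (withSpin (φ i) spinDown) (q i 0))
        (tens (withSpin (φ i) spinUp) (q i 1)), coeFn_tens_withSpin (φ i) spinDown (q i 0),
        coeFn_tens_withSpin (φ i) spinUp (q i 1)] with x a b c s
      rw [a, Pi.sub_apply, PiLp.sub_apply, b, c]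
    have h2 : ∀ᵐ x : Space3, F x = Ψ x := by
      rw [hF]
      filter_upwards [F.coeFn_toLp 2 (volume : Measure Space3)] with x a
      exact a.symm
    rw [hΨ] at h2
    filter_upwards [h1, h2, Lp.coeFn_smul ((Real.sqrt (2 * n))⁻¹ : ℂ) (∑ j,
      (tens (withSpin (φ j) spinDown) (q j 0) - tens (withSpin (φ j) spinUp) (q j 1))),
      Lp.coeFn_finsetSum Finset.univ (fun j =>
        tens (withSpin (φ j) spinDown) (q j 0) - tens (withSpin (φ j) spinUp) (q j 1)),
      (SchwartzMap.postcompCLM T F).coeFn_toLp 2 (volume : Measure Space3)] with x a b c d k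
    rw [k, SchwartzMap.postcompCLM_apply, hT, b, c, Pi.smul_apply, PiLp.smul_apply, d,
      Finset.sum_apply, WithLp.ofLp_sum, Finset.sum_apply]
    simp only [a, inner_smul_right, inner_sum, inner_sub_right, hq]
    generalize (Real.sqrt (2 * n) : ℂ) = r at hs ⊢
    simp [spinDown, spinUp, hs]
  · rw [fourier_postcompCLM, AssumptionA2.fourier_eq_zero hF' hξ, map_zero]

/-- The components in `Q` of the entangled state with respect to product states of `P`. -/
def entangledPart {N : ℕ} (c : Fin n → Fin N → ℂ) (q : Fin n → Fin 2 → HD) (i : Fin N × Fin 2) :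
    HD :=
  if i.2 = 0 then -((Real.sqrt (2 * n))⁻¹ : ℂ) • ∑ j, c j i.1 • q j 1
  else ((Real.sqrt (2 * n))⁻¹ : ℂ) • ∑ j, c j i.1 • q j 0

theorem sum_tens_entangledPart {N : ℕ} (c : Fin n → Fin N → ℂ) (q : Fin n → Fin 2 → HD)
    (a : Fin N → Lp ℂ 2 (volume : Measure Space3)) :
    ∑ i : Fin N × Fin 2, tens (withSpin (a i.1) (spinVec i.2)) (entangledPart c q i) =
      ((Real.sqrt (2 * n))⁻¹ : ℂ) • ∑ j,
        (tens (withSpin (∑ l, c j l • a l) spinDown) (q j 0) -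
          tens (withSpin (∑ l, c j l • a l) spinUp) (q j 1)) := by
  rw [Fintype.sum_prod_type]
  simp only [Fin.sum_univ_two, entangledPart, spinVec, ← tensCLM_apply, ← withSpinCLM_apply,
    map_sum, map_smul, if_true, one_ne_zero, if_false, neg_smul, map_neg,
    sum_apply, smul_apply]
  rw [Finset.sum_add_distrib, Finset.sum_neg_distrib, ← Finset.smul_sum, ← Finset.smul_sum,
    Finset.sum_sub_distrib, smul_sub,
    Finset.sum_comm (f := fun l j => c j l • tensCLM HD (withSpinCLM spinUp (a l)) (q j 1)),
    Finset.sum_comm (f := fun l j => c j l • tensCLM HD (withSpinCLM spinDown (a l)) (q j 0))]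
  abel

theorem map_entangledPart {N : ℕ} (c : Fin n → Fin N → ℂ) (q : Fin n → Fin 2 → HD)
    (W : HD →L[ℂ] HD) (i : Fin N × Fin 2) :
    W (entangledPart c q i) = entangledPart c (fun j s => W (q j s)) i := by
  unfold entangledPart
  split_ifs <;> simp only [map_smul, map_sum]

end InitialState

/-! ### Cook's method -/

section Cook

/-- Comparison with B(1 - (1+s)^{1-γ})/(γ-1), the integral of the bound; γ > 1 makes it bounded in
time. -/
theorem norm_sub_le_of_norm_deriv_le_rpow {E : Type*} [NormedAddCommGroup E] [NormedSpace ℝ E]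
    {f f' : ℝ → E} {B γ : ℝ} (hγ : 1 < γ) (hf : ∀ s, 0 ≤ s → HasDerivAt f (f' s) s)
    (hB : ∀ s, 0 ≤ s → ‖f' s‖ ≤ B * (1 + s) ^ (-γ)) {t : ℝ} (ht : 0 ≤ t) :
    ‖f t - f 0‖ ≤ B / (γ - 1) := by
  have hB0 : 0 ≤ B := by
    have := (norm_nonneg _).trans (hB 0 le_rfl)
    simpa using this
  have h1 : ∀ s, 0 ≤ s → HasDerivAt (fun s : ℝ => B / (γ - 1) * (1 - (1 + s) ^ (1 - γ)))
      (B * (1 + s) ^ (-γ)) s := by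
    intro s hs
    have h2 : HasDerivAt (fun s : ℝ => 1 + s) 1 s := (hasDerivAt_id s).const_add 1
    have h3 := ((h2.rpow_const (p := 1 - γ) (Or.inl (by linarith))).const_sub 1).const_mul
      (B / (γ - 1))
    convert! h3 using 1
    have : γ - 1 ≠ 0 := by linarith
    rw [show 1 - γ - 1 = -γ by ring]
    field_simp
    ring
  have h4 := image_norm_le_of_norm_deriv_right_le_deriv_boundary' (f := fun s => f s - f 0)
    (f' := f') (a := 0) (b := t) (B := fun s : ℝ => B / (γ - 1) * (1 - (1 + s) ^ (1 - γ)))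
    (B' := fun s => B * (1 + s) ^ (-γ))
    (fun s hs => ((hf s hs.1).sub_const _).continuousAt.continuousWithinAt)
    (fun s hs => ((hf s hs.1).sub_const _).hasDerivWithinAt) (by simp)
    (fun s hs => (h1 s hs.1).continuousAt.continuousWithinAt)
    (fun s hs => (h1 s hs.1).hasDerivWithinAt) (fun s hs => hB s hs.1)
    (Set.right_mem_Icc.2 ht)
  refine h4.trans (mul_le_of_le_one_right (div_nonneg hB0 (by linarith)) ?_)
  have : 0 ≤ (1 + t) ^ (1 - γ) := by positivity
  linarith

variable {ι : Type*} [Fintype ι] {K : Type*} [NormedAddCommGroup K] [InnerProductSpace ℂ K]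

variable {W : ℝ → K →L[ℂ] K} {w : Space3 → ℝ} {w₁ w₂ : Fin 3 → Space3 → ℝ} {B₁ B₂ : ℝ}

/-- The uncoupled evolution of product states, cut off in the position of `P`. -/
def cutEvol (W : ℝ → K →L[ℂ] K) (w : Space3 → ℝ) (z : ι → Spinor ℂ) (p : ι → K)
    (g : ι → 𝓢(Space3, ℂ)) (t : ℝ) : SpinL2 K :=
  tensSum z (fun i => W t (p i)) fun i => cutMul w (freeEvol t (g i))

theorem hasDerivAt_tens {u : ℝ → Lp ℂ 2 (volume : Measure Space3)}
    {u' : Lp ℂ 2 (volume : Measure Space3)} {q : ℝ → K} {q' : K} {t : ℝ}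
    (hu : HasDerivAt u u' t) (hq : HasDerivAt q q' t) (z : Spinor ℂ) :
    HasDerivAt (fun s => tens (withSpin (u s) z) (q s))
      (tens (withSpin u' z) (q t) + tens (withSpin (u t) z) q') t := by
  have h1 : IsBoundedBilinearMap ℂ fun r : SpinL2 ℂ × K => tensCLM K r.1 r.2 :=
    (tensCLM K).isBoundedBilinearMap
  have h2 : HasDerivAt (fun s => withSpinCLM z (u s)) (withSpinCLM z u') t :=
    ((withSpinCLM z).restrictScalars ℝ).hasFDerivAt.comp_hasDerivAt t hu
  have h3 := ((h1.hasFDerivAt (withSpinCLM z (u t), q t)).restrictScalars ℝ).comp_hasDerivAt t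
    (h2.prodMk hq)
  convert! h3 using 1
  simp only [ContinuousLinearMap.coe_restrictScalars', IsBoundedBilinearMap.deriv_apply,
    tensCLM_apply, withSpinCLM_apply]
  rw [add_comm]

theorem IsTimeEvolution.apply_mem_domain {A : K →ₗ.[ℂ] K} (h : IsTimeEvolution A W) {p : K}
    (hp : p ∈ A.domain) (t : ℝ) : W t p ∈ A.domain :=
  LinearPMap.mem_domain_of_mem_graph (h.mem_graph (A.mem_graph ⟨p, hp⟩) t)

theorem hasDerivAt_cutEvol {A : K →ₗ.[ℂ] K} (hW : IsTimeEvolution A W)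
    (hw : IsCutoff w w₁ w₂ B₁ B₂) (z : ι → Spinor ℂ) {p : ι → K} (hp : ∀ i, p i ∈ A.domain)
    (g : ι → 𝓢(Space3, ℂ)) (t : ℝ) :
    HasDerivAt (cutEvol W w z p g) (-Complex.I •
      (tensSum z (fun i => W t (p i)) (fun i => cutMul w (schwartzHam (freeEvol t (g i)))) +
        tensSum z (fun i => A ⟨W t (p i), hW.apply_mem_domain (hp i) t⟩)
          fun i => cutMul w (freeEvol t (g i)))) t := by
  have h1 : ∀ i, HasDerivAt (fun s => tens (withSpin ((cutMul w (freeEvol s (g i))).toLp 2 volume)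
      (z i)) (W s (p i))) (-Complex.I •
        (tens (withSpin ((cutMul w (schwartzHam (freeEvol t (g i)))).toLp 2 volume) (z i))
          (W t (p i)) + tens (withSpin ((cutMul w (freeEvol t (g i))).toLp 2 volume) (z i))
            (A ⟨W t (p i), hW.apply_mem_domain (hp i) t⟩))) t := by
    intro i
    have hA : A ⟨W t (p i), hW.apply_mem_domain (hp i) t⟩ = W t (A ⟨p i, hp i⟩) :=
      A.mem_graph_snd_inj (A.mem_graph ⟨W t (p i), hW.apply_mem_domain (hp i) t⟩)
        (hW.mem_graph (A.mem_graph ⟨p i, hp i⟩) t) rfl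
    have h2 := hasDerivAt_tens (hasDerivAt_toLp_cutMul_freeEvol hw (g i) t)
      (hW.hasDerivAt (A.mem_graph ⟨p i, hp i⟩) t) (z i)
    convert! h2 using 1
    rw [hA, smul_add]
    simp only [← tensCLM_apply, ← withSpinCLM_apply, map_smul, smul_apply]
  have h2 := HasDerivAt.fun_sum fun i (_ : i ∈ Finset.univ) => h1 i
  convert! h2 using 1
  rw [← Finset.smul_sum, Finset.sum_add_distrib]
  rfl

variable [CompleteSpace K]

/-- The decomposition of H, given on single product vectors, extends to sums because graphs are
linear subspaces. -/
theorem CoupledSystem.mem_graph_H (S : CoupledSystem K) (z : ι → Spinor ℂ)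
    (p : ι → S.HQ.domain) (f : ι → 𝓢(Space3, ℂ)) :
    (tensSum z (fun i => (p i : K)) f,
      tensSum z (fun i => (p i : K)) (fun i => schwartzHam (f i)) +
      tensSum z (fun i => S.HQ (p i)) f +
      S.HPQ ⟨_, S.le_domain_HPQ (tensSum_mem_productDomain (fun i => (p i).2) z f)⟩) ∈
        S.H.graph := by
  set F : ι → freeHam.domain := fun i => ⟨_, withSpin_mem_domain (f i) (z i)⟩ with hF
  have hmem : ∀ i, tens (F i : SpinL2 ℂ) (p i : K) ∈ productDomain S.HQ := fun i =>
    tens_mem_productDomain S.HQ (F i) (p i)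
  have h1 : ∀ i, (tens (F i : SpinL2 ℂ) (p i : K),
      tens (freeHam (F i)) (p i : K) + tens (F i : SpinL2 ℂ) (S.HQ (p i)) +
        S.HPQ ⟨_, S.le_domain_HPQ (hmem i)⟩) ∈ S.H.graph := by
    intro i
    rw [← S.H_apply (F i) (p i)]
    exact S.H.mem_graph ⟨_, S.le_domain_H (hmem i)⟩
  have h2 : ∑ i, S.HPQ ⟨_, S.le_domain_HPQ (hmem i)⟩ =
      S.HPQ ⟨_, S.le_domain_HPQ (tensSum_mem_productDomain (fun i => (p i).2) z f)⟩ := by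
    have h3 : ∑ i, (tens (F i : SpinL2 ℂ) (p i : K), S.HPQ ⟨_, S.le_domain_HPQ (hmem i)⟩) ∈
        S.HPQ.graph := Submodule.sum_mem _ fun i _ => S.HPQ.mem_graph ⟨_, S.le_domain_HPQ (hmem i)⟩
    have h4 := S.HPQ.mem_graph
      ⟨_, S.le_domain_HPQ (tensSum_mem_productDomain (fun i => (p i).2) z f)⟩
    have h5 : ∑ i, (tens (F i : SpinL2 ℂ) (p i : K), S.HPQ ⟨_, S.le_domain_HPQ (hmem i)⟩) =
        (∑ i, tens (F i : SpinL2 ℂ) (p i : K), ∑ i, S.HPQ ⟨_, S.le_domain_HPQ (hmem i)⟩) := by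
      rw [Prod.ext_iff, Prod.fst_sum, Prod.snd_sum]
      exact ⟨rfl, rfl⟩
    rw [h5] at h3
    exact S.HPQ.mem_graph_snd_inj h3 h4 rfl
  have h5 : ∑ i, (tens (F i : SpinL2 ℂ) (p i : K),
      tens (freeHam (F i)) (p i : K) + tens (F i : SpinL2 ℂ) (S.HQ (p i)) +
        S.HPQ ⟨_, S.le_domain_HPQ (hmem i)⟩) ∈ S.H.graph := Submodule.sum_mem _ fun i _ => h1 i
  rw [← h2]
  convert h5 using 1
  rw [Prod.ext_iff, Prod.fst_sum, Prod.snd_sum]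
  refine ⟨rfl, ?_⟩
  simp only [tensSum, hF, freeHam_withSpin, Finset.sum_add_distrib]

variable {S : CoupledSystem K} {U : ℝ → SpinL2 K →L[ℂ] SpinL2 K}

/-- Cook's method: the derivative of `e^{itH}` applied to the uncoupled evolution. -/
theorem hasDerivAt_neg_cutEvol (hW : IsTimeEvolution S.HQ W) (hU : IsTimeEvolution S.H U)
    (hw : IsCutoff w w₁ w₂ B₁ B₂) (z : ι → Spinor ℂ) {p : ι → K} (hp : ∀ i, p i ∈ S.HQ.domain)
    (g : ι → 𝓢(Space3, ℂ)) (t : ℝ) :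
    HasDerivAt (fun s => U (-s) (cutEvol W w z p g s)) (U (-t) (Complex.I •
      (tensSum z (fun i => W t (p i)) (fun i => schwartzHam (cutMul w (freeEvol t (g i))) -
        cutMul w (schwartzHam (freeEvol t (g i)))) +
      S.HPQ ⟨cutEvol W w z p g t, S.le_domain_HPQ (tensSum_mem_productDomain
        (fun i => hW.apply_mem_domain (hp i) t) z _)⟩))) t := by
  have h1 := S.mem_graph_H z (fun i => ⟨W t (p i), hW.apply_mem_domain (hp i) t⟩)
    (fun i => cutMul w (freeEvol t (g i)))
  have h2 := hU.hasDerivAt_neg_apply (hasDerivAt_cutEvol hW hw z hp g t) h1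
  -- The H_Q terms cancel; the two H_P terms differ by the order of w and H_P and leave the
  -- commutator.
  convert! h2 using 2
  have h3 : tensSum z (fun i => W t (p i)) (fun i => schwartzHam (cutMul w (freeEvol t (g i))) -
      cutMul w (schwartzHam (freeEvol t (g i)))) =
      tensSum z (fun i => W t (p i)) (fun i => schwartzHam (cutMul w (freeEvol t (g i)))) -
      tensSum z (fun i => W t (p i)) (fun i => cutMul w (schwartzHam (freeEvol t (g i)))) :=
    map_sub (tensSumₗ z fun i => W t (p i)) _ _
  rw [h3, neg_smul, ← sub_eq_add_neg, ← smul_sub]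
  congr 1
  simp only [cutEvol]
  abel

/-- Applying e^{itH} to the difference leaves its norm unchanged and reduces it to the initial error
plus the time integral of the Cook derivative. -/
theorem norm_sub_cutEvol_le (hW : IsTimeEvolution S.HQ W) (hU : IsTimeEvolution S.H U)
    (hw : IsCutoff w w₁ w₂ B₁ B₂) {z : ι → Spinor ℂ} (hz : ∀ i, ‖z i‖ ≤ 1) {p : ι → K}
    (hp : ∀ i, p i ∈ S.HQ.domain) (hp₁ : ∀ i, ‖p i‖ ≤ 1) (g : ι → 𝓢(Space3, ℂ)) {κ : ι → ℝ}
    (hκ : ∀ i t, 0 ≤ t → ‖(schwartzHam (cutMul w (freeEvol t (g i))) -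
      cutMul w (schwartzHam (freeEvol t (g i)))).toLp 2 (volume : Measure Space3)‖ ≤
        κ i * (1 + t) ^ (-2 : ℝ)) {B γ : ℝ} (hγ : 1 < γ) (hγ₂ : γ ≤ 2)
    (hB : ∀ t, 0 ≤ t → ‖S.HPQ ⟨cutEvol W w z p g t, S.le_domain_HPQ (tensSum_mem_productDomain
        (fun i => hW.apply_mem_domain (hp i) t) z _)⟩‖ ≤ B * (1 + t) ^ (-γ))
    {t : ℝ} (ht : 0 ≤ t) (Ψ : SpinL2 K) :
    ‖U t Ψ - cutEvol W w z p g t‖ ≤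
      ‖Ψ - cutEvol W w z p g 0‖ + ((∑ i, κ i) + B) / (γ - 1) := by
  have hκ0 : ∀ i, 0 ≤ κ i := fun i => by
    have := (norm_nonneg _).trans (hκ i 0 le_rfl)
    simpa using this
  have h1 := norm_sub_le_of_norm_deriv_le_rpow (B := (∑ i, κ i) + B) hγ
    (fun s _ => hasDerivAt_neg_cutEvol hW hU hw z hp g s) (fun s hs => ?_) ht
  · have h2 : ‖U t Ψ - cutEvol W w z p g t‖ = ‖Ψ - U (-t) (cutEvol W w z p g t)‖ := by
      rw [← hU.norm_map (-t), map_sub, ← hU.apply_add, neg_add_cancel, hU.apply_zero]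
    rw [neg_zero, hU.apply_zero, norm_sub_rev] at h1
    rw [h2]
    exact (norm_sub_le_norm_sub_add_norm_sub _ _ _).trans (by gcongr)
  · rw [hU.norm_map, norm_smul, Complex.norm_I, one_mul, add_mul]
    refine (norm_add_le _ _).trans (add_le_add ?_ (hB s hs))
    refine (norm_tensSum_le _ _ _).trans ?_
    rw [Finset.sum_mul]
    refine Finset.sum_le_sum fun i _ => ?_
    have h3 : (1 + s) ^ (-2 : ℝ) ≤ (1 + s) ^ (-γ) :=
      Real.rpow_le_rpow_of_exponent_le (by linarith) (by linarith)
    rw [hW.norm_map, mul_assoc]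
    refine (mul_le_of_le_one_right (norm_nonneg _) (mul_le_one₀ (hz i) (norm_nonneg _)
      (hp₁ i))).trans ((hκ i s hs).trans ?_)
    exact mul_le_mul_of_nonneg_left h3 (hκ0 i)

end Cook

/-! ### Assembly of the estimate and the final theorem -/

section Main

section Estimate

variable {ι : Type*} [Fintype ι] {K : Type*} [NormedAddCommGroup K] [InnerProductSpace ℂ K]
  [CompleteSpace K] {S : CoupledSystem K} {L : RegionData K} {W : ℝ → K →L[ℂ] K}
  {U : ℝ → SpinL2 K →L[ℂ] SpinL2 K} {e : Space3} {θ₀ d α β C₁ C₂ M v : ℝ}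

/-- The bound on the whole state passes to each coefficient vector because the P-factors are
orthonormal: W t commutes with the expansion, and partial inner products do not increase the norm.
-/
theorem AssumptionA3.exists_mem_graph {z : ι → Spinor ℂ} {g : ι → 𝓢(Space3, ℂ)}
    (hg : Orthonormal ℂ fun i => withSpin ((g i).toLp 2 volume) (z i)) {p : ι → K}
    (h : AssumptionA3 L W (tensSum z p g) C₂) {n : ℕ} (hn : n ∈ L.index) {t : ℝ} (ht : 0 ≤ t)
    (i : ι) : ∃ m, (W t (p i), m) ∈ (L.num n).graph ∧ ‖m‖ ≤ max C₂ 0 := by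
  obtain ⟨Φ, hΦ, -, hΦ₂⟩ := h n hn t ht
  have h1 : ∀ᵐ x : Space3, ∀ i s, tens (withSpin ((g i).toLp 2 volume) (z i)) (p i) x s =
      withSpin ((g i).toLp 2 volume) (z i) x s • p i := by
    rw [ae_all_iff]
    exact fun i => coeFn_tens _ _
  have h2 : ∀ᵐ x : Space3, FiberApply (L.num n) (WithLp.toLp 2 fun s =>
      ∑ i, withSpin ((g i).toLp 2 volume) (z i) x s • W t (p i)) (Φ x) := by
    filter_upwards [hΦ, h1, Lp.coeFn_finsetSum Finset.univ
      (fun i => tens (withSpin ((g i).toLp 2 volume) (z i)) (p i))] with x a b c s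
    have h3 := a s
    rw [tensSum, c, Finset.sum_apply, WithLp.ofLp_sum] at h3
    simp only [Finset.sum_apply, b, map_sum, map_smul] at h3
    exact h3
  obtain ⟨m, hm, hm'⟩ := exists_mem_graph_of_fiberApply (L.num n) hg _ Φ h2 i
  refine ⟨m, hm, hm'.trans ?_⟩
  rw [Lp.norm_def]
  exact ENNReal.toReal_le_of_le_ofReal (le_max_right _ _)
    (hΦ₂.le.trans (ENNReal.ofReal_le_ofReal (le_max_left _ _)))

/-- The true evolution of the state stays close to the uncoupled, cut off evolution. -/
theorem norm_sub_cutEvol_le_of_assumptions (he : ‖e‖ = 1) (hα : 1 < α)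
    (hθ : Real.cos (2 * θ₀) < Real.cos θ₀) (hd : 1 ≤ d) {A : ℝ} (hA : 0 ≤ A)
    (hA' : ∀ δ t : ℝ, 1 ≤ δ → 0 ≤ t →
      (max (δ / 2) ((Real.cos θ₀ - Real.cos (2 * θ₀)) / 2 * v * t)) ^ (-α) ≤
        A * δ ^ ((1 - α) / 2) * (1 + t) ^ (-min 2 ((1 + α) / 2)) ∧
      (δ / 2) ^ (-α) * (1 + t) ^ (-2 : ℝ) ≤
        A * δ ^ ((1 - α) / 2) * (1 + t) ^ (-min 2 ((1 + α) / 2)))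
    {z : ι → Spinor ℂ} (hz : ∀ i, ‖z i‖ ≤ 1) {g : ι → 𝓢(Space3, ℂ)}
    (hg₁ : ∀ i, ‖(g i).toLp 2 (volume : Measure Space3)‖ ≤ 1)
    (hg : Orthonormal ℂ fun i => withSpin ((g i).toLp 2 volume) (z i)) {κ₁ κ₂ : ι → ℝ}
    (hκ₁ : ∀ i, 0 ≤ κ₁ i) (hκ₁' : ∀ i, ∀ t : ℝ, 0 ≤ t → ∃ r : 𝓢(Space3, ℂ),
      ‖r.toLp 2 (volume : Measure Space3)‖ ≤ κ₁ i * (1 + t) ^ (-2 : ℝ) ∧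
      ∀ x, ¬ (x ∈ cone e θ₀ ∧ v * t ≤ ‖x‖) → ‖freeEvol t (g i) x‖ ≤ ‖r x‖)
    {w : Space3 → ℝ} {w₁ w₂ : Fin 3 → Space3 → ℝ} {B₁ B₂ : ℝ} (hw : IsCutoff w w₁ w₂ B₁ B₂)
    (hw₀ : ∀ x, d / 2 < Metric.infDist x (cone e (2 * θ₀)) → w x = 0) {ρ : ℝ} (hρ : 0 < ρ)
    (hwρ : ∀ x, w x ≠ 1 → ρ ≤ ‖x‖)
    (hκ₂ : ∀ i, ∀ t : ℝ, 0 ≤ t → ‖(schwartzHam (cutMul w (freeEvol t (g i))) -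
      cutMul w (schwartzHam (freeEvol t (g i)))).toLp 2 (volume : Measure Space3)‖ ≤
        κ₂ i * (B₁ + B₂) * (1 + t) ^ (-2 : ℝ))
    {p : ι → K} (hW : IsTimeEvolution S.HQ W) (hU : IsTimeEvolution S.H U)
    (hp : tensSum z p g ∈ productDomain S.HQ) (hp₁ : ‖tensSum z p g‖ = 1)
    (h₁ : AssumptionA1 S L e θ₀ d α β C₁ M) (h₃ : AssumptionA3 L W (tensSum z p g) C₂)
    {t : ℝ} (ht : 0 ≤ t) :
    ‖U t (tensSum z p g) - cutEvol W w z p g t‖ ≤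
      (∑ i, ‖(cutMul (fun x => ‖x‖ ^ 2) (g i)).toLp 2 (volume : Measure Space3)‖) * (ρ ^ 2)⁻¹ +
      ((∑ i, κ₂ i) * (B₁ + B₂) + max C₂ 0 * A * (∑ i, (1 + κ₁ i)) * (C₁ * d ^ (-β))) /
        (min 2 ((1 + α) / 2) - 1) := by
  -- Recovering the coefficients as partial inner products of the unit vector Ψ₀ puts them in the
  -- domain of H_Q with norm at most 1, independently of the filter.
  have hpi : ∀ i, slice (withSpin ((g i).toLp 2 volume) (z i)) (tensSum z p g) = p i :=
    slice_sum_tens hg p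
  have hpd : ∀ i, p i ∈ S.HQ.domain := fun i => by
    rw [← hpi i]
    exact slice_mem_domain _ hp
  have hp1 : ∀ i, ‖p i‖ ≤ 1 := fun i => by
    have h := norm_slice_le (withSpin ((g i).toLp 2 volume) (z i)) (tensSum z p g)
    rwa [hpi, hp₁, hg.1 i, one_mul] at h
  have hγ : 1 < min 2 ((1 + α) / 2) := lt_min (by norm_num) (by linarith)
  have h := norm_sub_cutEvol_le hW hU hw hz hpd hp1 g hκ₂ hγ (min_le_left _ _)
    (B := max C₂ 0 * A * (∑ i, (1 + κ₁ i)) * (C₁ * d ^ (-β))) (fun s hs => ?_) ht (tensSum z p g)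
  · rw [← Finset.sum_mul] at h
    refine h.trans (add_le_add_left ?_ _)
    have h4 : tensSum z p g - cutEvol W w z p g 0 = tensSum z p fun i => g i - cutMul w (g i) := by
      simp only [cutEvol, hW.apply_zero, freeEvol_zero]
      exact (map_sub (tensSumₗ z p) g fun i => cutMul w (g i)).symm
    rw [h4, Finset.sum_mul]
    refine (norm_tensSum_le _ _ _).trans (Finset.sum_le_sum fun i _ => ?_)
    rw [mul_assoc, mul_comm _ (ρ ^ 2)⁻¹]
    exact (mul_le_of_le_one_right (norm_nonneg _) (mul_le_one₀ (hz i) (norm_nonneg _)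
      (hp1 i))).trans (norm_toLp_sub_cutMul_le hw hρ hwρ (g i))
  · choose r hr hr' using fun i => hκ₁' i s hs
    refine h₁.norm_HPQ_le he hα hθ hd hs hA hA' (le_max_right _ _) hw.growth (fun x => ?_) hw₀ hz
      (fun i => hW.apply_mem_domain (hpd i) s) (fun n hn i => h₃.exists_mem_graph hg hn hs i) hr'
      (fun i => ?_) hr hκ₁
    · rw [abs_of_nonneg (hw.nonneg x)]
      exact hw.le_one x
    · rw [norm_toLp_freeEvol]
      exact hg₁ i

end Estimate

/-- A point which is close, after rescaling, to a point of a set. -/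
theorem infDist_le_of_dist_smul_le {T : Set Space3} {r R : ℝ} (hr : 0 < r) {x y : Space3}
    (hy : r⁻¹ • y ∈ T) (h : dist (r • x) y ≤ R) : Metric.infDist x T ≤ R / r := by
  refine (Metric.infDist_le_dist_of_mem hy).trans ?_
  have h1 : y = r • r⁻¹ • y := by rw [smul_smul, mul_inv_cancel₀ hr.ne', one_smul]
  rw [h1, dist_smul₀, Real.norm_of_nonneg hr.le] at h
  rwa [le_div_iff₀ hr, mul_comm]

theorem orthonormal_withSpin_spinVec {N : ℕ} {g : Fin N → 𝓢(Space3, ℂ)}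
    (hg : Orthonormal ℂ fun l => (g l).toLp 2 (volume : Measure Space3)) :
    Orthonormal ℂ fun i : Fin N × Fin 2 =>
      withSpin ((g i.1).toLp 2 volume) (spinVec i.2) := by
  refine orthonormal_iff_ite.2 fun i j => ?_
  rw [inner_withSpin, orthonormal_iff_ite.1 hg, inner_spinVec]
  by_cases h₁ : i.1 = j.1 <;> by_cases h₂ : i.2 = j.2 <;> simp [h₁, h₂, Prod.ext_iff]

/-- Regrouped by j, the comparison state is again a singlet sum: the wave functions become
combinations of cut off free packets, and the states of Q remain orthonormal under W t. -/
theorem spinExpectation_cutEvol {K : Type*} [NormedAddCommGroup K] [InnerProductSpace ℂ K]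
    {A : K →ₗ.[ℂ] K} {W : ℝ → K →L[ℂ] K} (hW : IsTimeEvolution A W) {n N : ℕ}
    {q : Fin n → Fin 2 → K}
    (hq : ∀ j s j' s', ⟪q j s, q j' s'⟫_ℂ = if j = j' ∧ s = s' then 1 else 0)
    (c : Fin n → Fin N → ℂ) (g : Fin N → 𝓢(Space3, ℂ)) (w : Space3 → ℝ) (t : ℝ) :
    spinExpectation (cutEvol W w (fun i : Fin N × Fin 2 => spinVec i.2) (entangledPart c q)
      (fun i => g i.1) t) = 0 := by
  have h := sum_tens_entangledPart c (fun j s => W t (q j s))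
    fun l => (cutMul w (freeEvol t (g l))).toLp 2 volume
  simp only [← map_entangledPart] at h
  rw [cutEvol, tensSum, h]
  refine spinExpectation_singlet _ (fun j s => W t (q j s)) (fun j s j' s' => ?_) _
  rw [hW.inner_map, hq]

/-- The error terms are small for large `d`. -/
theorem exists_forall_error_lt {β δ η : ℝ} (R B X κ D C γ : ℝ) (hβ : 0 < β) (hη : 0 < η) :
    ∃ d₀ : ℝ, ∀ d, d₀ ≤ d → ∀ ε, 0 ≤ ε →
      ε ≤ X * ((δ / (R / d)) ^ 2)⁻¹ +
        (κ * (R / d * B + R / d * (R / d * B)) + D * (C * d ^ (-β))) / γ →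
      ∀ s, s ≤ 3 * ((1 + (1 + ε)) * ε) → s < η := by
  set f : ℝ → ℝ := fun d => X * ((δ / (R / d)) ^ 2)⁻¹ +
    (κ * (R / d * B + R / d * (R / d * B)) + D * (C * d ^ (-β))) / γ with hf
  have hε : Tendsto f atTop (𝓝 0) := by
    have h1 : Tendsto (fun d : ℝ => R / d) atTop (𝓝 0) := tendsto_const_nhds.div_atTop tendsto_id
    have h2 : Tendsto (fun d : ℝ => d ^ (-β)) atTop (𝓝 0) := tendsto_rpow_neg_atTop hβ
    have h3 : Tendsto (fun d : ℝ => ((δ / (R / d)) ^ 2)⁻¹) atTop (𝓝 0) := by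
      have h4 := (h1.div_const δ).pow 2
      simp only [zero_div, ne_eq, OfNat.ofNat_ne_zero, not_false_eq_true, zero_pow] at h4
      refine h4.congr fun d => ?_
      rw [← inv_pow, inv_div]
    have h5 := (h3.const_mul X).add (((((h1.mul_const B).add (h1.mul (h1.mul_const B))).const_mul
      κ).add ((h2.const_mul C).const_mul D)).div_const γ)
    simpa using h5
  have hε' : Tendsto (fun d => 3 * ((1 + (1 + f d)) * f d)) atTop (𝓝 0) := by
    simpa using ((((hε.const_add 1).const_add 1).mul hε).const_mul 3)
  obtain ⟨d₀, hd₀⟩ := eventually_atTop.1 (hε'.eventually_lt_const hη)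
  refine ⟨d₀, fun d hd ε h0 hle s hs => hs.trans_lt (lt_of_le_of_lt ?_ (hd₀ d hd))⟩
  have hle' : ε ≤ f d := hle
  exact mul_le_mul_of_nonneg_left (mul_le_mul (by linarith) hle' h0 (by linarith)) (by norm_num)

theorem mainTheorem2 (e : Space3) (he : ‖e‖ = 1) (θ₀ : ℝ) (hθ₀ : 0 < θ₀)
    (hθ₀' : θ₀ < Real.pi / 4) (v : ℝ) (hv : 0 < v) (α : ℝ) (hα : 1 < α) (β : ℝ) (hβ : 0 < β)
    (C₁ C₂ M : ℝ) (n : ℕ) (φ : Fin n → Lp ℂ 2 (volume : Measure Space3))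
    (hφ : ∀ j, ‖φ j‖ = 1) (η : ℝ) (hη : 0 < η) :
    ∃ d₀ : ℝ, 0 < d₀ ∧
      ∀ (HD : Type*) [NormedAddCommGroup HD] [InnerProductSpace ℂ HD] [CompleteSpace HD]
        [TopologicalSpace.SeparableSpace HD]
        (ψ : Fin n → Lp ℂ 2 (volume : Measure Space3)) (χ : Fin n → HD)
        (S : CoupledSystem (SpinL2 HD)) (L : RegionData (SpinL2 HD)) (d : ℝ)
        (W : ℝ → SpinL2 HD →L[ℂ] SpinL2 HD)
        (U : ℝ → SpinL2 (SpinL2 HD) →L[ℂ] SpinL2 (SpinL2 HD)),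
        (∀ j, ‖ψ j‖ = 1) → Orthonormal ℂ χ →
        IsTimeEvolution S.HQ W → IsTimeEvolution S.H U →
        singletState φ ψ χ ∈ productDomain S.HQ →
        AssumptionA1 S L e θ₀ d α β C₁ M →
        AssumptionA2 (singletState φ ψ χ) e θ₀ v →
        AssumptionA3 L W (singletState φ ψ χ) C₂ →
        d₀ < d →
        ∀ t : ℝ, 0 ≤ t → ‖spinExpectation (U t (singletState φ ψ χ))‖ < η := by
  -- This property involves only the φ j, so d₀ may depend on it. Where it fails, (A2) fails for
  -- every choice of Q and any d₀ will do.
  by_cases hφs : ∀ j, ∃ f : 𝓢(Space3, ℂ), φ j = f.toLp 2 volume ∧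
      ∀ ξ ∉ outgoingSet e θ₀ v, 𝓕 f ξ = 0
  swap
  · refine ⟨1, one_pos, fun HD _ _ _ _ ψ χ S L d W U hψ hχ _ _ _ _ h₂ _ _ _ _ => ?_⟩
    exact absurd (h₂.exists_schwartz (inner_filterState hψ hχ) (singletState_eq φ ψ χ)) hφs
  obtain ⟨N, g, c, hg, hgs, hφg⟩ := exists_orthonormal_schwartz φ _ hφs
  have hcos : Real.cos (2 * θ₀) < Real.cos θ₀ :=
    Real.cos_lt_cos_of_nonneg_of_le_pi_div_two hθ₀.le (by linarith) (by linarith)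
  have hcos0 : 0 < Real.cos (2 * θ₀) :=
    Real.cos_pos_of_mem_Ioo ⟨by linarith [Real.pi_pos], by linarith⟩
  have hcos1 : Real.cos (2 * θ₀) < 1 := hcos.trans_le (Real.cos_le_one _)
  obtain ⟨w, w₁, w₂, B, R, δ, hB, hR, hδ, hw, hw_one, hw_supp, hw_far⟩ :=
    exists_cutoff e he _ hcos0 hcos1
  obtain ⟨A, hA, hA'⟩ := exists_rpow_bound hα
    (c := (Real.cos θ₀ - Real.cos (2 * θ₀)) / 2 * v) (by
      have : 0 < Real.cos θ₀ - Real.cos (2 * θ₀) := by linarith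
      positivity)
  choose κ₁ hκ₁ hκ₁' using fun l => exists_propagation_bound (hgs l)
  choose κ₂ hκ₂ hκ₂' using fun l => exists_commutator_bound (hgs l)
  let G : Fin N × Fin 2 → 𝓢(Space3, ℂ) := fun i => g i.1
  let z : Fin N × Fin 2 → Spinor ℂ := fun i => spinVec i.2
  have hGz : Orthonormal ℂ fun i => withSpin ((G i).toLp 2 volume) (z i) :=
    orthonormal_withSpin_spinVec hg
  obtain ⟨d₀, hd₀⟩ := exists_forall_error_lt (δ := δ) (2 * R) B
    (∑ i, ‖(cutMul (fun x => ‖x‖ ^ 2) (G i)).toLp 2 (volume : Measure Space3)‖)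
    (∑ i : Fin N × Fin 2, κ₂ i.1) (max C₂ 0 * A * (∑ i : Fin N × Fin 2, (1 + κ₁ i.1))) C₁
    (min 2 ((1 + α) / 2) - 1) hβ hη
  refine ⟨max d₀ 1, by positivity, fun HD _ _ _ _ ψ χ S L d W U hψ hχ hW hU hdom h₁ h₂ h₃ hd t ht =>
    ?_⟩
  have hd1 : 1 ≤ d := (le_max_right _ _).trans hd.le
  have hd0 : 0 < d := by linarith
  let p : Fin N × Fin 2 → SpinL2 HD := entangledPart c (filterState ψ χ)
  have hΨ : singletState φ ψ χ = tensSum z p G := by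
    have h := sum_tens_entangledPart c (filterState ψ χ) fun l => (g l).toLp 2 volume
    simp only [← hφg] at h
    exact h.symm
  have hnorm := h₂.norm_eq_one
  rw [hΨ] at hdom h₃ hnorm ⊢
  -- Dilation by 2R/d turns the support radius R into d/2 and the radius δ around the vertex into a
  -- multiple of d, while the derivatives pick up factors of 1/d.
  have hr : 0 < 2 * R / d := by positivity
  have hcut := hw.comp_smul hr.le
  have key := norm_sub_cutEvol_le_of_assumptions (ρ := δ / (2 * R / d)) (κ₁ := fun i => κ₁ i.1)
    (κ₂ := fun i => κ₂ i.1) he hα hcos hd1 hA hA'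
    (z := z) (fun i => (norm_spinVec i.2).le) (g := G) (fun i => (hg.1 i.1).le) hGz
    (fun i => hκ₁ i.1) (fun i => hκ₁' i.1) hcut (fun x hx => ?_) (by positivity)
    (fun x hx => ?_) (fun i t ht => ?_) hW hU hdom hnorm h₁ h₃ ht
  · have hzero : spinExpectation (cutEvol W (fun x => w ((2 * R / d) • x)) z p G t) = 0 :=
      spinExpectation_cutEvol hW (inner_filterState hψ hχ) c g _ t
    refine hd₀ d ((le_max_left _ _).trans hd.le) _ (norm_nonneg _) key _ ?_
    refine (norm_spinExpectation_le_of_eq_zero hzero).trans ?_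
    have h4 : ‖U t (tensSum z p G)‖ = 1 := by rw [hU.norm_map, hnorm]
    have h5 := norm_sub_norm_le (cutEvol W (fun x => w ((2 * R / d) • x)) z p G t)
      (U t (tensSum z p G))
    rw [norm_sub_rev, h4] at h5
    rw [h4]
    exact mul_le_mul_of_nonneg_left (mul_le_mul_of_nonneg_right (by linarith) (norm_nonneg _))
      (by norm_num)
  · by_contra hne
    obtain ⟨y, hy, hy'⟩ := hw_supp _ hne
    have hy2 : (2 * R / d)⁻¹ • y ∈ cone e (2 * θ₀) := (smul_mem_cone (inv_pos.2 hr)).2 hy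
    have h7 := infDist_le_of_dist_smul_le hr hy2 hy'
    have h8 : R / (2 * R / d) = d / 2 := by
      field_simp
    linarith
  · have h4 := hw_far _ hx
    rw [norm_smul, Real.norm_of_nonneg hr.le] at h4
    rw [div_le_iff₀ hr, mul_comm]
    exact h4
  · refine hκ₂' i.1 _ _ _ _ _ hcut (fun x hx j => ?_) t ht
    have h4 : (2 * R / d) • x ∈ cone e θ₀ := (smul_mem_cone hr).2 hx
    -- The packet moves in the cone of angle θ₀, inside the cone of angle 2θ₀ on which the
    -- derivatives of the cutoff vanish.
    have h5 : ‖(2 * R / d) • x‖ * Real.cos (2 * θ₀) ≤ ⟪(2 * R / d) • x, e⟫_ℝ :=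
      (mul_le_mul_of_nonneg_left hcos.le (norm_nonneg _)).trans h4
    obtain ⟨-, h6⟩ := hw_one _ h5
    simp [h6 j]

end Main

end
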